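/- Let $E>0$ and $-1<\nu<\tfrac12$, and let $\Omega\subset\mathbb R^2$ be open, bounded and simply connected with boundary of class $C^2$. Let $x^1,\dots,x^J\in\Omega$ be distinct points, let $b^1,\dots,b^J\in\mathbb R^2\setminus\{0\}$, put $\alpha=\sum_{j=1}^J b^j\delta_{x^j}$, and let $R>0$ be such that $\overline\Omega\subset B_R(x^j)$ for every $j$. Write $\Pi(b)=(b_2,-b_1)$ for $b=(b_1,b_2)$. For $0<\varepsilon<R$ and $s>0$ let $$W^{s}_{0,\varepsilon}(y)=\frac{s}{16\pi}\frac{E}{1-\nu^2}\Big(\alpha_\varepsilon+\frac{\beta_\varepsilon}{|y|^2}+\gamma_\varepsilon|y|^2+2\log|y|^2\Big)y_1\quad\text{if } |y|\ge\varepsilon,$$ $$W^{s}_{0,\varepsilon}(y)=\frac{s}{16\pi}\frac{E}{1-\nu^2}\Big(\alpha_\varepsilon+\frac{\beta_\varepsilon}{\varepsilon^2}+\varepsilon^2\gamma_\varepsilon+4\log\varepsilon\Big)y_1\quad\text{if } |y|<\varepsilon,$$ where $\alpha_\varepsilon=2\frac{R^2-\varepsilon^2}{R^2+\varepsilon^2}-2\log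 R^2$, $\beta_\varepsilon=2\varepsilon^2\frac{R^2}{R^2+\varepsilon^2}$, $\gamma_\varepsilon=-\frac{2}{R^2+\varepsilon^2}$. Set $$W_\varepsilon^\alpha(x)=\sum_{j=1}^J W_{0,\varepsilon}^{|b^j|}\Big(\Big\langle\tfrac{\Pi(b^j)}{|b^j|},x-x^j\Big\rangle,\Big\langle\tfrac{b^j}{|b^j|},x-x^j\Big\rangle\Big),$$ $$W_0^\alpha(x)=\sum_{j=1}^J\frac{|b^j|}{8\pi}\frac{E}{1-\nu^2}\Big((1-\log R^2)-\frac{|x-x^j|^2}{R^2}+\log|x-x^j|^2\Big)\Big\langle\tfrac{\Pi(b^j)}{|b^j|},x-x^j\Big\rangle.$$ Let $\widetilde{\mathscr B}^\alpha_{\varepsilon,\Omega}$ be the set of functions $\widetilde w$ on $\Omega$ such that $\widetilde w+W_\varepsilon^\alpha\in H^2_0(\Omega)$ and, for each $j$, $\widetilde w+W_\varepsilon^\alpha$ coincides a.e. in $B_\varepsilon(x^j)$ with an affine function. Here $H^2_0(\Omega)$ is the closure of $C_c^\infty(\Omega)$ in $H^2(\Omega)$. Then for every $w\in H^2(\Omega)$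 with $w=-W_0^\alpha$ and $\partial_n w=-\partial_n W_0^\alpha$ on $\partial\Omega$ in the sense of traces ($n$ the outer unit normal, $\partial_n w=\langle\mathrm{Tr}(\nabla w),n\rangle$) there is a family $(w_\varepsilon)_{\varepsilon>0}\subset H^2(\Omega)$ such that $w_\varepsilon\in\widetilde{\mathscr B}^\alpha_{\varepsilon,\Omega}$ for all sufficiently small $\varepsilon>0$, and $w_\varepsilon\to w$ strongly in $H^2(\Omega)$ as $\varepsilon\to0$. In particular, for all sufficiently small $\varepsilon>0$, $w_\varepsilon+W_\varepsilon^\alpha$ is affine in each core $B_\varepsilon(x^j)$ and satisfies $w_\varepsilon+W_\varepsilon^\alpha=\partial_n(w_\varepsilon+W_\varepsilon^\alpha)=0$ on $\partial\Omega$ in the sense of traces. -/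

import Mathlib

open Filter Topology MeasureTheory
open scoped ENNReal ContDiff

noncomputable section

/-- The Euclidean plane `ℝ²`. -/
abbrev Plane : Type := EuclideanSpace ℝ (Fin 2)

/-! ### Sobolev spaces `H¹(Ω)`, `H²(Ω)`, `H²₀(Ω)` through weak derivatives -/

/-- The classical partial derivative `∂ᵢ φ`. -/
def pderiv (i : Fin 2) (φ : Plane → ℝ) (x : Plane) : ℝ :=
  fderiv ℝ φ x (EuclideanSpace.single i 1)

/-- Test functions: `φ ∈ C_c^∞(Ω)`. -/
structure IsTestFunction (Ω : Set Plane) (φ : Plane → ℝ) : Prop where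
  smooth : ContDiff ℝ ∞ φ
  compact : HasCompactSupport φ
  support : tsupport φ ⊆ Ω

/-- `g` is the weak partial derivative `∂ᵢ u` in the open set `Ω`. -/
structure IsWeakPartial (Ω : Set Plane) (i : Fin 2) (u g : Plane → ℝ) : Prop where
  locInt : LocallyIntegrableOn u Ω
  locInt' : LocallyIntegrableOn g Ω
  byParts : ∀ φ, IsTestFunction Ω φ →
    ∫ x in Ω, u x * pderiv i φ x = - ∫ x in Ω, g x * φ x

/-- `u ∈ H¹(Ω)`. -/
def MemH1 (Ω : Set Plane) (u : Plane → ℝ) : Prop :=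
  MemLp u 2 (volume.restrict Ω) ∧
    ∀ i, ∃ g, IsWeakPartial Ω i u g ∧ MemLp g 2 (volume.restrict Ω)

/-- `u ∈ H²(Ω)`. -/
def MemH2 (Ω : Set Plane) (u : Plane → ℝ) : Prop :=
  MemLp u 2 (volume.restrict Ω) ∧ ∀ i, ∃ g, IsWeakPartial Ω i u g ∧ MemH1 Ω g

/-- The norm `(‖u‖² + ∑ᵢ ‖∂ᵢu‖²)^{1/2}` of `H¹(Ω)` (all norms on the right are those of `L²(Ω)`).
Weak derivatives are unique up to null sets, so the infimum runs over one single value; it is `∞`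
if `u` has no weak gradient. -/
def eH1Norm (Ω : Set Plane) (u : Plane → ℝ) : ℝ≥0∞ :=
  ⨅ (G : Fin 2 → Plane → ℝ) (_ : ∀ i, IsWeakPartial Ω i u (G i)),
    (eLpNorm u 2 (volume.restrict Ω) ^ 2
      + ∑ i, eLpNorm (G i) 2 (volume.restrict Ω) ^ 2) ^ (1 / 2 : ℝ)

/-- The norm `(‖u‖² + ∑ᵢ ‖∂ᵢu‖² + ∑ᵢⱼ ‖∂ⱼ∂ᵢu‖²)^{1/2}` of `H²(Ω)`, with the same convention. -/
def eH2Norm (Ω : Set Plane) (u : Plane → ℝ) : ℝ≥0∞ :=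
  ⨅ (G : Fin 2 → Plane → ℝ) (_ : ∀ i, IsWeakPartial Ω i u (G i))
    (H : Fin 2 → Fin 2 → Plane → ℝ) (_ : ∀ i j, IsWeakPartial Ω j (G i) (H i j)),
    (eLpNorm u 2 (volume.restrict Ω) ^ 2
      + ∑ i, eLpNorm (G i) 2 (volume.restrict Ω) ^ 2
      + ∑ i, ∑ j, eLpNorm (H i j) 2 (volume.restrict Ω) ^ 2) ^ (1 / 2 : ℝ)

/-- `u ∈ H²₀(Ω)`: the closure of `C_c^∞(Ω)` in `H²(Ω)`. -/
def MemH20 (Ω : Set Plane) (u : Plane → ℝ) : Prop :=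
  MemH2 Ω u ∧ ∃ φ : ℕ → Plane → ℝ, (∀ k, IsTestFunction Ω (φ k)) ∧
    Tendsto (fun k => eH2Norm Ω (fun x => φ k x - u x)) atTop (𝓝 0)

/-! ### Boundaries and traces -/

/-- `∂Ω` is of class `C^k`: near each boundary point and up to a rigid motion, `Ω` is the strict
subgraph of a `C^k` function. -/
def HasBoundaryOfClass (k : ℕ) (Ω : Set Plane) : Prop :=
  ∀ z ∈ frontier Ω, ∃ r > 0, ∃ (e : Plane ≃ₗᵢ[ℝ] Plane) (ψ : ℝ → ℝ), ContDiff ℝ k ψ ∧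
    Ω ∩ Metric.ball z r = {y | y ∈ Metric.ball z r ∧ (e y) 1 < ψ ((e y) 0)}

/-- `n` is the outer unit normal to `Ω` at `x`: blown up at `x`, the set `Ω` lies in the half plane
`⟪n, ·⟫ ≤ 0` and its complement in `⟪n, ·⟫ ≥ 0`. There is at most one such `n`, and exactly one at
each boundary point if the boundary is of class `C¹`. -/
def IsOuterUnitNormal (Ω : Set Plane) (x n : Plane) : Prop :=
  ‖n‖ = 1 ∧ ∀ δ > 0, ∀ᶠ y in 𝓝 x,
    (y ∈ Ω → inner ℝ n (y - x) ≤ δ * ‖y - x‖) ∧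
    (y ∉ Ω → -(δ * ‖y - x‖) ≤ inner ℝ n (y - x))

/-- Arc length (one-dimensional Hausdorff measure) on `∂Ω`. -/
def boundaryMeasure (Ω : Set Plane) : Measure Plane :=
  (Measure.hausdorffMeasure 1).restrict (frontier Ω)

/-- `u ∈ H¹(Ω)` has trace `g ∈ L²(∂Ω)`. The trace operator is the continuous extension of the
restriction map `C^∞(closure Ω) → L²(∂Ω)` to `H¹(Ω)`; this is its graph. -/
def HasTrace (Ω : Set Plane) (u g : Plane → ℝ) : Prop :=
  MemH1 Ω u ∧ MemLp g 2 (boundaryMeasure Ω) ∧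
    ∃ φ : ℕ → Plane → ℝ, (∀ k, ContDiff ℝ ∞ (φ k)) ∧
      Tendsto (fun k => eH1Norm Ω (fun x => φ k x - u x)) atTop (𝓝 0) ∧
      Tendsto (fun k => eLpNorm (fun x => φ k x - g x) 2 (boundaryMeasure Ω)) atTop (𝓝 0)

/-- For `u ∈ H²(Ω)` and a function `f` that is smooth near `∂Ω`: `u = f` and `∂ₙu = ∂ₙf` on `∂Ω`
in the sense of traces, where `∂ₙu = ∑ᵢ Tr(∂ᵢu) nᵢ`. -/
def HasCauchyData (Ω : Set Plane) (u f : Plane → ℝ) : Prop :=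
  HasTrace Ω u f ∧ ∃ G T : Fin 2 → Plane → ℝ,
    (∀ i, IsWeakPartial Ω i u (G i) ∧ HasTrace Ω (G i) (T i)) ∧
    ∀ᵐ x ∂(boundaryMeasure Ω), ∀ n, IsOuterUnitNormal Ω x n →
      ∑ i, T i x * n i = fderiv ℝ f x n

/-! ### Edge dislocations and their Airy functions -/

/-- A finite system of edge dislocations `α = ∑ⱼ bʲ δ_{xʲ}` in `Ω`: nonzero Burgers vectors at
distinct points of `Ω`. -/
structure EdgeDislocations (Ω : Set Plane) where
  J : ℕ
  b : Fin J → Plane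
  x : Fin J → Plane
  b_ne_zero : ∀ j, b j ≠ 0
  x_mem : ∀ j, x j ∈ Ω
  x_injective : Function.Injective x

/-- The clockwise rotation `Π(b)` of `b` by `π/2`. -/
def clockwise (b : Plane) : Plane := !₂[b 1, -b 0]

/-- The function `W_{0,ε}^s`, with Young modulus `E`, Poisson ratio `ν` and outer radius `R`. It is
linear in the core `‖y‖ < ε`. -/
def airyScalar (E ν R ε s : ℝ) (y : Plane) : ℝ :=
  let α : ℝ := 2 * ((R ^ 2 - ε ^ 2) / (R ^ 2 + ε ^ 2)) - 2 * Real.log (R ^ 2)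
  let β : ℝ := 2 * ε ^ 2 * (R ^ 2 / (R ^ 2 + ε ^ 2))
  let γ : ℝ := -(2 / (R ^ 2 + ε ^ 2))
  if ‖y‖ < ε then
    s / (16 * Real.pi) * (E / (1 - ν ^ 2))
      * (α + β / ε ^ 2 + ε ^ 2 * γ + 4 * Real.log ε) * y 0
  else
    s / (16 * Real.pi) * (E / (1 - ν ^ 2))
      * (α + β / ‖y‖ ^ 2 + γ * ‖y‖ ^ 2 + 2 * Real.log (‖y‖ ^ 2)) * y 0

/-- The function `W_{0,ε}^b` of a dislocation at the origin with Burgers vector `b`: the function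
`W_{0,ε}^{|b|}` in the orthonormal frame `Π(b)/|b|, b/|b|`. -/
def airyVector (E ν R ε : ℝ) (b y : Plane) : ℝ :=
  airyScalar E ν R ε ‖b‖ !₂[inner ℝ (‖b‖⁻¹ • clockwise b) y, inner ℝ (‖b‖⁻¹ • b) y]

/-- `W_ε^α = ∑ⱼ W_ε^j`, with `W_ε^j = W_{0,ε}^{bʲ}(· - xʲ)`. -/
def plasticW {Ω : Set Plane} (α : EdgeDislocations Ω) (E ν R ε : ℝ) (y : Plane) : ℝ :=
  ∑ j, airyVector E ν R ε (α.b j) (y - α.x j)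

/-- `W_0^α = ∑ⱼ W_0^j`, the limit of `W_ε^α` away from the points `xʲ`. -/
def plasticW0 {Ω : Set Plane} (α : EdgeDislocations Ω) (E ν R : ℝ) (y : Plane) : ℝ :=
  ∑ j, ‖α.b j‖ / (8 * Real.pi) * (E / (1 - ν ^ 2))
    * ((1 - Real.log (R ^ 2)) - ‖y - α.x j‖ ^ 2 / R ^ 2 + Real.log (‖y - α.x j‖ ^ 2))
    * inner ℝ (‖α.b j‖⁻¹ • clockwise (α.b j)) (y - α.x j)

/-- The class `B̃^α_{0,Ω}`: functions `w ∈ H²(Ω)` with `w = -W_0^α` and `∂ₙw = -∂ₙW_0^α` on `∂Ω`. -/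
def classB0 {Ω : Set Plane} (α : EdgeDislocations Ω) (E ν R : ℝ) : Set (Plane → ℝ) :=
  {w | MemH2 Ω w ∧ HasCauchyData Ω w (fun y => - plasticW0 α E ν R y)}

/-- The class `B̃^α_{ε,Ω}`: functions `w` with `w + W_ε^α ∈ H²₀(Ω)` and `w + W_ε^α` affine in each
core `B_ε(xʲ)`. -/
def classBε {Ω : Set Plane} (α : EdgeDislocations Ω) (E ν R ε : ℝ) : Set (Plane → ℝ) :=
  {w | MemH20 Ω (fun y => w y + plasticW α E ν R ε y) ∧
    ∀ j, ∃ a : Plane →ᵃ[ℝ] ℝ, ∀ᵐ y ∂(volume.restrict (Metric.ball (α.x j) ε)),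
      w y + plasticW α E ν R ε y = a y}

end

/-!
The given `w` and the required `w_ε` become, after the addition of functions that carry the
boundary data, elements of `H²₀(Ω)`, where test functions are available.

Fix cutoffs `η_j` supported in disjoint balls in `Ω` and equal to one near `xʲ`, and put
`χ_j = 1 - η_j`. The function `F = ∑ⱼ χ_j W_0^j` is smooth on the plane and coincides with `W_0^α`
near `∂Ω`, so that `v = w + F` has vanishing Cauchy data and hence lies in `H²₀(Ω)`
(`MemH2.memH20_of_hasCauchyData_zero`). Suppose `v` is approximated by test functions `ψ_ε` that
are affine in the cores `B_ε(xʲ)` (`MemH20.exists_tendsto_affine_in_balls`). The recovery sequence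
is `w_ε = ψ_ε - ∑ⱼ χ_j W_ε^j`. Then `w_ε + W_ε^α = ψ_ε + ∑ⱼ η_j W_ε^j`. This is affine in the
cores, where `W_ε^j` is linear and `η_j = 1`. It is in `H²₀(Ω)`, because the regularised Airy
function `W_ε^j` is of class `C^{1,1}` (`memH20_mul_airyVector`): its radial factor is stationary
at `|y| = ε`, where the two formulas meet. Finally `w_ε - w = (ψ_ε - v) - ∑ⱼ χ_j (W_ε^j - W_0^j)`
tends to zero in `H²(Ω)`, since the logarithms cancel in `χ_j (W_ε^j - W_0^j)`, which leaves three
fixed smooth functions with coefficients tending to zero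
(`eventually_cutoff_airyVector_sub_bound`).

The test functions `ψ_ε` come from a capacity argument. A smooth `φ` is replaced by its
first-order Taylor polynomial in `B_r(xʲ)` by means of a cutoff at scale `r`. As the remainder is
`O(|y - xʲ|²)`, the error has second derivatives bounded independently of `r`, on a set of area
`O(r²)`, and so is small in `H²` (`exists_testFunction_affine_near`). For each `ε` one then takes
a test function, affine in the cores, whose distance from `v` is almost minimal.

That vanishing Cauchy data imply membership in `H²₀(Ω)` is proved in boundary patches, in which
`Ω` is the subgraph of a `C¹` function. Green's formula (`HasTrace.green`) identifies traces with
the boundary terms in the integration by parts, so that a function with zero trace extends by zero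
to a weakly differentiable function (`HasTrace.isWeakPartial_indicator`). Apply this first to `v`.
Testing with `∂₀∂₁ζ = ∂₁∂₀ζ` shows that the trace of `∇v` has no tangential component
(`tangential_trace_eq_zero`); it has no normal component by assumption, so `∇v` has zero trace
too, and `v` extends by zero to `H²(ℝ²)`. A partition of unity, a small translation of each
boundary piece into `Ω` (`MemH2.memH20_of_support_patch`), and mollification then give the
approximating test functions.
-/

/-! ### Weak partial derivatives -/

theorem continuous_pderiv {φ : Plane → ℝ} (hφ : ContDiff ℝ 1 φ) (i : Fin 2) :
    Continuous (pderiv i φ) :=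
  (hφ.continuous_fderiv one_ne_zero).clm_apply continuous_const

theorem contDiff_pderiv {φ : Plane → ℝ} (hφ : ContDiff ℝ ∞ φ) (i : Fin 2) :
    ContDiff ℝ ∞ (pderiv i φ) :=
  (hφ.fderiv_right (m := ∞) (by norm_cast)).clm_apply contDiff_const

theorem tsupport_pderiv_subset (φ : Plane → ℝ) (i : Fin 2) :
    tsupport (pderiv i φ) ⊆ tsupport φ :=
  tsupport_fderiv_apply_subset ℝ _

theorem pderiv_mul {φ ψ : Plane → ℝ} {x : Plane} (hφ : DifferentiableAt ℝ φ x)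
    (hψ : DifferentiableAt ℝ ψ x) (i : Fin 2) :
    pderiv i (fun y => φ y * ψ y) x = pderiv i φ x * ψ x + φ x * pderiv i ψ x := by
  simp only [pderiv, fderiv_fun_mul hφ hψ]
  simp; ring

theorem pderiv_add {φ ψ : Plane → ℝ} {x : Plane} (hφ : DifferentiableAt ℝ φ x)
    (hψ : DifferentiableAt ℝ ψ x) (i : Fin 2) :
    pderiv i (fun y => φ y + ψ y) x = pderiv i φ x + pderiv i ψ x := by
  simp only [pderiv, fderiv_fun_add hφ hψ]
  simp

theorem pderiv_const_mul {φ : Plane → ℝ} {x : Plane} (hφ : DifferentiableAt ℝ φ x) (c : ℝ)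
    (i : Fin 2) : pderiv i (fun y => c * φ y) x = c * pderiv i φ x := by
  simp only [pderiv, fderiv_const_mul hφ]
  simp

theorem pderiv_comm {φ : Plane → ℝ} (hφ : ContDiff ℝ ∞ φ) (i j : Fin 2) (x : Plane) :
    pderiv i (pderiv j φ) x = pderiv j (pderiv i φ) x := by
  have key : ∀ v w : Plane, fderiv ℝ (fun y => fderiv ℝ φ y v) x w
      = fderiv ℝ (fderiv ℝ φ) x w v := by
    intro v w
    have hd : DifferentiableAt ℝ (fderiv ℝ φ) x :=
      ((hφ.fderiv_right (m := ∞) (by norm_cast)).differentiable (by simp)) x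
    rw [fderiv_clm_apply hd (differentiableAt_const v)]
    simp
  have h2 : ContDiff ℝ 2 φ := hφ.of_le (WithTop.coe_le_coe.2 le_top)
  have hs : IsSymmSndFDerivAt ℝ φ x :=
    h2.contDiffAt.isSymmSndFDerivAt (by simp)
  change fderiv ℝ (fun y => fderiv ℝ φ y _) x _ = fderiv ℝ (fun y => fderiv ℝ φ y _) x _
  rw [key, key]
  exact hs _ _

theorem fderiv_eq_sum_pderiv (φ : Plane → ℝ) (x n : Plane) :
    fderiv ℝ φ x n = ∑ i, pderiv i φ x * n i := by
  have : n = ∑ i, n i • (EuclideanSpace.single i (1 : ℝ) : Plane) := by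
    ext j; fin_cases j <;> simp
  conv_lhs => rw [this]
  simp [pderiv, mul_comm]

/-- The factor `2` is the number of coordinates; the constant is not optimal. -/
theorem norm_fderiv_le_of_pderiv {φ : Plane → ℝ} {x : Plane} {C : ℝ} (h : ∀ i, |pderiv i φ x| ≤ C) :
    ‖fderiv ℝ φ x‖ ≤ 2 * C := by
  have hC : 0 ≤ C := (abs_nonneg _).trans (h 0)
  refine ContinuousLinearMap.opNorm_le_bound _ (by positivity) fun n => ?_
  rw [fderiv_eq_sum_pderiv, Fin.sum_univ_two]
  have h0 := PiLp.norm_apply_le n 0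
  have h1 := PiLp.norm_apply_le n 1
  simp only [Real.norm_eq_abs] at h0 h1
  rw [Real.norm_eq_abs]
  calc _ ≤ |pderiv 0 φ x| * |n 0| + |pderiv 1 φ x| * |n 1| := by
        rw [← abs_mul, ← abs_mul]; exact abs_add_le _ _
    _ ≤ C * ‖n‖ + C * ‖n‖ := by gcongr <;> exact h _
    _ = _ := by ring

namespace IsTestFunction

variable {Ω Ω' : Set Plane} {φ ψ : Plane → ℝ}

theorem mono (h : IsTestFunction Ω φ) (hΩ : Ω ⊆ Ω') : IsTestFunction Ω' φ :=
  ⟨h.smooth, h.compact, h.support.trans hΩ⟩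

theorem pderiv (h : IsTestFunction Ω φ) (i : Fin 2) : IsTestFunction Ω (pderiv i φ) :=
  ⟨contDiff_pderiv h.smooth i,
    h.compact.mono' ((subset_tsupport _).trans (tsupport_pderiv_subset φ i)),
    (tsupport_pderiv_subset φ i).trans h.support⟩

theorem mul_left (h : IsTestFunction Ω φ) (hψ : ContDiff ℝ ∞ ψ) :
    IsTestFunction Ω (fun x => ψ x * φ x) :=
  ⟨hψ.mul h.smooth, h.compact.mul_left, (tsupport_mul_subset_right).trans h.support⟩

theorem add (h : IsTestFunction Ω φ) (h' : IsTestFunction Ω ψ) :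
    IsTestFunction Ω (fun x => φ x + ψ x) :=
  ⟨h.smooth.add h'.smooth, h.compact.add h'.compact,
    (tsupport_add φ ψ).trans (Set.union_subset h.support h'.support)⟩

theorem of_eq_zero_off_compact {K : Set Plane} (hK : IsCompact K) (hKΩ : K ⊆ Ω)
    (hφ : ContDiff ℝ ∞ φ) (h0 : ∀ x, x ∉ K → φ x = 0) : IsTestFunction Ω φ := by
  have hs : tsupport φ ⊆ K :=
    closure_minimal (fun x hx => by_contra fun hxK => hx (h0 x hxK)) hK.isClosed
  exact ⟨hφ, HasCompactSupport.of_support_subset_isCompact hK ((subset_tsupport _).trans hs),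
    hs.trans hKΩ⟩

theorem zero : IsTestFunction Ω (fun _ => 0) :=
  of_eq_zero_off_compact isCompact_empty (Set.empty_subset _) contDiff_const (fun _ _ => rfl)

theorem sum {ι : Type*} (s : Finset ι) {φ : ι → Plane → ℝ} (h : ∀ i ∈ s, IsTestFunction Ω (φ i)) :
    IsTestFunction Ω (fun x => ∑ i ∈ s, φ i x) := by
  classical
  induction s using Finset.induction_on with
  | empty => simpa using zero
  | insert a s ha ih =>
    simp only [Finset.sum_insert ha]
    exact (h a (by simp)).add (ih fun i hi => h i (by simp [hi]))

end IsTestFunction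

theorem memLp_two_locallyIntegrableOn {Ω : Set Plane} {u : Plane → ℝ}
    (h : MemLp u 2 (volume.restrict Ω)) : LocallyIntegrableOn u Ω :=
  locallyIntegrableOn_of_locallyIntegrable_restrict (h.locallyIntegrable (by norm_num))

theorem integrable_mul_of_tsupport_subset {Ω : Set Plane} {u ψ : Plane → ℝ}
    (hu : LocallyIntegrableOn u Ω) (hψ : Continuous ψ) (hc : HasCompactSupport ψ)
    (hs : tsupport ψ ⊆ Ω) : Integrable (fun x => u x * ψ x) := by
  have h1 : IntegrableOn u (tsupport ψ) := hu.integrableOn_compact_subset hs hc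
  have h2 : IntegrableOn (fun x => u x * ψ x) (tsupport ψ) :=
    h1.mul_continuousOn hψ.continuousOn hc
  refine (integrableOn_iff_integrable_of_support_subset ?_).1 h2
  intro x hx
  exact subset_tsupport _ (fun h0 => hx (by simp [h0]))

theorem setIntegral_eq_integral_of_tsupport_subset {Ω : Set Plane} {u ψ : Plane → ℝ}
    (hs : tsupport ψ ⊆ Ω) : ∫ x in Ω, u x * ψ x = ∫ x, u x * ψ x :=
  setIntegral_eq_integral_of_forall_compl_eq_zero fun x hx => by
    rw [image_eq_zero_of_notMem_tsupport (fun h => hx (hs h)), mul_zero]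

theorem locallyIntegrableOn_congr_ae {Ω : Set Plane} {a b : Plane → ℝ}
    (ha : LocallyIntegrableOn a Ω)
    (hab : a =ᵐ[volume.restrict Ω] b) : LocallyIntegrableOn b Ω := by
  intro x hx
  obtain ⟨s, hs, hi⟩ := ha x hx
  refine ⟨s ∩ Ω, inter_mem hs self_mem_nhdsWithin, ?_⟩
  exact (hi.mono_set Set.inter_subset_left).congr_fun_ae
    (ae_restrict_of_ae_restrict_of_subset Set.inter_subset_right hab)

namespace IsWeakPartial

variable {Ω Ω' : Set Plane} {i : Fin 2} {u v g h : Plane → ℝ}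

theorem integrable_mul (hu : LocallyIntegrableOn u Ω) {φ : Plane → ℝ} (hφ : IsTestFunction Ω φ) :
    Integrable (fun x => u x * φ x) (volume.restrict Ω) :=
  (integrable_mul_of_tsupport_subset hu hφ.smooth.continuous hφ.compact
    hφ.support).integrableOn

theorem add (hu : IsWeakPartial Ω i u g) (hv : IsWeakPartial Ω i v h) :
    IsWeakPartial Ω i (fun x => u x + v x) (fun x => g x + h x) := by
  refine ⟨hu.locInt.add hv.locInt, hu.locInt'.add hv.locInt', fun φ hφ => ?_⟩
  simp only [add_mul]
  rw [integral_add (integrable_mul hu.locInt (hφ.pderiv i))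
      (integrable_mul hv.locInt (hφ.pderiv i)),
    integral_add (integrable_mul hu.locInt' hφ) (integrable_mul hv.locInt' hφ),
    hu.byParts φ hφ, hv.byParts φ hφ]
  ring

theorem const_mul (c : ℝ) (hu : IsWeakPartial Ω i u g) :
    IsWeakPartial Ω i (fun x => c * u x) (fun x => c * g x) := by
  refine ⟨hu.locInt.smul c, hu.locInt'.smul c, fun φ hφ => ?_⟩
  simp only [mul_assoc]
  rw [integral_const_mul, integral_const_mul, hu.byParts φ hφ]
  ring

theorem neg (hu : IsWeakPartial Ω i u g) : IsWeakPartial Ω i (fun x => - u x) (fun x => - g x) := by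
  simpa using hu.const_mul (-1)

theorem sub (hu : IsWeakPartial Ω i u g) (hv : IsWeakPartial Ω i v h) :
    IsWeakPartial Ω i (fun x => u x - v x) (fun x => g x - h x) := by
  simpa [sub_eq_add_neg] using hu.add hv.neg

theorem zero : IsWeakPartial Ω i (fun _ => 0) (fun _ => 0) :=
  ⟨locallyIntegrableOn_zero, locallyIntegrableOn_zero, fun φ _ => by simp⟩

theorem mono (hu : IsWeakPartial Ω i u g) (hΩ : Ω' ⊆ Ω) : IsWeakPartial Ω' i u g := by
  refine ⟨hu.locInt.mono_set hΩ, hu.locInt'.mono_set hΩ, fun φ hφ => ?_⟩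
  have := hu.byParts φ (hφ.mono hΩ)
  rwa [setIntegral_eq_integral_of_tsupport_subset ((hφ.mono hΩ).pderiv i).support,
    setIntegral_eq_integral_of_tsupport_subset (hφ.mono hΩ).support,
    ← setIntegral_eq_integral_of_tsupport_subset (hφ.pderiv i).support,
    ← setIntegral_eq_integral_of_tsupport_subset hφ.support] at this

theorem congr_ae (hu : IsWeakPartial Ω i u g)
    (huv : u =ᵐ[volume.restrict Ω] v) (hgh : g =ᵐ[volume.restrict Ω] h) :
    IsWeakPartial Ω i v h := by
  refine ⟨locallyIntegrableOn_congr_ae hu.locInt huv, locallyIntegrableOn_congr_ae hu.locInt' hgh,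
    fun φ hφ => ?_⟩
  rw [integral_congr_ae (g := fun x => u x * _root_.pderiv i φ x)
      (huv.mono fun x hx => by simp [hx]),
    integral_congr_ae (f := fun x => h x * φ x) (g := fun x => g x * φ x)
      (hgh.mono fun x hx => by simp [hx])]
  exact hu.byParts φ hφ

theorem congr (hΩ : MeasurableSet Ω) (hu : IsWeakPartial Ω i u g) (huv : Set.EqOn u v Ω)
    (hgh : Set.EqOn g h Ω) : IsWeakPartial Ω i v h :=
  hu.congr_ae ((ae_restrict_mem hΩ).mono huv) ((ae_restrict_mem hΩ).mono hgh)

theorem ae_eq (hΩ : IsOpen Ω) (hg : IsWeakPartial Ω i u g) (hh : IsWeakPartial Ω i u h) :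
    g =ᵐ[volume.restrict Ω] h := by
  have := hΩ.ae_eq_zero_of_integral_contDiff_smul_eq_zero (μ := volume)
    (hg.locInt'.sub hh.locInt') (fun φ h1 h2 h3 => by
      have hφ : IsTestFunction Ω φ := ⟨h1, h2, h3⟩
      have e1 := hg.byParts φ hφ
      have e2 := hh.byParts φ hφ
      have e3 : ∫ x in Ω, g x * φ x = ∫ x in Ω, h x * φ x := by linarith
      rw [setIntegral_eq_integral_of_tsupport_subset h3,
        setIntegral_eq_integral_of_tsupport_subset h3] at e3
      have i1 := integrable_mul_of_tsupport_subset hg.locInt' h1.continuous h2 h3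
      have i2 := integrable_mul_of_tsupport_subset hh.locInt' h1.continuous h2 h3
      rw [← sub_eq_zero, ← integral_sub i1 i2] at e3
      rw [← e3]
      congr 1; ext x; simp; ring)
  rw [Filter.EventuallyEq, ae_restrict_iff' hΩ.measurableSet]
  filter_upwards [this] with x hx hxΩ
  have := hx hxΩ
  simp only [Pi.sub_apply] at this
  linarith

theorem of_contDiff (hu : ContDiff ℝ 1 u) : IsWeakPartial Ω i u (pderiv i u) := by
  refine ⟨hu.continuous.locallyIntegrable.locallyIntegrableOn _,
    (continuous_pderiv hu i).locallyIntegrable.locallyIntegrableOn _, fun φ hφ => ?_⟩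
  rw [setIntegral_eq_integral_of_tsupport_subset (hφ.pderiv i).support,
    setIntegral_eq_integral_of_tsupport_subset hφ.support]
  have hc := hφ.smooth.continuous
  exact integral_mul_fderiv_eq_neg_fderiv_mul_of_integrable
    (((continuous_pderiv hu i).mul hc).integrable_of_hasCompactSupport hφ.compact.mul_left)
    ((hu.continuous.mul (hφ.pderiv i).smooth.continuous).integrable_of_hasCompactSupport
      (hφ.pderiv i).compact.mul_left)
    ((hu.continuous.mul hc).integrable_of_hasCompactSupport hφ.compact.mul_left)
    (fun x _ => hu.differentiable one_ne_zero x)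
    (fun x _ => hφ.smooth.differentiable (by simp) x)

/-- The Leibniz rule for a smooth and a weakly differentiable factor. -/
theorem mul_smooth {η : Plane → ℝ} (hη : ContDiff ℝ ∞ η) (hu : IsWeakPartial Ω i u g) :
    IsWeakPartial Ω i (fun x => η x * u x) (fun x => pderiv i η x * u x + η x * g x) := by
  have hL : ∀ {w : Plane → ℝ} {κ : Plane → ℝ}, Continuous κ → LocallyIntegrableOn w Ω →
      LocallyIntegrableOn (fun x => κ x * w x) Ω := by
    intro w κ hκ hw x hx
    obtain ⟨s, hs, hi⟩ := hw x hx
    have hB : Metric.closedBall x 1 ∈ 𝓝[Ω] x :=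
      mem_nhdsWithin_of_mem_nhds (Metric.closedBall_mem_nhds x one_pos)
    refine ⟨Metric.closedBall x 1 ∩ s, inter_mem hB hs, ?_⟩
    have hi' := hi.mono_set (Set.inter_subset_right (s := Metric.closedBall x 1))
    obtain ⟨C, hC⟩ := (isCompact_closedBall x 1).exists_bound_of_continuousOn hκ.continuousOn
    refine Integrable.bdd_mul (c := C) hi' hκ.aestronglyMeasurable ?_
    refine ae_restrict_of_ae_restrict_of_subset Set.inter_subset_left
      ((ae_restrict_mem Metric.isClosed_closedBall.measurableSet).mono fun y hy => hC y hy)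
  have hη1 : ContDiff ℝ 1 η := hη.of_le (by norm_cast)
  refine ⟨hL hη.continuous hu.locInt, (hL (continuous_pderiv hη1 i) hu.locInt).add
    (hL hη.continuous hu.locInt'), fun φ hφ => ?_⟩
  have h1 := hu.byParts _ (hφ.mul_left hη)
  have hd : ∀ x, pderiv i (fun y => η y * φ y) x = pderiv i η x * φ x + η x * pderiv i φ x :=
    fun x => pderiv_mul (hη.differentiable (by simp) x) (hφ.smooth.differentiable (by simp) x) i
  simp only [hd, mul_add] at h1
  have i1 := integrable_mul hu.locInt (hφ.mul_left (contDiff_pderiv hη i))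
  have i2 := integrable_mul hu.locInt ((hφ.pderiv i).mul_left hη)
  have i3 := integrable_mul hu.locInt' (hφ.mul_left hη)
  rw [integral_add i1 i2] at h1
  have e1 : ∫ x in Ω, η x * u x * pderiv i φ x = ∫ x in Ω, u x * (η x * pderiv i φ x) := by
    congr 1; ext x; ring
  have e2 : ∫ x in Ω, (pderiv i η x * u x + η x * g x) * φ x
      = ∫ x in Ω, (u x * (pderiv i η x * φ x) + g x * (η x * φ x)) := by
    congr 1; ext x; ring
  rw [e1, e2, integral_add i1 i3]
  linarith

/-- Weak partial derivatives commute. -/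
theorem comm {G : Fin 2 → Plane → ℝ} {i j : Fin 2} (hG : ∀ k, IsWeakPartial Ω k u (G k))
    (hg : IsWeakPartial Ω j (G i) g) : IsWeakPartial Ω i (G j) g := by
  refine ⟨(hG j).locInt', hg.locInt', fun φ hφ => ?_⟩
  have h1 := hg.byParts φ hφ
  have h2 := (hG i).byParts _ (hφ.pderiv j)
  have h3 := (hG j).byParts _ (hφ.pderiv i)
  have : ∫ x in Ω, u x * _root_.pderiv i (_root_.pderiv j φ) x
      = ∫ x in Ω, u x * _root_.pderiv j (_root_.pderiv i φ) x := by
    congr 1; ext x; rw [pderiv_comm hφ.smooth]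
  linarith

/-- A Lipschitz function has its pointwise partial derivative, which exists almost everywhere, as
weak partial derivative. -/
theorem of_lipschitz {C : NNReal} (hu : LipschitzWith C u) :
    IsWeakPartial Ω i u (fun x => lineDeriv ℝ u x (EuclideanSpace.single i 1)) := by
  have hm : Measurable (fun x => lineDeriv ℝ u x (EuclideanSpace.single i (1 : ℝ))) :=
    measurable_lineDeriv hu.continuous
  refine ⟨hu.continuous.locallyIntegrable.locallyIntegrableOn _, ?_, fun φ hφ => ?_⟩
  · have : LocallyIntegrable (fun _ : Plane => (C : ℝ)) := locallyIntegrable_const _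
    refine LocallyIntegrable.locallyIntegrableOn
      (this.mono hm.aestronglyMeasurable (ae_of_all _ fun x => ?_)) _
    have := norm_lineDeriv_le_of_lipschitz ℝ hu (x₀ := x) (v := EuclideanSpace.single i (1 : ℝ))
    simpa using this
  · obtain ⟨D, hD⟩ := ContDiff.lipschitzWith_of_hasCompactSupport hφ.compact hφ.smooth (by simp)
    rw [setIntegral_eq_integral_of_tsupport_subset (hφ.pderiv i).support,
      setIntegral_eq_integral_of_tsupport_subset hφ.support,
      hu.integral_lineDeriv_mul_eq hD hφ.compact, ← integral_neg]
    congr 1; ext x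
    rw [lineDeriv_neg, (hφ.smooth.differentiable (by simp) x).lineDeriv_eq_fderiv]
    simp only [_root_.pderiv]; ring

end IsWeakPartial

/-! ### Quantitative membership in `H¹` and `H²` -/

section

/-- `u` has a weak gradient in `Ω`, and `u` and its first derivatives have `L²(Ω)` norm at
most `δ`. -/
def HasH1Bound (Ω : Set Plane) (u : Plane → ℝ) (δ : ℝ≥0∞) : Prop :=
  ∃ G : Fin 2 → Plane → ℝ, (∀ i, IsWeakPartial Ω i u (G i)) ∧
    eLpNorm u 2 (volume.restrict Ω) ≤ δ ∧ ∀ i, eLpNorm (G i) 2 (volume.restrict Ω) ≤ δ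

/-- `u` has weak derivatives up to order two in `Ω`, and all of them have `L²(Ω)` norm at
most `δ`. -/
def HasH2Bound (Ω : Set Plane) (u : Plane → ℝ) (δ : ℝ≥0∞) : Prop :=
  ∃ (G : Fin 2 → Plane → ℝ) (H : Fin 2 → Fin 2 → Plane → ℝ),
    (∀ i, IsWeakPartial Ω i u (G i)) ∧ (∀ i j, IsWeakPartial Ω j (G i) (H i j)) ∧
    eLpNorm u 2 (volume.restrict Ω) ≤ δ ∧ (∀ i, eLpNorm (G i) 2 (volume.restrict Ω) ≤ δ) ∧
    ∀ i j, eLpNorm (H i j) 2 (volume.restrict Ω) ≤ δ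

variable {Ω : Set Plane} {u v : Plane → ℝ} {δ δ' : ℝ≥0∞}

theorem rpow_half_le_of_le_nine_mul_sq {a : ℝ≥0∞} (h : a ≤ 9 * δ ^ 2) :
    a ^ (1 / 2 : ℝ) ≤ 3 * δ := by
  have e : (9 * δ ^ 2 : ℝ≥0∞) = (3 * δ) ^ (2 : ℝ) := by
    rw [ENNReal.rpow_two, mul_pow]; norm_num
  calc a ^ (1 / 2 : ℝ) ≤ ((3 * δ) ^ (2 : ℝ)) ^ (1 / 2 : ℝ) := by
        rw [← e]; exact ENNReal.rpow_le_rpow h (by norm_num)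
    _ = 3 * δ := by rw [← ENNReal.rpow_mul]; norm_num

theorem le_of_sq_le_of_rpow_half_lt {a b : ℝ≥0∞} (h : a ^ 2 ≤ b) (hb : b ^ (1 / 2 : ℝ) < δ) :
    a ≤ δ := by
  have : a = (a ^ 2) ^ (1 / 2 : ℝ) := by
    rw [← ENNReal.rpow_two, ← ENNReal.rpow_mul]; norm_num
  rw [this]
  exact (ENNReal.rpow_le_rpow h (by norm_num)).trans hb.le

theorem HasH1Bound.eH1Norm_le (h : HasH1Bound Ω u δ) : eH1Norm Ω u ≤ 3 * δ := by
  obtain ⟨G, hG, h0, h1⟩ := h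
  refine (iInf₂_le G hG).trans (rpow_half_le_of_le_nine_mul_sq ?_)
  calc _ ≤ δ ^ 2 + ∑ _i : Fin 2, δ ^ 2 := by gcongr; exact h1 _
    _ = 3 * δ ^ 2 := by simp; ring
    _ ≤ 9 * δ ^ 2 := by gcongr; norm_num

/-- The norm is the root of a sum of seven squares of at most `δ`, and `7 ≤ 3 ^ 2`. -/
theorem HasH2Bound.eH2Norm_le (h : HasH2Bound Ω u δ) : eH2Norm Ω u ≤ 3 * δ := by
  obtain ⟨G, H, hG, hH, h0, h1, h2⟩ := h
  refine (iInf₂_le_of_le G hG (iInf₂_le H hH)).trans (rpow_half_le_of_le_nine_mul_sq ?_)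
  calc _ ≤ δ ^ 2 + ∑ _i : Fin 2, δ ^ 2 + ∑ _i : Fin 2, ∑ _j : Fin 2, δ ^ 2 := by
        gcongr
        · exact h1 _
        · exact h2 _ _
    _ = 7 * δ ^ 2 := by simp; ring
    _ ≤ 9 * δ ^ 2 := by gcongr; norm_num

theorem hasH1Bound_of_eH1Norm_lt (h : eH1Norm Ω u < δ) : HasH1Bound Ω u δ := by
  simp only [eH1Norm, iInf_lt_iff] at h
  obtain ⟨G, hG, h⟩ := h
  refine ⟨G, hG, le_of_sq_le_of_rpow_half_lt le_self_add h, fun i =>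
    le_of_sq_le_of_rpow_half_lt (le_add_left ?_) h⟩
  exact Finset.single_le_sum (f := fun i => eLpNorm (G i) 2 (volume.restrict Ω) ^ 2)
    (fun _ _ => zero_le) (Finset.mem_univ i)

/-- Strict inequality is needed: the norm is an infimum over weak derivatives, one choice of which
is extracted here. -/
theorem hasH2Bound_of_eH2Norm_lt (h : eH2Norm Ω u < δ) : HasH2Bound Ω u δ := by
  simp only [eH2Norm, iInf_lt_iff] at h
  obtain ⟨G, hG, H, hH, h⟩ := h
  refine ⟨G, H, hG, hH, le_of_sq_le_of_rpow_half_lt (le_add_right le_self_add) h, fun i =>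
    le_of_sq_le_of_rpow_half_lt (le_add_right (le_add_left ?_)) h, fun i j =>
    le_of_sq_le_of_rpow_half_lt (le_add_left ?_) h⟩
  · exact Finset.single_le_sum (f := fun i => eLpNorm (G i) 2 (volume.restrict Ω) ^ 2)
      (fun _ _ => zero_le) (Finset.mem_univ i)
  · refine le_trans ?_ (Finset.single_le_sum
      (f := fun i => ∑ j, eLpNorm (H i j) 2 (volume.restrict Ω) ^ 2)
      (fun _ _ => zero_le) (Finset.mem_univ i))
    exact Finset.single_le_sum (f := fun j => eLpNorm (H i j) 2 (volume.restrict Ω) ^ 2)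
      (fun _ _ => zero_le) (Finset.mem_univ j)

theorem HasH2Bound.hasH1Bound (h : HasH2Bound Ω u δ) : HasH1Bound Ω u δ := by
  obtain ⟨G, H, hG, hH, h0, h1, h2⟩ := h
  exact ⟨G, hG, h0, h1⟩

theorem HasH2Bound.mono (h : HasH2Bound Ω u δ) (hδ : δ ≤ δ') : HasH2Bound Ω u δ' := by
  obtain ⟨G, H, hG, hH, h0, h1, h2⟩ := h
  exact ⟨G, H, hG, hH, h0.trans hδ, fun i => (h1 i).trans hδ, fun i j => (h2 i j).trans hδ⟩

theorem memLp_of_memH1_partial (hΩ : IsOpen Ω) {i : Fin 2} {g : Plane → ℝ} (hu : MemH1 Ω u)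
    (hg : IsWeakPartial Ω i u g) : MemLp g 2 (volume.restrict Ω) := by
  obtain ⟨g', hg', hm⟩ := hu.2 i
  exact (memLp_congr_ae (hg'.ae_eq hΩ hg)).1 hm

theorem HasH1Bound.eLpNorm_le (hΩ : IsOpen Ω) (h : HasH1Bound Ω u δ) {i : Fin 2} {g : Plane → ℝ}
    (hg : IsWeakPartial Ω i u g) : eLpNorm g 2 (volume.restrict Ω) ≤ δ := by
  obtain ⟨G, hG, h0, h1⟩ := h
  rw [eLpNorm_congr_ae (hg.ae_eq hΩ (hG i))]
  exact h1 i

theorem HasH2Bound.partial (hΩ : IsOpen Ω) (h : HasH2Bound Ω u δ) {i : Fin 2} {g : Plane → ℝ}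
    (hg : IsWeakPartial Ω i u g) : HasH1Bound Ω g δ := by
  obtain ⟨G, H, hG, hH, h0, h1, h2⟩ := h
  have e := (hG i).ae_eq hΩ hg
  refine ⟨H i, fun j => (hH i j).congr_ae e EventuallyEq.rfl, ?_, h2 i⟩
  rw [← eLpNorm_congr_ae e]
  exact h1 i

theorem HasH2Bound.add (hu : HasH2Bound Ω u δ) (hv : HasH2Bound Ω v δ') :
    HasH2Bound Ω (fun x => u x + v x) (δ + δ') := by
  obtain ⟨G, H, hG, hH, h0, h1, h2⟩ := hu
  obtain ⟨G', H', hG', hH', h0', h1', h2'⟩ := hv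
  have key : ∀ {a b : Plane → ℝ}, LocallyIntegrableOn a Ω → LocallyIntegrableOn b Ω →
      eLpNorm a 2 (volume.restrict Ω) ≤ δ → eLpNorm b 2 (volume.restrict Ω) ≤ δ' →
      eLpNorm (fun x => a x + b x) 2 (volume.restrict Ω) ≤ δ + δ' := fun ha hb h h' =>
    (eLpNorm_add_le ha.aestronglyMeasurable hb.aestronglyMeasurable (by norm_num)).trans
      (add_le_add h h')
  refine ⟨fun i x => G i x + G' i x, fun i j x => H i j x + H' i j x,
    fun i => (hG i).add (hG' i), fun i j => (hH i j).add (hH' i j), ?_, fun i => ?_,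
    fun i j => ?_⟩
  · exact key (hG 0).locInt (hG' 0).locInt h0 h0'
  · exact key (hG i).locInt' (hG' i).locInt' (h1 i) (h1' i)
  · exact key (hH i j).locInt' (hH' i j).locInt' (h2 i j) (h2' i j)

theorem HasH2Bound.const_mul (c : ℝ) (hu : HasH2Bound Ω u δ) :
    HasH2Bound Ω (fun x => c * u x) (‖c‖ₑ * δ) := by
  obtain ⟨G, H, hG, hH, h0, h1, h2⟩ := hu
  have key : ∀ {a : Plane → ℝ}, eLpNorm a 2 (volume.restrict Ω) ≤ δ →
      eLpNorm (fun x => c * a x) 2 (volume.restrict Ω) ≤ ‖c‖ₑ * δ := fun {a} h => by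
    have := eLpNorm_const_smul c a 2 (volume.restrict Ω)
    simp only [Pi.smul_def, smul_eq_mul] at this
    rw [this]
    gcongr
  exact ⟨fun i x => c * G i x, fun i j x => c * H i j x, fun i => (hG i).const_mul c,
    fun i j => (hH i j).const_mul c, key h0, fun i => key (h1 i), fun i j => key (h2 i j)⟩

theorem HasH2Bound.neg (hu : HasH2Bound Ω u δ) : HasH2Bound Ω (fun x => - u x) δ := by
  simpa using hu.const_mul (-1)

theorem HasH2Bound.sub (hu : HasH2Bound Ω u δ) (hv : HasH2Bound Ω v δ') :
    HasH2Bound Ω (fun x => u x - v x) (δ + δ') := by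
  simpa [sub_eq_add_neg] using hu.add hv.neg

theorem HasH2Bound.zero : HasH2Bound Ω (fun _ => 0) 0 :=
  ⟨fun _ _ => 0, fun _ _ _ => 0, fun _ => IsWeakPartial.zero, fun _ _ => IsWeakPartial.zero,
    by simp, by simp, by simp⟩

theorem HasH2Bound.sum {ι : Type*} (s : Finset ι) {u : ι → Plane → ℝ}
    {δ : ι → ℝ≥0∞} (h : ∀ a ∈ s, HasH2Bound Ω (u a) (δ a)) :
    HasH2Bound Ω (fun x => ∑ a ∈ s, u a x) (∑ a ∈ s, δ a) := by
  classical
  induction s using Finset.induction_on with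
  | empty => simpa using HasH2Bound.zero
  | insert a s ha ih =>
    simp only [Finset.sum_insert ha]
    exact (h a (by simp)).add (ih fun b hb => h b (by simp [hb]))

theorem memH2_iff_exists_hasH2Bound :
    MemH2 Ω u ↔ ∃ δ : ℝ≥0∞, δ ≠ ⊤ ∧ HasH2Bound Ω u δ := by
  constructor
  · rintro ⟨hu, h⟩
    choose G hG hG1 using h
    choose hG2 H hH hH2 using fun i => hG1 i
    refine ⟨eLpNorm u 2 (volume.restrict Ω) + ∑ i, eLpNorm (G i) 2 (volume.restrict Ω)
      + ∑ i, ∑ j, eLpNorm (H i j) 2 (volume.restrict Ω), ?_, G, H, hG, hH,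
      le_add_right le_self_add, fun i => le_add_right (le_add_left ?_), fun i j => le_add_left ?_⟩
    · simp only [ne_eq, ENNReal.add_eq_top, ENNReal.sum_eq_top, not_or, not_exists, not_and]
      exact ⟨⟨hu.eLpNorm_ne_top, fun i _ => (hG2 i).eLpNorm_ne_top⟩,
        fun i _ j _ => (hH2 i j).eLpNorm_ne_top⟩
    · exact Finset.single_le_sum (f := fun i => eLpNorm (G i) 2 (volume.restrict Ω))
        (fun _ _ => zero_le) (Finset.mem_univ i)
    · exact (Finset.single_le_sum (f := fun j => eLpNorm (H i j) 2 (volume.restrict Ω))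
        (fun _ _ => zero_le) (Finset.mem_univ j)).trans (Finset.single_le_sum
        (f := fun i => ∑ j, eLpNorm (H i j) 2 (volume.restrict Ω))
        (fun _ _ => zero_le) (Finset.mem_univ i))
  · rintro ⟨δ, hδ, G, H, hG, hH, h0, h1, h2⟩
    have hlt := lt_top_iff_ne_top.2 hδ
    exact ⟨⟨(hG 0).locInt.aestronglyMeasurable, h0.trans_lt hlt⟩, fun i => ⟨G i, hG i,
      ⟨(hG i).locInt'.aestronglyMeasurable, (h1 i).trans_lt hlt⟩, fun j => ⟨H i j, hH i j,
      (hH i j).locInt'.aestronglyMeasurable, (h2 i j).trans_lt hlt⟩⟩⟩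

theorem MemH2.add (hu : MemH2 Ω u) (hv : MemH2 Ω v) :
    MemH2 Ω (fun x => u x + v x) := by
  rw [memH2_iff_exists_hasH2Bound] at *
  obtain ⟨δ, hδ, hu⟩ := hu
  obtain ⟨δ', hδ', hv⟩ := hv
  exact ⟨δ + δ', by simp [hδ, hδ'], hu.add hv⟩

theorem MemH2.memH1 (hu : MemH2 Ω u) : MemH1 Ω u :=
  ⟨hu.1, fun i => let ⟨g, hg, hg1⟩ := hu.2 i; ⟨g, hg, hg1.1⟩⟩

/-- In the definition of `H²`, any weak gradient may be used. -/
theorem MemH2.memH1_partial (hΩ : IsOpen Ω) (hu : MemH2 Ω u) {i : Fin 2} {g : Plane → ℝ}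
    (hg : IsWeakPartial Ω i u g) : MemH1 Ω g := by
  obtain ⟨g', hg', hm, hd⟩ := hu.2 i
  have e := hg'.ae_eq hΩ hg
  refine ⟨(memLp_congr_ae e).1 hm, fun j => ?_⟩
  obtain ⟨h, hh, hhm⟩ := hd j
  exact ⟨h, hh.congr_ae e EventuallyEq.rfl, hhm⟩

theorem memLp_two_of_continuous_of_isBounded (hb : Bornology.IsBounded Ω) (hu : Continuous u) :
    MemLp u 2 (volume.restrict Ω) := by
  obtain ⟨C, hC⟩ := hb.isCompact_closure.exists_bound_of_continuousOn hu.continuousOn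
  have : IsFiniteMeasure (volume.restrict (closure Ω)) :=
    ⟨by simpa using hb.isCompact_closure.measure_lt_top⟩
  have h : MemLp u 2 (volume.restrict (closure Ω)) :=
    MemLp.of_bound hu.aestronglyMeasurable C
      ((ae_restrict_mem isClosed_closure.measurableSet).mono hC)
  exact h.mono_measure (Measure.restrict_mono subset_closure le_rfl)

theorem memH2_of_contDiff (hb : Bornology.IsBounded Ω) (hu : ContDiff ℝ ∞ u) : MemH2 Ω u :=
  ⟨memLp_two_of_continuous_of_isBounded hb hu.continuous, fun i =>
    ⟨pderiv i u, IsWeakPartial.of_contDiff (hu.of_le (by norm_cast)),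
      memLp_two_of_continuous_of_isBounded hb (contDiff_pderiv hu i).continuous, fun j =>
      ⟨pderiv j (pderiv i u),
        IsWeakPartial.of_contDiff ((contDiff_pderiv hu i).of_le (by norm_cast)),
        memLp_two_of_continuous_of_isBounded hb
          (contDiff_pderiv (contDiff_pderiv hu i) j).continuous⟩⟩⟩

/-! ### The space `H²₀` and its vanishing traces -/

theorem memH20_iff : MemH20 Ω u ↔ MemH2 Ω u ∧ ∀ δ : ℝ≥0∞, 0 < δ →
    ∃ φ, IsTestFunction Ω φ ∧ HasH2Bound Ω (fun x => φ x - u x) δ := by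
  refine and_congr_right fun _ => ⟨?_, fun h => ?_⟩
  · rintro ⟨φ, hφ, hlim⟩ δ hδ
    obtain ⟨k, hk⟩ := (hlim.eventually (gt_mem_nhds hδ)).exists
    exact ⟨φ k, hφ k, hasH2Bound_of_eH2Norm_lt hk⟩
  · choose φ hφ hb using fun k : ℕ => h ((k : ℝ≥0∞) + 1)⁻¹ (by simp)
    refine ⟨φ, hφ, ?_⟩
    have hlim : Tendsto (fun k : ℕ => 3 * ((k : ℝ≥0∞) + 1)⁻¹) atTop (𝓝 0) := by
      have := (ENNReal.tendsto_inv_nat_nhds_zero.comp (tendsto_add_atTop_nat 1))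
      simpa using ENNReal.Tendsto.const_mul (a := 3) this (Or.inr (by norm_num))
    exact tendsto_of_tendsto_of_tendsto_of_le_of_le tendsto_const_nhds hlim (fun _ => zero_le)
      fun k => (hb k).eH2Norm_le

theorem MemH20.add (hu : MemH20 Ω u) (hv : MemH20 Ω v) :
    MemH20 Ω (fun x => u x + v x) := by
  rw [memH20_iff] at *
  refine ⟨hu.1.add hv.1, fun δ hδ => ?_⟩
  obtain ⟨φ, hφ, h1⟩ := hu.2 (δ / 2) (ENNReal.half_pos hδ.ne')
  obtain ⟨ψ, hψ, h2⟩ := hv.2 (δ / 2) (ENNReal.half_pos hδ.ne')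
  refine ⟨_, hφ.add hψ, ?_⟩
  convert h1.add h2 using 1
  · ext x; ring
  · rw [ENNReal.add_halves]

theorem IsTestFunction.memH20 (hb : Bornology.IsBounded Ω)
    (hu : IsTestFunction Ω u) : MemH20 Ω u :=
  memH20_iff.2 ⟨memH2_of_contDiff hb hu.smooth, fun δ _ => ⟨u, hu, by
    simpa using HasH2Bound.zero.mono zero_le⟩⟩

theorem MemH20.sum {ι : Type*} (hb : Bornology.IsBounded Ω) (s : Finset ι)
    {u : ι → Plane → ℝ} (h : ∀ a ∈ s, MemH20 Ω (u a)) : MemH20 Ω (fun x => ∑ a ∈ s, u a x) := by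
  classical
  induction s using Finset.induction_on with
  | empty => simpa using IsTestFunction.zero.memH20 hb
  | insert a s ha ih =>
    simp only [Finset.sum_insert ha]
    exact (h a (by simp)).add (ih fun b hb => h b (by simp [hb]))

/-- Functions in `H²₀(Ω)` have vanishing Cauchy data: the approximating test functions vanish
on the boundary together with their derivatives. -/
theorem MemH20.hasCauchyData_zero (hΩ : IsOpen Ω) (hu : MemH20 Ω u) :
    HasCauchyData Ω u (fun _ => 0) := by
  obtain ⟨h2, hap⟩ := memH20_iff.1 hu
  choose φ hφ hb using fun k : ℕ => hap ((k : ℝ≥0∞) + 1)⁻¹ (by simp)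
  have hlim : Tendsto (fun k : ℕ => 3 * ((k : ℝ≥0∞) + 1)⁻¹) atTop (𝓝 0) := by
    have := (ENNReal.tendsto_inv_nat_nhds_zero.comp (tendsto_add_atTop_nat 1))
    simpa using ENNReal.Tendsto.const_mul (a := 3) this (Or.inr (by norm_num))
  have hbd : ∀ ψ, IsTestFunction Ω ψ →
      eLpNorm (fun x => ψ x - 0) 2 (boundaryMeasure Ω) = 0 := by
    intro ψ hψ
    refine (eLpNorm_congr_ae (g := 0) ?_).trans eLpNorm_zero
    refine (ae_restrict_mem isClosed_frontier.measurableSet).mono fun x hx => ?_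
    have : x ∉ tsupport ψ := fun h => by
      rw [hΩ.frontier_eq] at hx
      exact hx.2 (hψ.support h)
    simp [image_eq_zero_of_notMem_tsupport this]
  choose G hG _ using h2.2
  refine ⟨⟨h2.memH1, MemLp.zero, φ, fun k => (hφ k).smooth, ?_, ?_⟩, G, fun _ _ => 0,
    fun i => ⟨hG i, h2.memH1_partial hΩ (hG i), MemLp.zero, fun k => pderiv i (φ k),
      fun k => ((hφ k).pderiv i).smooth, ?_, ?_⟩, ?_⟩
  · exact tendsto_of_tendsto_of_tendsto_of_le_of_le tendsto_const_nhds hlim (fun _ => zero_le)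
      fun k => (hb k).hasH1Bound.eH1Norm_le
  · simp_rw [fun k => hbd _ (hφ k)]
    exact tendsto_const_nhds
  · exact tendsto_of_tendsto_of_tendsto_of_le_of_le tendsto_const_nhds hlim (fun _ => zero_le)
      fun k => ((hb k).partial hΩ ((IsWeakPartial.of_contDiff
        ((hφ k).smooth.of_le (by norm_cast))).sub (hG i))).eH1Norm_le
  · simp_rw [fun k => hbd _ ((hφ k).pderiv i)]
    exact tendsto_const_nhds
  · simp

end

/-! ### Translation and mollification in `L²` and `H²` -/

/-- Translation is continuous in `L²`. -/
theorem exists_eLpNorm_translate_sub_le {f : Plane → ℝ} (hf : MemLp f 2) {δ : ℝ≥0∞} (hδ : 0 < δ) :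
    ∃ r > 0, ∀ a : Plane, ‖a‖ < r → eLpNorm (fun x => f (x - a) - f x) 2 ≤ δ := by
  let g : Plane → C(Plane, Plane) :=
    ((ContinuousMap.mk (fun p : Plane × Plane => p.2 - p.1) (by fun_prop)).curry)
  have hg : Continuous g := ContinuousMap.continuous _
  have hm : ∀ a, MeasurePreserving (g a) (volume : Measure Plane) volume := fun a =>
    measurePreserving_sub_right volume a
  have hF := (tendsto_const_nhds (x := hf.toLp f) (f := 𝓝 (0 : Plane))).compMeasurePreservingLp
    (hg.tendsto 0) hm (hm 0) (by norm_num)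
  have h2 := (EMetric.tendsto_nhds.1 hF) δ hδ
  obtain ⟨r, hr, hb⟩ := Metric.eventually_nhds_iff.1 h2
  refine ⟨r, hr, fun a ha => ?_⟩
  have := (hb (y := a) (by simpa using ha)).le
  rw [Lp.edist_def] at this
  refine le_trans (eLpNorm_congr_ae ?_).le this
  have e : ∀ a, ⇑(Lp.compMeasurePreserving (g a) (hm a) (hf.toLp f)) =ᵐ[volume]
      fun x => f (x - a) := fun a =>
    (Lp.coeFn_compMeasurePreserving _ (hm a)).trans
      ((hm a).quasiMeasurePreserving.ae_eq_comp hf.coeFn_toLp)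
  filter_upwards [e a, e 0] with x h1 h2
  simp only [Pi.sub_apply, h1, h2, sub_zero]

/-- Convolution with the normalised bump function `ρ`. -/
noncomputable def mollify (ρ : ContDiffBump (0 : Plane)) (f : Plane → ℝ) (x : Plane) : ℝ :=
  ∫ t, ρ.normed volume t * f (x - t)

theorem mollify_eq_convolution (ρ : ContDiffBump (0 : Plane)) (f : Plane → ℝ) :
    mollify ρ f = convolution (ρ.normed volume) f (ContinuousLinearMap.mul ℝ ℝ) volume := by
  ext x; rfl

theorem mollify_eq_swap (ρ : ContDiffBump (0 : Plane)) (f : Plane → ℝ) (x : Plane) :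
    mollify ρ f x = ∫ y, f y * ρ.normed volume (x - y) := by
  rw [mollify, ← integral_sub_left_eq_self _ volume x]
  congr 1; ext y; simp [mul_comm]

/-- Jensen's inequality for the square and the probability density `k`. -/
theorem sq_lintegral_mul_le {α : Type*} [MeasurableSpace α] {μ : Measure α} {k g : α → ℝ≥0∞}
    (hk : Measurable k) (hg : AEMeasurable g μ) (h1 : ∫⁻ t, k t ∂μ = 1) :
    (∫⁻ t, k t * g t ∂μ) ^ 2 ≤ ∫⁻ t, k t * g t ^ 2 ∂μ := by
  have hk2 : Measurable fun t => k t ^ (1 / 2 : ℝ) := hk.pow_const _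
  have hmul : ∀ t, k t ^ (1 / 2 : ℝ) * k t ^ (1 / 2 : ℝ) = k t := fun t => by
    rw [← ENNReal.rpow_add_of_nonneg _ _ (by norm_num) (by norm_num)]; norm_num
  have := ENNReal.lintegral_mul_le_Lp_mul_Lq μ (p := 2) (q := 2)
    (by norm_num [Real.holderConjugate_iff])
    hk2.aemeasurable (hk2.aemeasurable.mul hg)
  have e1 : ∀ t, (k t ^ (1 / 2 : ℝ)) ^ (2 : ℝ) = k t := fun t => by
    rw [ENNReal.rpow_two, sq, hmul]
  simp only [Pi.mul_apply, ← mul_assoc, hmul, e1, ENNReal.mul_rpow_of_nonneg _ _ zero_le_two, h1,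
    ENNReal.one_rpow, one_mul] at this
  calc _ ≤ ((∫⁻ t, k t * g t ^ (2 : ℝ) ∂μ) ^ (1 / 2 : ℝ)) ^ 2 := by gcongr
    _ = _ := by
      rw [← ENNReal.rpow_two, ← ENNReal.rpow_mul]; simp

theorem eLpNorm_two_le_iff {α : Type*} [MeasurableSpace α] {μ : Measure α} {f : α → ℝ} {δ : ℝ≥0∞} :
    eLpNorm f 2 μ ≤ δ ↔ ∫⁻ x, ‖f x‖ₑ ^ 2 ∂μ ≤ δ ^ 2 := by
  rw [eLpNorm_eq_lintegral_rpow_enorm_toReal (by norm_num) (by norm_num)]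
  simp only [ENNReal.toReal_ofNat, ENNReal.rpow_two]
  rw [← ENNReal.rpow_two, one_div, ENNReal.rpow_inv_le_iff (by norm_num)]

/-- A mollification is as close to `f` in `L²` as the translates of `f` over which it averages. -/
theorem eLpNorm_mollify_sub_le {f : Plane → ℝ} (hf : MemLp f 2) {δ : ℝ≥0∞}
    (ρ : ContDiffBump (0 : Plane))
    (h : ∀ a : Plane, ‖a‖ < ρ.rOut → eLpNorm (fun x => f (x - a) - f x) 2 ≤ δ) :
    eLpNorm (fun x => mollify ρ f x - f x) 2 ≤ δ := by
  set k := ρ.normed (volume : Measure Plane) with hk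
  have kc : Continuous k := ρ.continuous_normed
  have ks : HasCompactSupport k := ρ.hasCompactSupport_normed
  have k1 : ∫ t, k t = 1 := ρ.integral_normed
  have k1' : ∫⁻ t, ‖k t‖ₑ = 1 := by
    have := ofReal_integral_norm_eq_lintegral_enorm (μ := volume)
      (kc.integrable_of_hasCompactSupport ks)
    have hn : ∀ t, ‖k t‖ = k t := fun t => by
      rw [Real.norm_eq_abs, abs_of_nonneg (ρ.nonneg_normed t)]
    rw [← this]
    simp only [hn, k1, ENNReal.ofReal_one]
  have hli : LocallyIntegrable f := hf.locallyIntegrable (by norm_num)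
  have hpt : ∀ x, ‖mollify ρ f x - f x‖ₑ ^ 2 ≤ ∫⁻ t, ‖k t‖ₑ * ‖f (x - t) - f x‖ₑ ^ 2 := by
    intro x
    have hmx : AEStronglyMeasurable (fun t => f (x - t)) :=
      hf.1.comp_quasiMeasurePreserving
        (Measure.measurePreserving_sub_left volume x).quasiMeasurePreserving
    have hint : Integrable (fun t => k t * f (x - t)) := by
      have := (ks.convolutionExists_left (ContinuousLinearMap.mul ℝ ℝ) kc hli x).integrable
      simpa using this
    have e : mollify ρ f x - f x = ∫ t, k t * (f (x - t) - f x) := by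
      simp only [mul_sub]
      rw [integral_sub hint ((kc.integrable_of_hasCompactSupport ks).mul_const _),
        integral_mul_const, k1, one_mul]
      rfl
    rw [e]
    refine le_trans ?_ (sq_lintegral_mul_le kc.measurable.enorm
      (hmx.sub aestronglyMeasurable_const).enorm k1')
    gcongr
    refine (enorm_integral_le_lintegral_enorm _).trans (lintegral_mono fun t => ?_)
    simp [enorm_mul]
  rw [eLpNorm_two_le_iff]
  have hmeas : AEMeasurable (Function.uncurry fun x t : Plane => ‖k t‖ₑ * ‖f (x - t) - f x‖ₑ ^ 2)
      (volume.prod volume) := by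
    have m1 : AEStronglyMeasurable (fun p : Plane × Plane => f (p.1 - p.2)) (volume.prod volume) :=
      hf.1.comp_quasiMeasurePreserving (quasiMeasurePreserving_sub_of_right_invariant volume volume)
    have m2 : AEStronglyMeasurable (fun p : Plane × Plane => f p.1) (volume.prod volume) :=
      hf.1.comp_fst
    exact (kc.measurable.enorm.comp measurable_snd).aemeasurable.mul ((m1.sub m2).enorm.pow_const 2)
  calc _ ≤ ∫⁻ x, ∫⁻ t, ‖k t‖ₑ * ‖f (x - t) - f x‖ₑ ^ 2 := lintegral_mono hpt
    _ = ∫⁻ t, ∫⁻ x, ‖k t‖ₑ * ‖f (x - t) - f x‖ₑ ^ 2 := lintegral_lintegral_swap hmeas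
    _ ≤ ∫⁻ t, ‖k t‖ₑ * δ ^ 2 := by
      refine lintegral_mono fun t => ?_
      rw [lintegral_const_mul' _ _ (by simp)]
      by_cases ht : ‖t‖ < ρ.rOut
      · gcongr
        exact eLpNorm_two_le_iff.1 (h t ht)
      · have : k t = 0 := by
          rw [← Function.notMem_support, hk, ρ.support_normed_eq]
          simpa using ht
        simp [this]
    _ = δ ^ 2 := by rw [lintegral_mul_const _ kc.measurable.enorm, k1', one_mul]

theorem contDiff_mollify (ρ : ContDiffBump (0 : Plane)) {f : Plane → ℝ}
    (hf : LocallyIntegrable f) : ContDiff ℝ ∞ (mollify ρ f) := by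
  rw [mollify_eq_convolution]
  exact ρ.hasCompactSupport_normed.contDiff_convolution_left _ ρ.contDiff_normed hf

theorem pderiv_mollify (ρ : ContDiffBump (0 : Plane)) {u g : Plane → ℝ} {i : Fin 2}
    (h : IsWeakPartial Set.univ i u g) : pderiv i (mollify ρ u) = mollify ρ g := by
  have hu : LocallyIntegrable u := locallyIntegrableOn_univ.1 h.locInt
  set k := ρ.normed (volume : Measure Plane) with hk
  have kd : ContDiff ℝ ∞ k := ρ.contDiff_normed
  have ks : HasCompactSupport k := ρ.hasCompactSupport_normed
  ext x
  have hd := ks.hasFDerivAt_convolution_left (ContinuousLinearMap.mul ℝ ℝ)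
    (kd.of_le (by norm_cast)) hu x
  have e1 : pderiv i (mollify ρ u) x = ∫ t, pderiv i k t * u (x - t) := by
    rw [pderiv, mollify_eq_convolution, hd.fderiv, convolution_def,
      ContinuousLinearMap.integral_apply]
    · rfl
    · exact ((ks.fderiv ℝ).convolutionExists_left _
        (kd.continuous_fderiv (by simp)) hu x).integrable
  have ht : IsTestFunction Set.univ (fun y => k (x - y)) :=
    ⟨kd.comp (contDiff_const.sub contDiff_id),
      ks.comp_homeomorph (Homeomorph.subLeft x), Set.subset_univ _⟩
  have hp : ∀ y, pderiv i (fun y => k (x - y)) y = - pderiv i k (x - y) := by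
    intro y
    have hf : HasFDerivAt (fun y => k (x - y))
        ((fderiv ℝ k (x - y)).comp (-(ContinuousLinearMap.id ℝ Plane))) y :=
      ((kd.differentiable (by simp) (x - y)).hasFDerivAt).comp y ((hasFDerivAt_id y).const_sub x)
    simp [pderiv, hf.fderiv]
  have hb := h.byParts _ ht
  simp only [Measure.restrict_univ, hp, mul_neg, integral_neg, neg_inj] at hb
  rw [e1, mollify_eq_swap, ← hb, ← integral_sub_left_eq_self _ volume x]
  congr 1; ext y; simp [mul_comm]

theorem mollify_eq_zero (ρ : ContDiffBump (0 : Plane)) {f : Plane → ℝ} {K : Set Plane}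
    (hf : ∀ x, x ∉ K → f x = 0) {x : Plane} (hx : x ∉ Metric.cthickening ρ.rOut K) :
    mollify ρ f x = 0 := by
  refine integral_eq_zero_of_ae (ae_of_all _ fun t => ?_)
  by_cases ht : t ∈ Metric.ball (0 : Plane) ρ.rOut
  · have : x - t ∉ K := fun h => hx (Metric.mem_cthickening_of_dist_le x (x - t) _ K h (by
      simpa [dist_eq_norm] using (mem_ball_zero_iff.1 ht).le))
    simp [hf _ this]
  · rw [← ρ.support_normed_eq (μ := volume), Function.notMem_support] at ht
    simp [ht]

theorem IsWeakPartial.locallyIntegrable {u g : Plane → ℝ} {i : Fin 2}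
    (h : IsWeakPartial Set.univ i u g) : LocallyIntegrable u :=
  locallyIntegrableOn_univ.1 h.locInt

theorem HasH2Bound.mono_set {Ω Ω' : Set Plane} {u : Plane → ℝ} {δ : ℝ≥0∞} (h : HasH2Bound Ω' u δ)
    (hΩ : Ω ⊆ Ω') : HasH2Bound Ω u δ := by
  obtain ⟨G, H, hG, hH, h0, h1, h2⟩ := h
  have hm : ∀ f : Plane → ℝ, eLpNorm f 2 (volume.restrict Ω) ≤ eLpNorm f 2 (volume.restrict Ω') :=
    fun f => eLpNorm_mono_measure f (Measure.restrict_mono hΩ le_rfl)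
  exact ⟨G, H, fun i => (hG i).mono hΩ, fun i j => (hH i j).mono hΩ, (hm _).trans h0,
    fun i => (hm _).trans (h1 i), fun i j => (hm _).trans (h2 i j)⟩

/-- A finite family of `L²` functions can be translated by a common small vector at a small cost. -/
theorem exists_common_translate_bound {u : Plane → ℝ} {G : Fin 2 → Plane → ℝ}
    {H : Fin 2 → Fin 2 → Plane → ℝ} (hu : MemLp u 2) (hG : ∀ i, MemLp (G i) 2)
    (hH : ∀ i j, MemLp (H i j) 2) {δ : ℝ≥0∞} (hδ : 0 < δ) :
    ∃ r > 0, ∀ a : Plane, ‖a‖ < r → eLpNorm (fun x => u (x - a) - u x) 2 ≤ δ ∧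
      (∀ i, eLpNorm (fun x => G i (x - a) - G i x) 2 ≤ δ) ∧
      ∀ i j, eLpNorm (fun x => H i j (x - a) - H i j x) 2 ≤ δ := by
  have key : ∀ {f : Plane → ℝ}, MemLp f 2 → ∀ᶠ r in 𝓝[>] (0 : ℝ), ∀ a : Plane, ‖a‖ < r →
      eLpNorm (fun x => f (x - a) - f x) 2 ≤ δ := by
    intro f hf
    obtain ⟨r, hr, h⟩ := exists_eLpNorm_translate_sub_le hf hδ
    filter_upwards [Ioo_mem_nhdsGT hr] with s hs a ha using h a (ha.trans hs.2)
  obtain ⟨r, ⟨⟨h0, h1⟩, h2⟩, hr⟩ := (((key hu).and (eventually_all.2 fun i => key (hG i))).and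
    (eventually_all.2 fun i => eventually_all.2 fun j => key (hH i j))).and
      self_mem_nhdsWithin |>.exists
  exact ⟨r, hr, fun a ha => ⟨h0 a ha, fun i => h1 i a ha, fun i j => h2 i j a ha⟩⟩

/-- A function in `H²(ℝ²)` supported in a compact subset of `Ω` is approximated by its
mollifications, which are test functions. -/
theorem MemH2.exists_testFunction {Ω K : Set Plane} {u : Plane → ℝ} (hΩ : IsOpen Ω)
    (hK : IsCompact K) (hKΩ : K ⊆ Ω) (hu : MemH2 Set.univ u) (h0 : ∀ x, x ∉ K → u x = 0)
    {δ : ℝ≥0∞} (hδ : 0 < δ) :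
    ∃ φ, IsTestFunction Ω φ ∧ HasH2Bound Set.univ (fun x => φ x - u x) δ := by
  obtain ⟨hm, h⟩ := hu
  choose G hG hG1 using h
  choose hG2 H hH hH2 using hG1
  simp only [Measure.restrict_univ] at hm hG2 hH2
  obtain ⟨r, hr, hb⟩ := exists_common_translate_bound hm hG2 hH2 hδ
  obtain ⟨s, hs, hsΩ⟩ := hK.exists_cthickening_subset_open hΩ hKΩ
  let ρ : ContDiffBump (0 : Plane) :=
    ⟨min r s / 2, min r s, by positivity, half_lt_self (by positivity)⟩
  have hρ : ρ.rOut = min r s := rfl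
  have sm : ContDiff ℝ ∞ (mollify ρ u) := contDiff_mollify ρ (hG 0).locallyIntegrable
  have p1 : ∀ i, pderiv i (mollify ρ u) = mollify ρ (G i) := fun i => pderiv_mollify ρ (hG i)
  have p2 : ∀ i j, pderiv j (mollify ρ (G i)) = mollify ρ (H i j) :=
    fun i j => pderiv_mollify ρ (hH i j)
  have ht : IsTestFunction Ω (mollify ρ u) :=
    IsTestFunction.of_eq_zero_off_compact (hK.cthickening (r := s)) hsΩ sm fun x hx =>
      mollify_eq_zero ρ h0 fun hx' =>
        hx (Metric.cthickening_mono (min_le_right r s) _ hx')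
  have hb' : ∀ a : Plane, ‖a‖ < ρ.rOut → _ := fun a ha => hb a (ha.trans_le (min_le_left r s))
  refine ⟨mollify ρ u, ht, fun i x => mollify ρ (G i) x - G i x,
    fun i j x => mollify ρ (H i j) x - H i j x, fun i => ?_, fun i j => ?_, ?_, fun i => ?_,
    fun i j => ?_⟩
  · have := IsWeakPartial.of_contDiff (Ω := Set.univ) (i := i) (sm.of_le (n := ∞) (by norm_cast))
    rw [p1] at this
    exact this.sub (hG i)
  · have := IsWeakPartial.of_contDiff (Ω := Set.univ) (i := j)
      ((contDiff_mollify ρ (hH i 0).locallyIntegrable).of_le (n := ∞) (by norm_cast))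
    rw [p2] at this
    exact this.sub (hH i j)
  · rw [Measure.restrict_univ]
    exact eLpNorm_mollify_sub_le hm ρ fun a ha => (hb' a ha).1
  · rw [Measure.restrict_univ]
    exact eLpNorm_mollify_sub_le (hG2 i) ρ fun a ha => (hb' a ha).2.1 i
  · rw [Measure.restrict_univ]
    exact eLpNorm_mollify_sub_le (hH2 i j) ρ fun a ha => (hb' a ha).2.2 i j

theorem IsWeakPartial.translate {u g : Plane → ℝ} {i : Fin 2} (a : Plane)
    (h : IsWeakPartial Set.univ i u g) :
    IsWeakPartial Set.univ i (fun x => u (x - a)) (fun x => g (x - a)) := by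
  have hl : ∀ {f : Plane → ℝ}, LocallyIntegrable f → LocallyIntegrable fun x => f (x - a) := by
    intro f hf x
    obtain ⟨s, hs, hi⟩ := hf (x - a)
    refine ⟨(fun y => y - a) ⁻¹' s, (continuous_id.sub continuous_const).continuousAt hs, ?_⟩
    exact ((measurePreserving_sub_right volume a).integrableOn_comp_preimage
      (MeasurableEquiv.subRight a).measurableEmbedding).2 hi
  refine ⟨locallyIntegrableOn_univ.2 (hl h.locallyIntegrable),
    locallyIntegrableOn_univ.2 (hl (locallyIntegrableOn_univ.1 h.locInt')), fun φ hφ => ?_⟩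
  have ht : IsTestFunction Set.univ (fun y => φ (y + a)) :=
    ⟨hφ.smooth.comp (contDiff_id.add contDiff_const),
      hφ.compact.comp_homeomorph (Homeomorph.addRight a), Set.subset_univ _⟩
  have hb := h.byParts _ ht
  have hp : ∀ y, _root_.pderiv i (fun y => φ (y + a)) y = _root_.pderiv i φ (y + a) := fun y => by
    simp only [_root_.pderiv, fderiv_comp_add_right]
  simp only [Measure.restrict_univ, hp] at hb ⊢
  rw [← integral_sub_right_eq_self _ a,
    ← integral_sub_right_eq_self (fun y => g y * φ (y + a)) a] at hb
  simpa using hb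

theorem memLp_translate {f : Plane → ℝ} (hf : MemLp f 2) (a : Plane) :
    MemLp (fun x => f (x - a)) 2 :=
  hf.comp_measurePreserving (measurePreserving_sub_right volume a)

theorem MemH2.translate {u : Plane → ℝ} (hu : MemH2 Set.univ u) (a : Plane) :
    MemH2 Set.univ (fun x => u (x - a)) := by
  obtain ⟨hm, h⟩ := hu
  choose G hG hG1 using h
  choose hG2 H hH hH2 using hG1
  simp only [MemH2, MemH1, Measure.restrict_univ] at hm hG2 hH2 ⊢
  exact ⟨memLp_translate hm a, fun i => ⟨_, (hG i).translate a, memLp_translate (hG2 i) a, fun j =>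
    ⟨_, (hH i j).translate a, memLp_translate (hH2 i j) a⟩⟩⟩

theorem MemH2.exists_translate_bound {u : Plane → ℝ} (hu : MemH2 Set.univ u) {δ : ℝ≥0∞}
    (hδ : 0 < δ) : ∃ r > 0, ∀ a : Plane, ‖a‖ < r →
      HasH2Bound Set.univ (fun x => u (x - a) - u x) δ := by
  obtain ⟨hm, h⟩ := hu
  choose G hG hG1 using h
  choose hG2 H hH hH2 using hG1
  simp only [Measure.restrict_univ] at hm hG2 hH2
  obtain ⟨r, hr, hb⟩ := exists_common_translate_bound hm hG2 hH2 hδ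
  refine ⟨r, hr, fun a ha => ⟨fun i x => G i (x - a) - G i x, fun i j x => H i j (x - a) - H i j x,
    fun i => ((hG i).translate a).sub (hG i), fun i j => ((hH i j).translate a).sub (hH i j), ?_⟩⟩
  simpa only [Measure.restrict_univ] using hb a ha

theorem MemLp.mul_testFunction {Ω Ω' : Set Plane} {f η : Plane → ℝ}
    (hf : MemLp f 2 (volume.restrict Ω)) (hη : IsTestFunction Ω' η) :
    MemLp (fun x => η x * f x) 2 (volume.restrict Ω) := by
  obtain ⟨C, hC⟩ := hη.compact.exists_bound_of_continuous hη.smooth.continuous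
  refine MemLp.of_le_mul (c := C) hf (hη.smooth.continuous.aestronglyMeasurable.mul hf.1)
    (ae_of_all _ fun x => ?_)
  rw [norm_mul]
  gcongr
  exact hC x

theorem MemH2.mul_testFunction {Ω Ω' : Set Plane} {u η : Plane → ℝ} (hu : MemH2 Ω u)
    (hη : IsTestFunction Ω' η) : MemH2 Ω (fun x => η x * u x) := by
  obtain ⟨hm, h⟩ := hu
  choose G hG hG1 using h
  choose hG2 H hH hH2 using hG1
  refine ⟨MemLp.mul_testFunction hm hη, fun i => ⟨_, (hG i).mul_smooth hη.smooth,
    (MemLp.mul_testFunction hm (hη.pderiv i)).add (MemLp.mul_testFunction (hG2 i) hη), fun j =>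
    ⟨_, ((hG j).mul_smooth (hη.pderiv i).smooth).add ((hH i j).mul_smooth hη.smooth), ?_⟩⟩⟩
  exact ((MemLp.mul_testFunction hm ((hη.pderiv i).pderiv j)).add
    (MemLp.mul_testFunction (hG2 j) (hη.pderiv i))).add
    ((MemLp.mul_testFunction (hG2 i) (hη.pderiv j)).add (MemLp.mul_testFunction (hH2 i j) hη))

/-! ### Boundary patches and partitions of unity -/

/-- A ball in which `Ω` is, in the Cartesian coordinates given by the isometry `e`, the strict
subgraph of a `C¹` function `ψ`. -/
structure GraphPatch (Ω : Set Plane) where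
  center : Plane
  radius : ℝ
  e : Plane ≃ₗᵢ[ℝ] Plane
  ψ : ℝ → ℝ
  contDiff : ContDiff ℝ 1 ψ
  inter_eq : Ω ∩ Metric.ball center radius
    = {y | y ∈ Metric.ball center radius ∧ (e y) 1 < ψ ((e y) 0)}

/-- The divergence theorem in the lower half plane, for the field with components `a h` and
`c h`, where `c` depends on the abscissa only. -/
theorem integral_lower_halfPlane {h A B : ℝ × ℝ → ℝ} {c : ℝ → ℝ} (a : ℝ) {L : Set (ℝ × ℝ)}
    (hL : IsCompact L) (hh : Continuous h) (hA : Continuous A) (hB : Continuous B)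
    (hc : Continuous c) (h0 : ∀ p, p ∉ L → h p = 0) (hA0 : ∀ p, p ∉ L → A p = 0)
    (hB0 : ∀ p, p ∉ L → B p = 0) (hdx : ∀ x t, HasDerivAt (fun x => h (x, t)) (A (x, t)) x)
    (hdt : ∀ x t, HasDerivAt (fun t => h (x, t)) (B (x, t)) t) :
    ∫ p in (Set.univ ×ˢ Set.Iio (0 : ℝ) : Set (ℝ × ℝ)), (a * A p + c p.1 * B p)
        ∂(volume.prod volume) = ∫ x, h (x, 0) * c x := by
  have hcs₁ : ∀ {F : ℝ × ℝ → ℝ} (t : ℝ), (∀ p, p ∉ L → F p = 0) →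
      HasCompactSupport fun x => F (x, t) := fun t hF =>
    HasCompactSupport.intro (hL.image continuous_fst) fun x hx => hF _ fun h => hx ⟨_, h, rfl⟩
  have hcs₂ : ∀ {F : ℝ × ℝ → ℝ} (x : ℝ), (∀ p, p ∉ L → F p = 0) →
      HasCompactSupport fun t => F (x, t) := fun x hF =>
    HasCompactSupport.intro (hL.image continuous_snd) fun t ht => hF _ fun h => ht ⟨_, h, rfl⟩
  have hm : (volume.prod volume : Measure (ℝ × ℝ)).restrict (Set.univ ×ˢ Set.Iio (0 : ℝ))
      = (volume : Measure ℝ).prod (volume.restrict (Set.Iio (0 : ℝ))) := by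
    rw [← Measure.prod_restrict, Measure.restrict_univ]
  have hint : ∀ {F : ℝ × ℝ → ℝ}, Continuous F → (∀ p, p ∉ L → F p = 0) →
      Integrable F ((volume : Measure ℝ).prod (volume.restrict (Set.Iio (0 : ℝ)))) := by
    intro F hF hF0
    rw [← hm]
    exact (hF.integrable_of_hasCompactSupport (HasCompactSupport.intro hL fun p hp => hF0 p hp)
      ).integrableOn
  have hcBc : Continuous fun p : ℝ × ℝ => c p.1 * B p := (hc.comp continuous_fst).mul hB
  have hcBz : ∀ p : ℝ × ℝ, p ∉ L → c p.1 * B p = 0 := fun p hp => by simp [hB0 p hp]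
  have hA1 : ∀ t, ∫ x, A (x, t) = 0 := fun t =>
    integral_eq_zero_of_hasDerivAt_of_integrable (fun x => hdx x t)
      ((hA.comp (continuous_id.prodMk continuous_const)).integrable_of_hasCompactSupport
        (hcs₁ t hA0))
      ((hh.comp (continuous_id.prodMk continuous_const)).integrable_of_hasCompactSupport
        (hcs₁ t h0))
  have hB1 : ∀ x, ∫ t in Set.Iio 0, B (x, t) = h (x, 0) := by
    intro x
    have hder : deriv (fun t => h (x, t)) = fun t => B (x, t) :=
      funext fun t => (hdt x t).deriv
    have hC1 : ContDiff ℝ 1 fun t => h (x, t) := by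
      refine contDiff_one_iff_deriv.2 ⟨fun t => (hdt x t).differentiableAt, ?_⟩
      rw [hder]
      exact hB.comp (continuous_const.prodMk continuous_id)
    have := HasCompactSupport.integral_Iic_deriv_eq hC1 (hcs₂ x h0) 0
    rw [hder, integral_Iic_eq_integral_Iio] at this
    exact this
  rw [hm, integral_add ((hint hA hA0).const_mul _) (hint hcBc hcBz), integral_const_mul,
    integral_prod_symm _ (hint hA hA0), integral_prod _ (hint hcBc hcBz)]
  simp only [hA1, integral_zero, mul_zero, zero_add, integral_const_mul, hB1]
  congr 1; ext x; ring

namespace GraphPatch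

variable {Ω : Set Plane} (P : GraphPatch Ω)

/-- The ball on which the patch describes `Ω`. -/
def dom : Set Plane := Metric.ball P.center P.radius

/-- The point at height `t` above the point of the graph with abscissa `x`. -/
noncomputable def point (x t : ℝ) : Plane := P.e.symm !₂[x, P.ψ x + t]

/-- The abscissae at which the graph runs inside the patch, and so parametrises `∂Ω`. -/
def base : Set ℝ := {x | P.point x 0 ∈ P.dom}

/-- The upward normal `(-ψ', 1)` of the graph, not normalised. -/
noncomputable def normal (x : ℝ) : Plane := P.e.symm !₂[-deriv P.ψ x, 1]

theorem mem_iff {y : Plane} (hy : y ∈ P.dom) : y ∈ Ω ↔ (P.e y) 1 < P.ψ ((P.e y) 0) := by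
  have := Set.ext_iff.1 P.inter_eq y
  simp only [Set.mem_inter_iff, Set.mem_ofPred_eq] at this
  have hy' : y ∈ Metric.ball P.center P.radius := hy
  tauto

theorem isOpen_dom : IsOpen P.dom := Metric.isOpen_ball

@[simp] theorem e_point_zero (x t : ℝ) : (P.e (P.point x t)) 0 = x := by simp [point]

@[simp] theorem e_point_one (x t : ℝ) : (P.e (P.point x t)) 1 = P.ψ x + t := by simp [point]

theorem continuous_vec {X : Type*} [TopologicalSpace X] {f g : X → ℝ} (hf : Continuous f)
    (hg : Continuous g) : Continuous fun x => (!₂[f x, g x] : Plane) := by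
  refine (PiLp.continuous_toLp 2 _).comp (continuous_pi fun i => ?_)
  fin_cases i
  · exact hf
  · exact hg

theorem continuous_point : Continuous fun p : ℝ × ℝ => P.point p.1 p.2 :=
  P.e.symm.continuous.comp (continuous_vec continuous_fst
    ((P.contDiff.continuous.comp continuous_fst).add continuous_snd))

theorem continuous_point_zero : Continuous fun x => P.point x 0 :=
  P.continuous_point.comp (continuous_id.prodMk continuous_const)

theorem continuous_normal : Continuous P.normal :=
  P.e.symm.continuous.comp (continuous_vec (P.contDiff.continuous_deriv le_rfl).neg
    continuous_const)

theorem isOpen_base : IsOpen P.base := P.isOpen_dom.preimage P.continuous_point_zero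

theorem point_mem_frontier (hΩ : IsOpen Ω) {x : ℝ} (hx : x ∈ P.base) :
    P.point x 0 ∈ frontier Ω := by
  rw [hΩ.frontier_eq]
  refine ⟨?_, fun h => ?_⟩
  · have hc : Tendsto (fun t => P.point x t) (𝓝[<] 0) (𝓝 (P.point x 0)) :=
      ((P.continuous_point.comp (continuous_const.prodMk continuous_id)).tendsto 0).mono_left
        nhdsWithin_le_nhds
    refine mem_closure_of_tendsto hc ?_
    filter_upwards [hc (P.isOpen_dom.mem_nhds hx), self_mem_nhdsWithin] with t ht ht0
    rw [P.mem_iff ht]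
    simpa using ht0
  · rw [P.mem_iff hx] at h
    simp at h

/-- The graph parametrisation does not decrease length, as the projection to the abscissa is
`1`-Lipschitz. -/
theorem map_le_boundaryMeasure (hΩ : IsOpen Ω) :
    Measure.map (fun x => P.point x 0) (volume.restrict P.base) ≤ boundaryMeasure Ω := by
  have hm := P.continuous_point_zero.measurable
  refine Measure.le_iff.2 fun A hA => ?_
  rw [Measure.map_apply hm hA, Measure.restrict_apply (hm hA), boundaryMeasure,
    Measure.restrict_apply hA]
  have hl : LipschitzWith 1 fun y : Plane => (P.e y) 0 := by
    refine LipschitzWith.of_dist_le_mul fun y z => ?_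
    have := PiLp.norm_apply_le (P.e y - P.e z) 0
    rw [← map_sub, P.e.norm_map] at this
    simpa [dist_eq_norm] using this
  have hsub : (fun x => P.point x 0) ⁻¹' A ∩ P.base
      ⊆ (fun y : Plane => (P.e y) 0) '' (A ∩ frontier Ω) := fun x hx =>
    ⟨P.point x 0, ⟨hx.1, P.point_mem_frontier hΩ hx.2⟩, by simp⟩
  calc volume ((fun x => P.point x 0) ⁻¹' A ∩ P.base)
      ≤ volume ((fun y : Plane => (P.e y) 0) '' (A ∩ frontier Ω)) := measure_mono hsub
    _ = Measure.hausdorffMeasure 1 ((fun y : Plane => (P.e y) 0) '' (A ∩ frontier Ω)) := by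
        rw [hausdorffMeasure_real]
    _ ≤ _ := by simpa using hl.hausdorffMeasure_image_le zero_le_one (A ∩ frontier Ω)

theorem ae_base_of_ae_boundary (hΩ : IsOpen Ω) {p : Plane → Prop}
    (h : ∀ᵐ y ∂(boundaryMeasure Ω), p y) : ∀ᵐ x ∂(volume.restrict P.base), p (P.point x 0) :=
  ae_of_ae_map P.continuous_point_zero.aemeasurable
    ((Measure.absolutelyContinuous_of_le (P.map_le_boundaryMeasure hΩ)).ae_le h)

theorem inner_normal (x : ℝ) (y : Plane) :
    inner ℝ (P.normal x) y = (P.e y) 1 - deriv P.ψ x * (P.e y) 0 := by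
  rw [← P.e.inner_map_map]
  simp [normal, PiLp.inner_apply, Fin.sum_univ_two]
  ring

theorem one_le_norm_normal (x : ℝ) : 1 ≤ ‖P.normal x‖ := by
  have := PiLp.norm_apply_le (P.e (P.normal x)) 1
  rw [P.e.norm_map] at this
  simpa [normal] using this

/-- The normalised upward normal of the graph is the outer unit normal of `Ω`, which is what ties
the normal derivative in `HasCauchyData` to the patches. -/
theorem isOuterUnitNormal {x : ℝ} (hx : x ∈ P.base) :
    IsOuterUnitNormal Ω (P.point x 0) (‖P.normal x‖⁻¹ • P.normal x) := by
  have hN := P.one_le_norm_normal x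
  have hN0 : 0 < ‖P.normal x‖ := by linarith
  refine ⟨by rw [norm_smul, norm_inv, norm_norm, inv_mul_cancel₀ hN0.ne'], fun δ hδ => ?_⟩
  have hd : HasDerivAt P.ψ (deriv P.ψ x) x :=
    (P.contDiff.differentiable one_ne_zero x).hasDerivAt
  have hc : Tendsto (fun y : Plane => (P.e y) 0) (𝓝 (P.point x 0)) (𝓝 x) := by
    have : Continuous fun y : Plane => (P.e y) 0 := by fun_prop
    simpa using this.tendsto (P.point x 0)
  have hlo := hc.eventually ((hasDerivAt_iff_isLittleO.1 hd).def hδ)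
  filter_upwards [hlo, P.isOpen_dom.mem_nhds hx] with y hy hyd
  have hle : |(P.e y) 0 - x| ≤ ‖y - P.point x 0‖ := by
    have := PiLp.norm_apply_le (P.e y - P.e (P.point x 0)) 0
    rw [← map_sub, P.e.norm_map] at this
    simpa using this
  have hb : |P.ψ ((P.e y) 0) - P.ψ x - ((P.e y) 0 - x) * deriv P.ψ x|
      ≤ δ * ‖y - P.point x 0‖ := by
    refine (by simpa using hy : _ ≤ δ * |(P.e y) 0 - x|).trans ?_
    gcongr
  have hi : inner ℝ (P.normal x) (y - P.point x 0)
      = (P.e y) 1 - P.ψ x - ((P.e y) 0 - x) * deriv P.ψ x := by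
    rw [inner_normal]; simp; ring
  rw [real_inner_smul_left, hi, P.mem_iff hyd]
  have hinv : ‖P.normal x‖⁻¹ ≤ 1 := inv_le_one_of_one_le₀ hN
  have hinv0 : 0 < ‖P.normal x‖⁻¹ := by positivity
  have hb1 := (abs_le.1 hb).1
  have hb2 := (abs_le.1 hb).2
  have hnn : 0 ≤ δ * ‖y - P.point x 0‖ := by positivity
  constructor
  · intro h
    have : (P.e y) 1 - P.ψ x - ((P.e y) 0 - x) * deriv P.ψ x ≤ δ * ‖y - P.point x 0‖ := by linarith
    nlinarith
  · intro h
    have : -(δ * ‖y - P.point x 0‖) ≤ (P.e y) 1 - P.ψ x - ((P.e y) 0 - x) * deriv P.ψ x := by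
      linarith [not_lt.1 h]
    nlinarith

/-- The patch coordinates are a shear followed by an isometry. -/
theorem measurePreserving_point :
    MeasurePreserving (fun p : ℝ × ℝ => P.point p.1 p.2) (volume.prod volume) volume := by
  have h1 : MeasurePreserving (fun p : ℝ × ℝ => (p.1, P.ψ p.1 + p.2)) (volume.prod volume)
      (volume.prod volume) :=
    MeasurePreserving.skew_product (g := fun x t => P.ψ x + t) (MeasurePreserving.id _)
      ((P.contDiff.continuous.comp continuous_fst).add continuous_snd).measurable
      (ae_of_all _ fun x => map_add_left_eq_self volume (P.ψ x))
  have h2 := (volume_preserving_finTwoArrow ℝ).symm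
  have h3 := PiLp.volume_preserving_toLp (Fin 2)
  have h4 := P.e.symm.measurePreserving
  exact h4.comp (h3.comp (h2.comp h1))

theorem point_eq (x t : ℝ) :
    P.point x t = x • P.e.symm !₂[1, 0] + (P.ψ x + t) • P.e.symm !₂[0, 1] := by
  rw [point, ← map_smul, ← map_smul, ← map_add]
  congr 1
  ext j; fin_cases j <;> simp

theorem normal_apply (x : ℝ) (i : Fin 2) :
    P.normal x i = (P.e (EuclideanSpace.single i 1)) 1
      - deriv P.ψ x * (P.e (EuclideanSpace.single i 1)) 0 := by
  rw [← inner_normal, EuclideanSpace.inner_single_right]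
  simp

theorem exists_compact_of_comp_point {K : Set Plane} (hK : IsCompact K) :
    ∃ L : Set (ℝ × ℝ), IsCompact L ∧ ∀ p : ℝ × ℝ, P.point p.1 p.2 ∈ K → p ∈ L := by
  have hc : Continuous fun y : Plane => ((P.e y) 0, (P.e y) 1 - P.ψ ((P.e y) 0)) :=
    Continuous.prodMk (by fun_prop) ((show Continuous fun y : Plane => (P.e y) 1 by fun_prop).sub
      (P.contDiff.continuous.comp (by fun_prop)))
  exact ⟨_, hK.image hc, fun p hp => ⟨_, hp, by simp⟩⟩

/-- The divergence theorem for the subgraph `Ω`, in a patch. -/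
theorem integral_pderiv {g : Plane → ℝ} (hg : ContDiff ℝ 1 g) (hc : HasCompactSupport g)
    (hs : tsupport g ⊆ P.dom) (hΩ : IsOpen Ω) (i : Fin 2) :
    ∫ y in Ω, pderiv i g y = ∫ x, g (P.point x 0) * P.normal x i := by
  let S : Set Plane := {y | (P.e y) 1 < P.ψ ((P.e y) 0)}
  have hSo : IsOpen S := isOpen_lt (by fun_prop) (P.contDiff.continuous.comp (by fun_prop))
  have hpc := continuous_pderiv hg i
  have e1 : ∫ y in Ω, pderiv i g y = ∫ y in S, pderiv i g y := by
    rw [← integral_indicator hΩ.measurableSet, ← integral_indicator hSo.measurableSet]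
    congr 1; ext y
    by_cases hy : y ∈ P.dom
    · have : y ∈ Ω ↔ y ∈ S := P.mem_iff hy
      by_cases h : y ∈ Ω
      · simp [h, this.1 h]
      · simp [h, mt this.2 h]
    · have : pderiv i g y = 0 := image_eq_zero_of_notMem_tsupport fun h =>
        hy (hs (tsupport_pderiv_subset g i h))
      simp [Set.indicator, this]
  let Γ : ℝ × ℝ → Plane := fun p => P.point p.1 p.2
  have e2 : ∫ y in S, pderiv i g y
      = ∫ p in (Set.univ ×ˢ Set.Iio (0 : ℝ) : Set (ℝ × ℝ)), pderiv i g (Γ p)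
          ∂(volume.prod volume) := by
    have hmp := P.measurePreserving_point
    conv_lhs => rw [← hmp.map_eq]
    rw [setIntegral_map hSo.measurableSet hpc.aestronglyMeasurable hmp.measurable.aemeasurable]
    congr 2
    ext p
    simp [S]
  obtain ⟨L, hL, hKL⟩ := P.exists_compact_of_comp_point hc.isCompact
  set f₀ : Plane := P.e.symm !₂[1, 0] with hf₀
  set f₁ : Plane := P.e.symm !₂[0, 1] with hf₁
  let A : ℝ × ℝ → ℝ := fun p => fderiv ℝ g (Γ p) (f₀ + deriv P.ψ p.1 • f₁)
  let B : ℝ × ℝ → ℝ := fun p => fderiv ℝ g (Γ p) f₁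
  have hΓ : Continuous Γ := P.continuous_point
  have hψ' : Continuous (deriv P.ψ) := P.contDiff.continuous_deriv le_rfl
  have hAc : Continuous A := ((hg.continuous_fderiv one_ne_zero).comp hΓ).clm_apply
    (continuous_const.add ((hψ'.comp continuous_fst).smul continuous_const))
  have hBc : Continuous B := ((hg.continuous_fderiv one_ne_zero).comp hΓ).clm_apply continuous_const
  have hz : ∀ p, p ∉ L → fderiv ℝ g (Γ p) = 0 := fun p hp =>
    image_eq_zero_of_notMem_tsupport fun h => hp (hKL p (tsupport_fderiv_subset ℝ h))
  have hzg : ∀ p, p ∉ L → g (Γ p) = 0 := fun p hp =>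
    image_eq_zero_of_notMem_tsupport fun h => hp (hKL p h)
  have hAz : ∀ p, p ∉ L → A p = 0 := fun p hp => by simp [A, hz p hp]
  have hBz : ∀ p, p ∉ L → B p = 0 := fun p hp => by simp [B, hz p hp]
  set v : Plane := P.e (EuclideanSpace.single i 1) with hv
  have hsplit : ∀ p, pderiv i g (Γ p) = v 0 * A p + P.normal p.1 i * B p := by
    intro p
    have : (EuclideanSpace.single i 1 : Plane) = v 0 • f₀ + v 1 • f₁ := by
      rw [hf₀, hf₁, ← map_smul, ← map_smul, ← map_add, LinearIsometryEquiv.eq_symm_apply, ← hv]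
      ext j; fin_cases j <;> simp
    have hn := P.normal_apply p.1 i
    rw [← hv] at hn
    simp only [pderiv, A, B]
    rw [hn, this]
    simp only [map_add, map_smul, smul_eq_mul]
    ring
  have hd : Differentiable ℝ g := hg.differentiable one_ne_zero
  have hdx : ∀ x t, HasDerivAt (fun x => g (Γ (x, t))) (A (x, t)) x := by
    intro x t
    have h1 : HasDerivAt (fun x => P.point x t) (f₀ + deriv P.ψ x • f₁) x := by
      simp only [P.point_eq]
      have hψ := ((P.contDiff.differentiable one_ne_zero x).hasDerivAt).add_const t
      simpa using ((hasDerivAt_id x).smul_const f₀).fun_add (hψ.smul_const f₁)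
    exact (hd _).hasFDerivAt.comp_hasDerivAt x h1
  have hdt : ∀ x t, HasDerivAt (fun t => g (Γ (x, t))) (B (x, t)) t := by
    intro x t
    have h1 : HasDerivAt (fun t => P.point x t) f₁ t := by
      simp only [P.point_eq]
      have hψ := (hasDerivAt_id t).const_add (P.ψ x)
      simpa using (hψ.smul_const f₁).const_add (x • f₀)
    exact (hd _).hasFDerivAt.comp_hasDerivAt t h1
  have hNc : Continuous fun x => P.normal x i :=
    (EuclideanSpace.proj (𝕜 := ℝ) i).continuous.comp P.continuous_normal
  rw [e1, e2]
  simp only [hsplit]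
  exact integral_lower_halfPlane (h := fun p => g (Γ p)) (c := fun x => P.normal x i) (v 0) hL
    (hg.continuous.comp hΓ) hAc hBc hNc hzg hAz hBz hdx hdt

end GraphPatch

/-- Every boundary point lies in a patch; of the `C²` regularity, only `C¹` is kept. -/
theorem HasBoundaryOfClass.exists_graphPatch {Ω : Set Plane} (h : HasBoundaryOfClass 2 Ω)
    {z : Plane} (hz : z ∈ frontier Ω) : ∃ P : GraphPatch Ω, z ∈ P.dom := by
  obtain ⟨r, hr, e, ψ, hψ, heq⟩ := h z hz
  exact ⟨⟨z, r, e, ψ, hψ.of_le (by norm_num), heq⟩, Metric.mem_ball_self hr⟩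

theorem IsTestFunction.of_tsupport_subset_bounded {U : Set Plane} {φ : Plane → ℝ}
    (hφ : ContDiff ℝ ∞ φ) (hs : tsupport φ ⊆ U) (hU : Bornology.IsBounded U) :
    IsTestFunction U φ :=
  ⟨hφ, Metric.isCompact_of_isClosed_isBounded (isClosed_tsupport φ) (hU.subset hs), hs⟩

/-- A smooth partition of unity on `closure Ω`, each member of which is supported in `Ω` or in a
boundary patch. -/
theorem exists_partitionOfUnity {Ω : Set Plane} (hΩ : IsOpen Ω) (hb : Bornology.IsBounded Ω)
    (hC : HasBoundaryOfClass 2 Ω) : ∃ (n : ℕ) (f : Fin n → Plane → ℝ),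
      (∀ y ∈ closure Ω, ∑ a, f a y = 1) ∧
      ∀ a, IsTestFunction Ω (f a) ∨ ∃ P : GraphPatch Ω, IsTestFunction P.dom (f a) := by
  have hcov : ∀ z : closure Ω, ∃ U : Set Plane, IsOpen U ∧ (z : Plane) ∈ U ∧
      Bornology.IsBounded U ∧ (U ⊆ Ω ∨ ∃ P : GraphPatch Ω, U ⊆ P.dom) := by
    rintro ⟨z, hz⟩
    by_cases h : z ∈ Ω
    · exact ⟨Ω, hΩ, h, hb, Or.inl le_rfl⟩
    · obtain ⟨P, hP⟩ := hC.exists_graphPatch (z := z) (by rw [hΩ.frontier_eq]; exact ⟨hz, h⟩)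
      exact ⟨P.dom, P.isOpen_dom, hP, Metric.isBounded_ball, Or.inr ⟨P, le_rfl⟩⟩
  choose U hUo hzU hUb hU using hcov
  obtain ⟨t, ht⟩ := hb.isCompact_closure.elim_finite_subcover U hUo
    (fun z hz => Set.mem_iUnion.2 ⟨⟨z, hz⟩, hzU ⟨z, hz⟩⟩)
  let ι := Fin t.card
  let V : ι → Set Plane := fun a => U (t.equivFin.symm a)
  obtain ⟨f, hf⟩ := SmoothPartitionOfUnity.exists_isSubordinate (modelWithCornersSelf ℝ Plane)
    (isClosed_closure (s := Ω)) V (fun a => hUo _) (fun z hz => by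
      obtain ⟨a, ha, hza⟩ := Set.mem_iUnion₂.1 (ht hz)
      exact Set.mem_iUnion.2 ⟨t.equivFin ⟨a, ha⟩, by simpa [V] using hza⟩)
  refine ⟨t.card, fun a => f a, fun y hy => ?_, fun a => ?_⟩
  · rw [← finsum_eq_sum_of_fintype]
    exact f.sum_eq_one hy
  · have hsm : ContDiff ℝ ∞ (f a) := (f a).contMDiff.contDiff
    have ht := IsTestFunction.of_tsupport_subset_bounded hsm (hf a) (hUb _)
    exact (hU _).imp (fun h => ht.mono h) fun ⟨P, h⟩ => ⟨P, ht.mono h⟩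

/-! ### Green's formula for traces and extension by zero -/

section

theorem tendsto_integral_mul_of_eLpNorm {α : Type*} [MeasurableSpace α] {μ : Measure α}
    {f : ℕ → α → ℝ} {g h : α → ℝ} (hm : ∀ k, AEStronglyMeasurable (fun x => f k x - g x) μ)
    (hh : MemLp h 2 μ) (hf : ∀ k, Integrable (fun x => f k x * h x) μ)
    (hg : Integrable (fun x => g x * h x) μ)
    (hlim : Tendsto (fun k => eLpNorm (fun x => f k x - g x) 2 μ) atTop (𝓝 0)) :
    Tendsto (fun k => ∫ x, f k x * h x ∂μ) atTop (𝓝 (∫ x, g x * h x ∂μ)) := by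
  refine tendsto_integral_of_L1' _ hg.1 (Eventually.of_forall hf) ?_
  have hb : Tendsto (fun k => eLpNorm (fun x => f k x - g x) 2 μ * eLpNorm h 2 μ) atTop (𝓝 0) := by
    simpa using ENNReal.Tendsto.mul_const hlim (Or.inr hh.eLpNorm_ne_top)
  refine tendsto_of_tendsto_of_tendsto_of_le_of_le tendsto_const_nhds hb (fun _ => zero_le)
    fun k => ?_
  have := eLpNorm_smul_le_mul_eLpNorm (p := 2) (q := 2) (r := 1) hh.1 (hm k)
  refine le_trans (le_of_eq ?_) this
  congr 1; ext x
  simp only [Pi.sub_apply, Pi.smul_apply', smul_eq_mul]; ring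

theorem eLpNorm_le_eH1Norm {Ω : Set Plane} {u : Plane → ℝ} :
    eLpNorm u 2 (volume.restrict Ω) ≤ eH1Norm Ω u :=
  le_of_forall_gt_imp_ge_of_dense fun _ hδ =>
    let ⟨_, _, h, _⟩ := hasH1Bound_of_eH1Norm_lt hδ; h

theorem eLpNorm_partial_le_eH1Norm {Ω : Set Plane} (hΩ : IsOpen Ω) {u g : Plane → ℝ} {i : Fin 2}
    (hg : IsWeakPartial Ω i u g) : eLpNorm g 2 (volume.restrict Ω) ≤ eH1Norm Ω u :=
  le_of_forall_gt_imp_ge_of_dense fun _ hδ => (hasH1Bound_of_eH1Norm_lt hδ).eLpNorm_le hΩ hg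

theorem exists_testFunction_eq_one {K U : Set Plane} (hK : IsCompact K) (hU : IsOpen U)
    (hUb : Bornology.IsBounded U) (hKU : K ⊆ U) :
    ∃ κ : Plane → ℝ, IsTestFunction U κ ∧ ∀ y ∈ K, κ y = 1 := by
  obtain ⟨f, hf⟩ := SmoothPartitionOfUnity.exists_isSubordinate (modelWithCornersSelf ℝ Plane)
    hK.isClosed (fun _ : Unit => U) (fun _ => hU) (by simpa [Set.iUnion_const] using hKU)
  refine ⟨f (), IsTestFunction.of_tsupport_subset_bounded (f ()).contMDiff.contDiff (hf ()) hUb,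
    fun y hy => ?_⟩
  have := f.sum_eq_one hy
  rwa [finsum_eq_sum_of_fintype, Fintype.sum_unique] at this

variable {Ω : Set Plane}

theorem GraphPatch.memLp_comp_point (P : GraphPatch Ω) (hΩ : IsOpen Ω) {g : Plane → ℝ}
    (hg : AEStronglyMeasurable g (boundaryMeasure Ω)) :
    AEStronglyMeasurable (fun x => g (P.point x 0)) (volume.restrict P.base) ∧
    eLpNorm (fun x => g (P.point x 0)) 2 (volume.restrict P.base)
      ≤ eLpNorm g 2 (boundaryMeasure Ω) := by
  have hm := P.continuous_point_zero.measurable.aemeasurable (μ := volume.restrict P.base)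
  have hg' : AEStronglyMeasurable g
      (Measure.map (fun x => P.point x 0) (volume.restrict P.base)) :=
    hg.mono_measure (P.map_le_boundaryMeasure hΩ)
  refine ⟨hg'.comp_aemeasurable hm, ?_⟩
  have := eLpNorm_map_measure (p := 2) hg' hm
  simp only [Function.comp_def] at this
  rw [← this]
  exact eLpNorm_mono_measure _ (P.map_le_boundaryMeasure hΩ)

/-- Green's formula in a boundary patch: the trace is the boundary value in the integration by
parts. -/
theorem HasTrace.green {u T K ζ : Plane → ℝ} {i : Fin 2} (hΩ : IsOpen Ω) (hT : HasTrace Ω u T)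
    (hK : IsWeakPartial Ω i u K) (P : GraphPatch Ω) (hζ : IsTestFunction P.dom ζ) :
    (∫ y in Ω, u y * pderiv i ζ y) + ∫ y in Ω, K y * ζ y
      = ∫ x in P.base, T (P.point x 0) * (ζ (P.point x 0) * P.normal x i) := by
  obtain ⟨hu, hTm, φ, hφ, hlim, hlimT⟩ := hT
  have hKm := memLp_of_memH1_partial hΩ hu hK
  have cont_memLp : ∀ {ξ : Plane → ℝ}, IsTestFunction P.dom ξ →
      MemLp ξ 2 (volume.restrict Ω) := fun hξ =>
    (hξ.smooth.continuous.memLp_of_hasCompactSupport hξ.compact).restrict _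
  have hi : ∀ {ξ κ : Plane → ℝ}, IsTestFunction P.dom ξ → Continuous κ →
      Integrable (fun y => κ y * ξ y) (volume.restrict Ω) := fun hξ hκ =>
    ((hκ.mul hξ.smooth.continuous).integrable_of_hasCompactSupport hξ.compact.mul_left).integrableOn
  have hφ' : ∀ k, IsWeakPartial Ω i (φ k) (pderiv i (φ k)) := fun k =>
    IsWeakPartial.of_contDiff ((hφ k).of_le (by norm_cast))
  have hpc : ∀ k, Continuous (pderiv i (φ k)) := fun k => (contDiff_pderiv (hφ k) i).continuous
  have l1 : Tendsto (fun k => ∫ y in Ω, φ k y * pderiv i ζ y) atTop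
      (𝓝 (∫ y in Ω, u y * pderiv i ζ y)) := by
    refine tendsto_integral_mul_of_eLpNorm
      (fun k => (hφ k).continuous.aestronglyMeasurable.sub hu.1.1) (cont_memLp (hζ.pderiv i))
      (fun k => hi (hζ.pderiv i) (hφ k).continuous) (hu.1.integrable_mul (cont_memLp (hζ.pderiv i)))
      (tendsto_of_tendsto_of_tendsto_of_le_of_le tendsto_const_nhds hlim (fun _ => zero_le)
        fun k => eLpNorm_le_eH1Norm)
  have l2 : Tendsto (fun k => ∫ y in Ω, pderiv i (φ k) y * ζ y) atTop
      (𝓝 (∫ y in Ω, K y * ζ y)) := by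
    refine tendsto_integral_mul_of_eLpNorm
      (fun k => (hpc k).aestronglyMeasurable.sub hKm.1) (cont_memLp hζ)
      (fun k => hi hζ (hpc k)) (hKm.integrable_mul (cont_memLp hζ))
      (tendsto_of_tendsto_of_tendsto_of_le_of_le tendsto_const_nhds hlim (fun _ => zero_le)
        fun k => eLpNorm_partial_le_eH1Norm hΩ ((hφ' k).sub hK))
  let q : ℝ → ℝ := fun x => ζ (P.point x 0) * P.normal x i
  obtain ⟨L, hL, hKL⟩ := P.exists_compact_of_comp_point hζ.compact.isCompact
  have hqc : Continuous q := (hζ.smooth.continuous.comp P.continuous_point_zero).mul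
    ((EuclideanSpace.proj (𝕜 := ℝ) i).continuous.comp P.continuous_normal)
  have hqs : HasCompactSupport q := HasCompactSupport.intro (hL.image continuous_fst) fun x hx => by
    have : ζ (P.point x 0) = 0 := image_eq_zero_of_notMem_tsupport fun h =>
      hx ⟨(x, 0), hKL (x, 0) h, rfl⟩
    simp [q, this]
  have hqm : MemLp q 2 (volume.restrict P.base) := (hqc.memLp_of_hasCompactSupport hqs).restrict _
  have hTp := P.memLp_comp_point hΩ hTm.1
  have hTq : MemLp (fun x => T (P.point x 0)) 2 (volume.restrict P.base) :=
    ⟨hTp.1, hTp.2.trans_lt hTm.2⟩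
  have hφp : ∀ k, Continuous fun x => φ k (P.point x 0) := fun k =>
    (hφ k).continuous.comp P.continuous_point_zero
  have l3 : Tendsto (fun k => ∫ x in P.base, φ k (P.point x 0) * q x) atTop
      (𝓝 (∫ x in P.base, T (P.point x 0) * q x)) := by
    refine tendsto_integral_mul_of_eLpNorm
      (fun k => (hφp k).aestronglyMeasurable.sub hTp.1) hqm
      (fun k => (((hφp k).mul hqc).integrable_of_hasCompactSupport hqs.mul_left).integrableOn)
      (hTq.integrable_mul hqm)
      (tendsto_of_tendsto_of_tendsto_of_le_of_le tendsto_const_nhds hlimT (fun _ => zero_le)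
        fun k => (P.memLp_comp_point hΩ
          ((hφ k).continuous.aestronglyMeasurable.sub hTm.1)).2)
  refine tendsto_nhds_unique ((l1.add l2).congr fun k => ?_) l3
  have hprod := hζ.mul_left (hφ k)
  rw [← integral_add (hi (hζ.pderiv i) (hφ k).continuous) (hi hζ (hpc k)),
    setIntegral_eq_integral_of_forall_compl_eq_zero (s := P.base)]
  · have := P.integral_pderiv (hprod.smooth.of_le (by norm_cast)) hprod.compact hprod.support hΩ i
    have hpm : ∀ y, pderiv i (fun y => φ k y * ζ y) y
        = pderiv i (φ k) y * ζ y + φ k y * pderiv i ζ y :=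
      fun y => pderiv_mul ((hφ k).differentiable (by simp) y)
        (hζ.smooth.differentiable (by simp) y) i
    simp only [hpm, mul_assoc] at this
    rw [← this]
    congr 1; ext y; ring
  · intro x hx
    have : ζ (P.point x 0) = 0 := image_eq_zero_of_notMem_tsupport fun h => hx (hζ.support h)
    simp [q, this]

theorem setIntegral_eq_of_indicator {f : Plane → ℝ} (hΩ : IsOpen Ω) (g : Plane → ℝ) :
    ∫ y, Ω.indicator f y * g y = ∫ y in Ω, f y * g y := by
  rw [← integral_indicator hΩ.measurableSet]
  congr 1; ext y; by_cases hy : y ∈ Ω <;> simp [hy]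

/-- A function in `H¹(Ω)` with zero trace extends by zero to a weakly differentiable function on
the plane. Only the values of the trace along the boundary graphs matter. -/
theorem HasTrace.isWeakPartial_indicator {u T K : Plane → ℝ} {i : Fin 2} (hΩ : IsOpen Ω)
    (hb : Bornology.IsBounded Ω) (hC : HasBoundaryOfClass 2 Ω) (hT : HasTrace Ω u T)
    (hK : IsWeakPartial Ω i u K)
    (h0 : ∀ P : GraphPatch Ω, ∀ᵐ x ∂(volume.restrict P.base), T (P.point x 0) = 0) :
    IsWeakPartial Set.univ i (Ω.indicator u) (Ω.indicator K) := by
  have hum : MemLp u 2 (volume.restrict Ω) := hT.1.1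
  have hKm := memLp_of_memH1_partial hΩ hT.1 hK
  have hloc : ∀ {f : Plane → ℝ}, MemLp f 2 (volume.restrict Ω) →
      LocallyIntegrableOn (Ω.indicator f) Set.univ := fun hf =>
    memLp_two_locallyIntegrableOn (by
      rw [Measure.restrict_univ]; exact (memLp_indicator_iff_restrict hΩ.measurableSet).2 hf)
  refine ⟨hloc hum, hloc hKm, fun ζ hζ => ?_⟩
  rw [Measure.restrict_univ, setIntegral_eq_of_indicator hΩ, setIntegral_eq_of_indicator hΩ,
    ← add_eq_zero_iff_eq_neg]
  obtain ⟨n, f, hf1, hf⟩ := exists_partitionOfUnity hΩ hb hC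
  have hfs : ∀ a, ContDiff ℝ ∞ (f a) := fun a => by
    rcases hf a with h | ⟨P, h⟩ <;> exact h.smooth
  have hζa : ∀ a, IsTestFunction Set.univ (fun y => f a y * ζ y) := fun a => hζ.mul_left (hfs a)
  have hpiece : ∀ a, (∫ y in Ω, u y * pderiv i (fun y => f a y * ζ y) y)
      + ∫ y in Ω, K y * (f a y * ζ y) = 0 := by
    intro a
    rcases hf a with h | ⟨P, h⟩
    · have ht : IsTestFunction Ω (fun y => f a y * ζ y) := by
        simpa only [mul_comm] using h.mul_left hζ.smooth
      rw [hK.byParts _ ht]; ring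
    · have ht : IsTestFunction P.dom (fun y => f a y * ζ y) := by
        simpa only [mul_comm] using h.mul_left hζ.smooth
      rw [hT.green hΩ hK P ht]
      refine integral_eq_zero_of_ae ((h0 P).mono fun x hx => ?_)
      simp [hx]
  have hmul : ∀ {w ξ : Plane → ℝ}, MemLp w 2 (volume.restrict Ω) → IsTestFunction Set.univ ξ →
      Integrable (fun y => w y * ξ y) (volume.restrict Ω) := fun hw hξ =>
    have h2 : MemLp _ 2 (volume.restrict Ω) :=
      (hξ.smooth.continuous.memLp_of_hasCompactSupport hξ.compact).restrict _
    hw.integrable_mul h2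
  have hsum : ∀ y ∈ Ω, ∑ a, f a y = 1 := fun y hy => hf1 y (subset_closure hy)
  have e1 : ∫ y in Ω, u y * pderiv i ζ y
      = ∑ a, ∫ y in Ω, u y * pderiv i (fun y => f a y * ζ y) y := by
    rw [← integral_finsetSum _ fun a _ => hmul hum ((hζa a).pderiv i)]
    refine setIntegral_congr_fun hΩ.measurableSet fun y hy => ?_
    have hloc : ζ =ᶠ[𝓝 y] fun y => ∑ a, f a y * ζ y := by
      filter_upwards [hΩ.mem_nhds hy] with z hz
      rw [← Finset.sum_mul, hsum z hz, one_mul]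
    simp only [← Finset.mul_sum]
    congr 1
    simp only [pderiv]
    rw [hloc.fderiv_eq, fderiv_fun_sum fun a _ => (hζa a).smooth.differentiable (by simp) y]
    simp
  have e2 : ∫ y in Ω, K y * ζ y = ∑ a, ∫ y in Ω, K y * (f a y * ζ y) := by
    rw [← integral_finsetSum _ fun a _ => hmul hKm (hζa a)]
    refine setIntegral_congr_fun hΩ.measurableSet fun y hy => ?_
    simp only [← Finset.mul_sum, ← Finset.sum_mul, hsum y hy, one_mul]
  rw [e1, e2, ← Finset.sum_add_distrib]
  exact Finset.sum_eq_zero fun a _ => hpiece a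

/-- If `u` has zero trace, the trace of `∇u` has no tangential component. -/
theorem tangential_trace_eq_zero {u f : Plane → ℝ} {G T : Fin 2 → Plane → ℝ} (hΩ : IsOpen Ω)
    (hb : Bornology.IsBounded Ω) (hC : HasBoundaryOfClass 2 Ω) (hu : HasTrace Ω u f)
    (h0 : ∀ P : GraphPatch Ω, ∀ᵐ x ∂(volume.restrict P.base), f (P.point x 0) = 0)
    (hG : ∀ i, IsWeakPartial Ω i u (G i) ∧ HasTrace Ω (G i) (T i)) (P : GraphPatch Ω) :
    ∀ᵐ x ∂(volume.restrict P.base),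
      T 1 (P.point x 0) * P.normal x 0 - T 0 (P.point x 0) * P.normal x 1 = 0 := by
  obtain ⟨K, hK, -⟩ := (hG 1).2.1.2 0
  have hK' : IsWeakPartial Ω 1 (G 0) K := IsWeakPartial.comm (fun i => (hG i).1) hK
  have hTm : ∀ i, MemLp (fun x => T i (P.point x 0)) 2 (volume.restrict P.base) := fun i =>
    have h := P.memLp_comp_point hΩ (hG i).2.2.1.1
    ⟨h.1, h.2.trans_lt (hG i).2.2.1.2⟩
  have hNc : ∀ i, Continuous fun x => P.normal x i := fun i =>
    (EuclideanSpace.proj (𝕜 := ℝ) i).continuous.comp P.continuous_normal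
  have hloc : ∀ {w κ : ℝ → ℝ}, MemLp w 2 (volume.restrict P.base) → Continuous κ →
      LocallyIntegrableOn (fun x => w x * κ x) P.base := by
    intro w κ hw hκ
    have h1 : LocallyIntegrableOn w P.base :=
      locallyIntegrableOn_of_locallyIntegrable_restrict (hw.locallyIntegrable (by norm_num))
    exact h1.mul_continuousOn hκ.continuousOn P.isOpen_base.isLocallyClosed
  have := P.isOpen_base.ae_eq_zero_of_integral_contDiff_smul_eq_zero (μ := volume)
    ((hloc (hTm 1) (hNc 0)).sub (hloc (hTm 0) (hNc 1))) ?_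
  · rw [ae_restrict_iff' P.isOpen_base.measurableSet]
    exact this
  intro η hη hηc hηs
  -- `η` is the restriction to the graph of a test function of the patch
  have hKc : IsCompact ((fun x => P.point x 0) '' tsupport η) :=
    hηc.isCompact.image P.continuous_point_zero
  have hKd : (fun x => P.point x 0) '' tsupport η ⊆ P.dom := by
    rintro _ ⟨x, hx, rfl⟩; exact hηs hx
  obtain ⟨κ, hκt, hκ3⟩ := exists_testFunction_eq_one hKc P.isOpen_dom Metric.isBounded_ball hKd
  have hηe : ContDiff ℝ ∞ fun y : Plane => η ((P.e y) 0) := by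
    refine hη.comp ?_
    exact (EuclideanSpace.proj (𝕜 := ℝ) (0 : Fin 2)).contDiff.comp P.e.contDiff
  have hζ := hκt.mul_left hηe
  set ζ : Plane → ℝ := fun y => η ((P.e y) 0) * κ y with hζdef
  have hζp : ∀ x, ζ (P.point x 0) = η x := by
    intro x
    by_cases hx : x ∈ tsupport η
    · simp [hζdef, hκ3 _ ⟨x, hx, rfl⟩]
    · simp [hζdef, image_eq_zero_of_notMem_tsupport hx]
  have g1 := (hG 1).2.green hΩ hK P hζ
  have g0 := (hG 0).2.green hΩ hK' P hζ
  have w0 := (hu.isWeakPartial_indicator hΩ hb hC (hG 0).1 h0).byParts _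
    ((hζ.pderiv 1).mono (Set.subset_univ _))
  have w1 := (hu.isWeakPartial_indicator hΩ hb hC (hG 1).1 h0).byParts _
    ((hζ.pderiv 0).mono (Set.subset_univ _))
  simp only [Measure.restrict_univ, setIntegral_eq_of_indicator hΩ] at w0 w1
  have hcomm : ∫ y in Ω, u y * pderiv 0 (pderiv 1 ζ) y
      = ∫ y in Ω, u y * pderiv 1 (pderiv 0 ζ) y := by
    congr 1; ext y; rw [pderiv_comm hζ.smooth]
  have key : (∫ x in P.base, T 1 (P.point x 0) * (ζ (P.point x 0) * P.normal x 0))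
      = ∫ x in P.base, T 0 (P.point x 0) * (ζ (P.point x 0) * P.normal x 1) := by
    linarith
  simp only [hζp] at key
  have hint : ∀ i j, Integrable (fun x => T i (P.point x 0) * (η x * P.normal x j))
      (volume.restrict P.base) := fun i j =>
    have h2 : MemLp (fun x => η x * P.normal x j) 2 (volume.restrict P.base) :=
      ((hη.continuous.mul (hNc j)).memLp_of_hasCompactSupport hηc.mul_right).restrict _
    (hTm i).integrable_mul h2
  rw [← sub_eq_zero, ← integral_sub (hint 1 0) (hint 0 1)] at key
  rw [← setIntegral_eq_integral_of_forall_compl_eq_zero (s := P.base)]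
  · refine Eq.trans ?_ key
    congr 1; ext x; simp; ring
  · intro x hx
    simp [image_eq_zero_of_notMem_tsupport fun h => hx (hηs h)]

end

/-! ### Vanishing Cauchy data characterise `H²₀` -/

section

variable {Ω : Set Plane}

theorem HasH2Bound.congr {u v : Plane → ℝ} {δ : ℝ≥0∞} (hΩ : IsOpen Ω) (h : HasH2Bound Ω u δ)
    (huv : Set.EqOn u v Ω) : HasH2Bound Ω v δ := by
  obtain ⟨G, H, hG, hH, h0, h1, h2⟩ := h
  refine ⟨G, H, fun i => (hG i).congr hΩ.measurableSet huv fun _ _ => rfl, hH, ?_, h1, h2⟩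
  rwa [← eLpNorm_congr_ae ((ae_restrict_mem hΩ.measurableSet).mono huv)]

theorem MemH2.congr {u v : Plane → ℝ} (hΩ : IsOpen Ω) (h : MemH2 Ω u)
    (huv : Set.EqOn u v Ω) : MemH2 Ω v := by
  rw [memH2_iff_exists_hasH2Bound] at *
  obtain ⟨δ, hδ, h⟩ := h
  exact ⟨δ, hδ, h.congr hΩ huv⟩

theorem MemH20.congr {u v : Plane → ℝ} (hΩ : IsOpen Ω) (h : MemH20 Ω u)
    (huv : Set.EqOn u v Ω) : MemH20 Ω v := by
  rw [memH20_iff] at *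
  refine ⟨h.1.congr hΩ huv, fun δ hδ => ?_⟩
  obtain ⟨φ, hφ, hb⟩ := h.2 δ hδ
  exact ⟨φ, hφ, hb.congr hΩ fun y hy => by simp only [huv hy]⟩

theorem MemH2.mono_set {Ω' : Set Plane} {u : Plane → ℝ} (h : MemH2 Ω' u) (hΩ : Ω ⊆ Ω') :
    MemH2 Ω u := by
  rw [memH2_iff_exists_hasH2Bound] at *
  obtain ⟨δ, hδ, h⟩ := h
  exact ⟨δ, hδ, h.mono_set hΩ⟩

/-- Functions supported in a compact subset of `Ω` need only be mollified. -/
theorem MemH2.memH20_of_compact_support {K : Set Plane} {u : Plane → ℝ} (hΩ : IsOpen Ω)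
    (hK : IsCompact K) (hKΩ : K ⊆ Ω) (hu : MemH2 Set.univ u) (h0 : ∀ x, x ∉ K → u x = 0) :
    MemH20 Ω u := by
  refine memH20_iff.2 ⟨hu.mono_set (Set.subset_univ _), fun δ hδ => ?_⟩
  obtain ⟨φ, hφ, hb⟩ := hu.exists_testFunction hΩ hK hKΩ h0 hδ
  exact ⟨φ, hφ, hb.mono_set (Set.subset_univ _)⟩

theorem GraphPatch.mem_closure (P : GraphPatch Ω) {y : Plane} (hy : y ∈ P.dom)
    (hc : y ∈ closure Ω) : (P.e y) 1 ≤ P.ψ ((P.e y) 0) := by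
  by_contra! h
  have ho : IsOpen {y : Plane | P.ψ ((P.e y) 0) < (P.e y) 1} :=
    isOpen_lt (P.contDiff.continuous.comp (by fun_prop)) (by fun_prop)
  obtain ⟨z, ⟨hz1, hz2⟩, hzΩ⟩ := mem_closure_iff.1 hc _ (P.isOpen_dom.inter ho) ⟨hy, h⟩
  exact lt_asymm hz2 ((P.mem_iff hz1).1 hzΩ)

/-- A function in `H²(ℝ²)` that vanishes off `Ω` and is supported in a boundary patch can be pushed
downwards, into `Ω`, and is therefore in `H²₀(Ω)`. -/
theorem MemH2.memH20_of_support_patch {K : Set Plane} {u : Plane → ℝ} (hΩ : IsOpen Ω)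
    (P : GraphPatch Ω) (hK : IsCompact K) (hKP : K ⊆ P.dom) (hKΩ : K ⊆ closure Ω)
    (hu : MemH2 Set.univ u) (h0 : ∀ x, x ∉ K → u x = 0) : MemH20 Ω u := by
  refine memH20_iff.2 ⟨hu.mono_set (Set.subset_univ _), fun δ hδ => ?_⟩
  obtain ⟨r, hr, hb⟩ := hu.exists_translate_bound (ENNReal.half_pos hδ.ne')
  obtain ⟨s, hs, hsP⟩ := hK.exists_cthickening_subset_open P.isOpen_dom hKP
  set t := min (r / 2) s with ht
  have ht0 : 0 < t := by positivity
  set a : Plane := P.e.symm !₂[0, -t] with ha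
  have hea : P.e a = !₂[0, -t] := by simp [ha]
  have hna : ‖a‖ = t := by
    rw [ha, P.e.symm.norm_map, EuclideanSpace.norm_eq]
    simp [Fin.sum_univ_two, Real.sqrt_sq ht0.le]
  have hsub : (fun x => x + a) '' K ⊆ Ω := by
    rintro _ ⟨x, hx, rfl⟩
    have hd : x + a ∈ P.dom := hsP (Metric.mem_cthickening_of_dist_le _ x _ _ hx (by
      simp [dist_eq_norm, hna, ht]))
    rw [P.mem_iff hd]
    have := P.mem_closure (hKP hx) (hKΩ hx)
    simp only [map_add, hea]
    simp
    linarith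
  obtain ⟨φ, hφ, hb1⟩ := (hu.translate a).exists_testFunction hΩ
    (hK.image (f := fun x => x + a) (by fun_prop)) hsub
    (fun x hx => h0 _ fun h => hx ⟨x - a, h, by simp⟩) (ENNReal.half_pos hδ.ne')
  refine ⟨φ, hφ, ?_⟩
  have := (hb1.add (hb a (by rw [hna]; exact (min_le_left _ _).trans_lt (by linarith)))).mono_set
    (Set.subset_univ Ω)
  rw [ENNReal.add_halves] at this
  simpa using this

/-- The trace of the gradient of a function with zero Cauchy data vanishes: its tangential part
because the function has zero trace, its normal part by assumption. -/
theorem trace_gradient_eq_zero {u f : Plane → ℝ} {G T : Fin 2 → Plane → ℝ} (hΩ : IsOpen Ω)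
    (hb : Bornology.IsBounded Ω) (hC : HasBoundaryOfClass 2 Ω) (hu : HasTrace Ω u f)
    (h0 : ∀ P : GraphPatch Ω, ∀ᵐ x ∂(volume.restrict P.base), f (P.point x 0) = 0)
    (hG : ∀ i, IsWeakPartial Ω i u (G i) ∧ HasTrace Ω (G i) (T i))
    (hn : ∀ᵐ x ∂(boundaryMeasure Ω), ∀ n, IsOuterUnitNormal Ω x n → ∑ i, T i x * n i = 0)
    (P : GraphPatch Ω) (i : Fin 2) :
    ∀ᵐ x ∂(volume.restrict P.base), T i (P.point x 0) = 0 := by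
  filter_upwards [tangential_trace_eq_zero hΩ hb hC hu h0 hG P, P.ae_base_of_ae_boundary hΩ hn,
    ae_restrict_mem P.isOpen_base.measurableSet] with x h1 h2 hx
  have h3 := h2 _ (P.isOuterUnitNormal hx)
  have hN := P.one_le_norm_normal x
  have hN0 : ‖P.normal x‖ ≠ 0 := by positivity
  have hsq : P.normal x 0 ^ 2 + P.normal x 1 ^ 2 = ‖P.normal x‖ ^ 2 := by
    rw [EuclideanSpace.norm_sq_eq]; simp [Fin.sum_univ_two]
  have h4 : T 0 (P.point x 0) * P.normal x 0 + T 1 (P.point x 0) * P.normal x 1 = 0 := by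
    simp only [Fin.sum_univ_two, PiLp.smul_apply, smul_eq_mul] at h3
    field_simp at h3
    linarith
  have hpos : P.normal x 0 ^ 2 + P.normal x 1 ^ 2 ≠ 0 := by rw [hsq]; positivity
  fin_cases i
  · refine (mul_eq_zero.1 (?_ : T 0 (P.point x 0) *
      (P.normal x 0 ^ 2 + P.normal x 1 ^ 2) = 0)).resolve_right hpos
    linear_combination P.normal x 0 * h4 - P.normal x 1 * h1
  · refine (mul_eq_zero.1 (?_ : T 1 (P.point x 0) *
      (P.normal x 0 ^ 2 + P.normal x 1 ^ 2) = 0)).resolve_right hpos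
    linear_combination P.normal x 1 * h4 + P.normal x 0 * h1

/-- A function in `H²(Ω)` with vanishing Cauchy data belongs to `H²₀(Ω)`. -/
theorem MemH2.memH20_of_hasCauchyData_zero {u : Plane → ℝ} (hΩ : IsOpen Ω)
    (hb : Bornology.IsBounded Ω) (hC : HasBoundaryOfClass 2 Ω) (hu : MemH2 Ω u)
    (hcd : HasCauchyData Ω u (fun _ => 0)) : MemH20 Ω u := by
  obtain ⟨htr, G, T, hG, hn⟩ := hcd
  simp only [fderiv_fun_const, Pi.zero_apply, _root_.zero_apply] at hn
  have hT := trace_gradient_eq_zero hΩ hb hC htr (fun P => ae_of_all _ fun _ => rfl) hG hn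
  choose H hH hHm using fun i => (hG i).2.1.2
  have hind : ∀ {f : Plane → ℝ}, MemLp f 2 (volume.restrict Ω) →
      MemLp (Ω.indicator f) 2 (volume.restrict Set.univ) := fun hf => by
    rw [Measure.restrict_univ]; exact (memLp_indicator_iff_restrict hΩ.measurableSet).2 hf
  have hV : MemH2 Set.univ (Ω.indicator u) := by
    refine ⟨hind hu.1, fun i => ⟨Ω.indicator (G i), htr.isWeakPartial_indicator hΩ hb hC (hG i).1
      (fun P => ae_of_all _ fun _ => rfl), hind (hG i).2.1.1, fun j => ⟨Ω.indicator (H i j), ?_,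
      hind (hHm i j)⟩⟩⟩
    exact (hG i).2.isWeakPartial_indicator hΩ hb hC (hH i j) fun P => hT P i
  obtain ⟨n, f, hf1, hf⟩ := exists_partitionOfUnity hΩ hb hC
  have hpiece : ∀ a, MemH20 Ω (fun y => f a y * Ω.indicator u y) := by
    intro a
    have h0 : ∀ y, y ∉ tsupport (f a) ∩ closure Ω → f a y * Ω.indicator u y = 0 := by
      intro y hy
      by_cases h : y ∈ tsupport (f a)
      · have : y ∉ Ω := fun h' => hy ⟨h, subset_closure h'⟩
        simp [this]
      · simp [image_eq_zero_of_notMem_tsupport h]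
    rcases hf a with h | ⟨P, h⟩
    · exact (hV.mul_testFunction h).memH20_of_compact_support hΩ
        (h.compact.isCompact.inter_right isClosed_closure)
        (Set.inter_subset_left.trans h.support) h0
    · exact (hV.mul_testFunction h).memH20_of_support_patch hΩ P
        (h.compact.isCompact.inter_right isClosed_closure)
        (Set.inter_subset_left.trans h.support) Set.inter_subset_right h0
  refine (MemH20.sum hb Finset.univ fun a _ => hpiece a).congr hΩ fun y hy => ?_
  simp [← Finset.sum_mul, hf1 y (subset_closure hy), hy]

/-! ### Adding a smooth function to Cauchy data -/

/-- The boundary has finite length: each patch of it is a Lipschitz image of a bounded interval. -/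
theorem boundaryMeasure_univ_lt_top (hΩ : IsOpen Ω) (hb : Bornology.IsBounded Ω)
    (hC : HasBoundaryOfClass 2 Ω) : boundaryMeasure Ω Set.univ < ⊤ := by
  rw [boundaryMeasure, Measure.restrict_apply_univ]
  have hcomp : IsCompact (frontier Ω) :=
    hb.isCompact_closure.of_isClosed_subset isClosed_frontier frontier_subset_closure
  refine hcomp.measure_lt_top_of_nhdsWithin fun z hz => ?_
  obtain ⟨P, hP⟩ := hC.exists_graphPatch hz
  refine ⟨P.dom ∩ frontier Ω, inter_mem (mem_nhdsWithin_of_mem_nhds (P.isOpen_dom.mem_nhds hP))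
    self_mem_nhdsWithin, ?_⟩
  have hcont : Continuous fun y : Plane => (P.e y) 0 := by fun_prop
  have hbase : IsCompact ((fun y : Plane => (P.e y) 0) '' closure P.dom) :=
    (Metric.isBounded_ball.isCompact_closure).image hcont
  obtain ⟨M, hM⟩ := hbase.isBounded.subset_closedBall 0
  have hγ : ContDiff ℝ 1 fun x => P.point x 0 := by
    simp only [P.point_eq]
    exact (contDiff_id.smul contDiff_const).add
      ((P.contDiff.add contDiff_const).smul contDiff_const)
  obtain ⟨C, hCl⟩ := (hγ.locallyLipschitz.locallyLipschitzOn
    (s := Metric.closedBall (0 : ℝ) M)).exists_lipschitzOnWith_of_compact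
      (isCompact_closedBall _ _)
  have hsub : P.dom ∩ frontier Ω ⊆ (fun x => P.point x 0) '' Metric.closedBall (0 : ℝ) M := by
    rintro y ⟨hy, hyf⟩
    refine ⟨(P.e y) 0, hM ⟨y, subset_closure hy, rfl⟩, ?_⟩
    rw [hΩ.frontier_eq] at hyf
    have h1 := P.mem_closure hy hyf.1
    have h2 := mt (P.mem_iff hy).2 hyf.2
    have h3 : P.ψ ((P.e y) 0) = (P.e y) 1 := le_antisymm (not_lt.1 h2) h1
    change P.e.symm !₂[(P.e y) 0, P.ψ ((P.e y) 0) + 0] = y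
    rw [LinearIsometryEquiv.symm_apply_eq, add_zero, h3]
    ext j; fin_cases j <;> rfl
  refine (measure_mono hsub).trans_lt ((hCl.hausdorffMeasure_image_le zero_le_one).trans_lt ?_)
  rw [hausdorffMeasure_real]
  exact ENNReal.mul_lt_top (by simp) (isCompact_closedBall _ _).measure_lt_top

theorem memLp_boundaryMeasure_of_continuous (hΩ : IsOpen Ω) (hb : Bornology.IsBounded Ω)
    (hC : HasBoundaryOfClass 2 Ω) {F : Plane → ℝ} (hF : Continuous F) :
    MemLp F 2 (boundaryMeasure Ω) := by
  have : IsFiniteMeasure (boundaryMeasure Ω) := ⟨boundaryMeasure_univ_lt_top hΩ hb hC⟩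
  obtain ⟨C, hC⟩ := hb.isCompact_closure.exists_bound_of_continuousOn hF.continuousOn
  exact MemLp.of_bound hF.aestronglyMeasurable C
    ((ae_restrict_mem isClosed_frontier.measurableSet).mono fun y hy =>
      hC y (frontier_subset_closure hy))

theorem MemH1.add_contDiff (hb : Bornology.IsBounded Ω) {u F : Plane → ℝ} (hu : MemH1 Ω u)
    (hF : ContDiff ℝ ∞ F) : MemH1 Ω (fun x => u x + F x) :=
  ⟨hu.1.add (memLp_two_of_continuous_of_isBounded hb hF.continuous), fun i =>
    let ⟨_, hg, hm⟩ := hu.2 i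
    ⟨_, hg.add (IsWeakPartial.of_contDiff (hF.of_le (by norm_cast))),
      hm.add (memLp_two_of_continuous_of_isBounded hb (contDiff_pderiv hF i).continuous)⟩⟩

theorem HasTrace.add_contDiff (hΩ : IsOpen Ω) (hb : Bornology.IsBounded Ω)
    (hC : HasBoundaryOfClass 2 Ω) {u g F : Plane → ℝ} (h : HasTrace Ω u g) (hF : ContDiff ℝ ∞ F) :
    HasTrace Ω (fun x => u x + F x) (fun x => g x + F x) := by
  obtain ⟨h1, hg, φ, hφ, hl1, hl2⟩ := h
  refine ⟨h1.add_contDiff hb hF,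
    hg.add (memLp_boundaryMeasure_of_continuous hΩ hb hC hF.continuous),
    fun k x => φ k x + F x, fun k => (hφ k).add hF, ?_, ?_⟩
  · simpa using hl1
  · simpa using hl2

theorem HasTrace.congr {u g g' : Plane → ℝ} (h : HasTrace Ω u g)
    (hg : ∀ x ∈ frontier Ω, g x = g' x) : HasTrace Ω u g' := by
  obtain ⟨h1, hm, φ, hφ, hl1, hl2⟩ := h
  have e : g =ᵐ[boundaryMeasure Ω] g' :=
    (ae_restrict_mem isClosed_frontier.measurableSet).mono hg
  refine ⟨h1, (memLp_congr_ae e).1 hm, φ, hφ, hl1, hl2.congr fun k => eLpNorm_congr_ae ?_⟩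
  filter_upwards [e] with x hx
  rw [hx]

/-- If `u` has the Cauchy data of `f`, and the smooth function `F` extends `-f` from a neighbourhood
of `∂Ω`, then `u + F` has vanishing Cauchy data. -/
theorem HasCauchyData.add_contDiff_eq_zero (hΩ : IsOpen Ω) (hb : Bornology.IsBounded Ω)
    (hC : HasBoundaryOfClass 2 Ω) {u f F : Plane → ℝ} (h : HasCauchyData Ω u f)
    (hF : ContDiff ℝ ∞ F) (hfF : ∀ x ∈ frontier Ω, f =ᶠ[𝓝 x] fun y => - F y) :
    HasCauchyData Ω (fun x => u x + F x) (fun _ => 0) := by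
  obtain ⟨htr, G, T, hG, hn⟩ := h
  refine ⟨(htr.add_contDiff hΩ hb hC hF).congr fun x hx => by simp [(hfF x hx).self_of_nhds],
    fun i x => G i x + pderiv i F x, fun i x => T i x + pderiv i F x, fun i =>
    ⟨(hG i).1.add (IsWeakPartial.of_contDiff (hF.of_le (by norm_cast))),
      (hG i).2.add_contDiff hΩ hb hC (contDiff_pderiv hF i)⟩, ?_⟩
  filter_upwards [hn, ae_restrict_mem isClosed_frontier.measurableSet] with x hx hxf n hxn
  have h1 := hx n hxn
  rw [(hfF x hxf).fderiv_eq, fderiv_fun_neg] at h1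
  simp only [add_mul, Finset.sum_add_distrib, h1, ← fderiv_eq_sum_pderiv]
  simp

end

/-! ### Functions with Lipschitz gradient -/

theorem LocallyLipschitz.mul_real {f g : Plane → ℝ} (hf : LocallyLipschitz f)
    (hg : LocallyLipschitz g) : LocallyLipschitz fun x => f x * g x :=
  ((contDiff_fst.mul contDiff_snd : ContDiff ℝ 1 fun p : ℝ × ℝ => p.1 * p.2).locallyLipschitz).comp
    (hf.prodMk hg)

theorem LocallyLipschitz.add_real {f g : Plane → ℝ} (hf : LocallyLipschitz f)
    (hg : LocallyLipschitz g) : LocallyLipschitz fun x => f x + g x :=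
  ((contDiff_fst.add contDiff_snd : ContDiff ℝ 1 fun p : ℝ × ℝ => p.1 + p.2).locallyLipschitz).comp
    (hf.prodMk hg)

theorem LocallyLipschitz.exists_lipschitzWith_of_hasCompactSupport {f : Plane → ℝ}
    (hf : LocallyLipschitz f) (hc : HasCompactSupport f) : ∃ C, LipschitzWith C f := by
  obtain ⟨M, hM⟩ := hc.isCompact.isBounded.subset_closedBall 0
  obtain ⟨C, hC⟩ := (hf.locallyLipschitzOn (s := Metric.closedBall (0 : Plane) (M + 1))
    ).exists_lipschitzOnWith_of_compact (isCompact_closedBall _ _)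
  obtain ⟨B, hB⟩ := hc.exists_bound_of_continuous hf.continuous
  have hB0 : 0 ≤ B := (norm_nonneg _).trans (hB 0)
  -- a point of the support and a point outside the larger ball are at distance at least one
  have far : ∀ x y : Plane, y ∉ Metric.closedBall (0 : Plane) (M + 1) →
      |f x - f y| ≤ B * dist x y := by
    intro x y hy
    have hfy : f y = 0 := image_eq_zero_of_notMem_tsupport fun h =>
      hy (Metric.closedBall_subset_closedBall (by linarith) (hM h))
    by_cases hx : x ∈ tsupport f
    · have h1 : ‖x‖ ≤ M := by simpa using hM hx
      have h2 : M + 1 < ‖y‖ := by simpa using hy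
      have h3 : 1 ≤ dist x y := by
        rw [dist_eq_norm, norm_sub_rev]
        linarith [norm_sub_norm_le y x]
      rw [hfy, sub_zero]
      exact (hB x).trans (le_mul_of_one_le_right hB0 h3)
    · rw [hfy, image_eq_zero_of_notMem_tsupport hx]
      simp; positivity
  refine ⟨max C B.toNNReal, LipschitzWith.of_dist_le_mul fun x y => ?_⟩
  have hle : B ≤ max (C : ℝ) B := le_max_right _ _
  rw [NNReal.coe_max, Real.coe_toNNReal _ hB0, Real.dist_eq]
  by_cases hy : y ∈ Metric.closedBall (0 : Plane) (M + 1)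
  · by_cases hx : x ∈ Metric.closedBall (0 : Plane) (M + 1)
    · have := hC.dist_le_mul x hx y hy
      rw [Real.dist_eq] at this
      exact this.trans (by gcongr; exact le_max_left _ _)
    · rw [abs_sub_comm, dist_comm]
      exact (far y x hx).trans (by gcongr)
  · exact (far x y hy).trans (by gcongr)

theorem memLp_two_lineDeriv_of_lipschitz {f : Plane → ℝ} {C : NNReal} (hf : LipschitzWith C f)
    (hc : HasCompactSupport f) (i : Fin 2) :
    MemLp (fun x => lineDeriv ℝ f x (EuclideanSpace.single i 1)) 2 := by
  have hm : AEStronglyMeasurable (fun x => lineDeriv ℝ f x (EuclideanSpace.single i (1 : ℝ))) :=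
    (measurable_lineDeriv hf.continuous).aestronglyMeasurable
  have h0 : ∀ x, x ∉ tsupport f → lineDeriv ℝ f x (EuclideanSpace.single i (1 : ℝ)) = 0 := by
    intro x hx
    have : f =ᶠ[𝓝 x] fun _ => 0 := notMem_tsupport_iff_eventuallyEq.1 hx
    rw [this.lineDeriv_eq]
    simp [lineDeriv]
  have : IsFiniteMeasure (volume.restrict (tsupport f)) :=
    ⟨by simpa using hc.isCompact.measure_lt_top⟩
  have h : MemLp (fun x => lineDeriv ℝ f x (EuclideanSpace.single i (1 : ℝ))) 2
      (volume.restrict (tsupport f)) := by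
    refine MemLp.of_bound hm.restrict C (ae_of_all _ fun x => ?_)
    simpa using norm_lineDeriv_le_of_lipschitz ℝ hf (x₀ := x) (v := EuclideanSpace.single i (1 : ℝ))
  rw [← memLp_indicator_iff_restrict (isClosed_tsupport f).measurableSet] at h
  rwa [Set.indicator_eq_self.2 fun x hx => by_contra fun hx' => hx (h0 x hx')] at h

/-- A `C¹` function with locally Lipschitz gradient is in `H²` after multiplication by a cutoff. -/
theorem memH2_mul_of_locallyLipschitz_pderiv {u η : Plane → ℝ} (hη : IsTestFunction Set.univ η)
    (hu : ContDiff ℝ 1 u) (hG : ∀ i, LocallyLipschitz (pderiv i u)) :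
    MemH2 Set.univ (fun x => η x * u x) := by
  have hcs : ∀ {ξ w : Plane → ℝ}, IsTestFunction Set.univ ξ → Continuous w →
      MemLp (fun x => ξ x * w x) 2 (volume.restrict Set.univ) := fun hξ hw => by
    rw [Measure.restrict_univ]
    exact (hξ.smooth.continuous.mul hw).memLp_of_hasCompactSupport hξ.compact.mul_right
  refine ⟨hcs hη hu.continuous, fun i => ⟨_, (IsWeakPartial.of_contDiff hu).mul_smooth hη.smooth,
    (hcs (hη.pderiv i) hu.continuous).add (hcs hη (hG i).continuous), fun j => ?_⟩⟩
  have hl : LocallyLipschitz fun x => η x * pderiv i u x :=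
    (hη.smooth.of_le (n := ∞) (m := 1) (by norm_cast)).locallyLipschitz.mul_real (hG i)
  have hc : HasCompactSupport fun x => η x * pderiv i u x := hη.compact.mul_right
  obtain ⟨C, hC⟩ := hl.exists_lipschitzWith_of_hasCompactSupport hc
  refine ⟨_, ((IsWeakPartial.of_contDiff hu).mul_smooth (hη.pderiv i).smooth).add
    (IsWeakPartial.of_lipschitz (i := j) hC), ?_⟩
  refine ((hcs ((hη.pderiv i).pderiv j) hu.continuous).add (hcs (hη.pderiv i)
    (hG j).continuous)).add ?_
  rw [Measure.restrict_univ]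
  exact memLp_two_lineDeriv_of_lipschitz hC hc j

theorem hasFDerivAt_radial_mul_linear {h h' : ℝ → ℝ} (hd : ∀ t, HasDerivAt h (h' t) t)
    (x n y : Plane) : HasFDerivAt (fun y => h (‖y - x‖ ^ 2) * inner ℝ n (y - x))
      (h (‖y - x‖ ^ 2) • innerSL ℝ n
        + inner ℝ n (y - x) • (h' (‖y - x‖ ^ 2) • (2 • innerSL ℝ (y - x)))) y := by
  have h1 : HasFDerivAt (fun y : Plane => ‖y - x‖ ^ 2) (2 • innerSL ℝ (y - x)) y := by
    exact (((hasStrictFDerivAt_norm_sq (y - x)).hasFDerivAt.comp y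
      ((hasFDerivAt_id y).sub_const x))).congr_fderiv (ContinuousLinearMap.comp_id _)
  have h2 : HasFDerivAt (fun y : Plane => inner ℝ n (y - x)) (innerSL ℝ n) y := by
    exact (((innerSL ℝ n).hasFDerivAt (x := y - x)).comp y
      ((hasFDerivAt_id y).sub_const x)).congr_fderiv (ContinuousLinearMap.comp_id _)
  exact ((hd _).comp_hasFDerivAt y h1).mul h2

theorem pderiv_radial_mul_linear {h h' : ℝ → ℝ} (hd : ∀ t, HasDerivAt h (h' t) t)
    (x n y : Plane) (i : Fin 2) : pderiv i (fun y => h (‖y - x‖ ^ 2) * inner ℝ n (y - x)) y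
      = h (‖y - x‖ ^ 2) * n i + h' (‖y - x‖ ^ 2) * (inner ℝ n (y - x) * (2 * (y i - x i))) := by
  rw [pderiv, (hasFDerivAt_radial_mul_linear hd x n y).fderiv]
  simp [EuclideanSpace.inner_single_right]
  ring

/-- A radial factor `h(|y - x|²)` with Lipschitz derivative makes a linear function `C^{1,1}`. -/
theorem radial_mul_linear_regularity {h h' : ℝ → ℝ} (hd : ∀ t, HasDerivAt h (h' t) t)
    (hl : LocallyLipschitz h') (x n : Plane) :
    ContDiff ℝ 1 (fun y => h (‖y - x‖ ^ 2) * inner ℝ n (y - x)) ∧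
    ∀ i, LocallyLipschitz (pderiv i fun y => h (‖y - x‖ ^ 2) * inner ℝ n (y - x)) := by
  have hC1 : ContDiff ℝ 1 h := contDiff_one_iff_deriv.2 ⟨fun t => (hd t).differentiableAt, by
    rw [funext fun t => (hd t).deriv]; exact hl.continuous⟩
  have hsq : ContDiff ℝ 1 fun y : Plane => ‖y - x‖ ^ 2 :=
    (contDiff_id.sub contDiff_const).norm_sq ℝ
  have hin : ContDiff ℝ 1 fun y : Plane => (inner ℝ n (y - x) : ℝ) :=
    contDiff_const.inner ℝ (contDiff_id.sub contDiff_const)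
  refine ⟨(hC1.comp hsq).mul hin, fun i => ?_⟩
  rw [funext fun y => pderiv_radial_mul_linear hd x n y i]
  have hi : ContDiff ℝ 1 fun y : Plane => 2 * (y i - x i) :=
    contDiff_const.mul (((EuclideanSpace.proj (𝕜 := ℝ) i).contDiff).sub contDiff_const)
  exact ((hC1.comp hsq).mul contDiff_const).locallyLipschitz.add_real
    ((hl.comp hsq.locallyLipschitz).mul_real (hin.mul hi).locallyLipschitz)

/-! ### The core-regularised Airy functions -/

/-- The radial factor of the Airy function outside the core, as a function of `t = |y|²`. -/
noncomputable def airyOuter (R ε t : ℝ) : ℝ :=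
  (2 * ((R ^ 2 - ε ^ 2) / (R ^ 2 + ε ^ 2)) - 2 * Real.log (R ^ 2))
    + 2 * ε ^ 2 * (R ^ 2 / (R ^ 2 + ε ^ 2)) / t + -(2 / (R ^ 2 + ε ^ 2)) * t + 2 * Real.log t

/-- The derivative of the radial factor outside the core, with `q = 1 / t`. -/
noncomputable def airyOuterDeriv (R ε q : ℝ) : ℝ :=
  -(2 * ε ^ 2 * (R ^ 2 / (R ^ 2 + ε ^ 2))) * q ^ 2 - 2 / (R ^ 2 + ε ^ 2) + 2 * q

theorem hasDerivAt_airyOuter (R ε : ℝ) {t : ℝ} (ht : 0 < t) :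
    HasDerivAt (airyOuter R ε) (airyOuterDeriv R ε t⁻¹) t := by
  have h1 := ((hasDerivAt_inv ht.ne').const_mul (2 * ε ^ 2 * (R ^ 2 / (R ^ 2 + ε ^ 2))))
  have h2 := (hasDerivAt_id t).const_mul (-(2 / (R ^ 2 + ε ^ 2)))
  have h3 := (Real.hasDerivAt_log ht.ne').const_mul 2
  have h4 := ((h1.const_add (2 * ((R ^ 2 - ε ^ 2) / (R ^ 2 + ε ^ 2))
    - 2 * Real.log (R ^ 2))).fun_add h2).fun_add h3
  have e : airyOuter R ε = fun t => 2 * ((R ^ 2 - ε ^ 2) / (R ^ 2 + ε ^ 2)) - 2 * Real.log (R ^ 2)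
      + 2 * ε ^ 2 * (R ^ 2 / (R ^ 2 + ε ^ 2)) * t⁻¹ + -(2 / (R ^ 2 + ε ^ 2)) * id t
      + 2 * Real.log t := by
    ext t; simp only [airyOuter, id, div_eq_mul_inv]
  rw [e]
  refine h4.congr_deriv ?_
  simp only [airyOuterDeriv]
  ring

/-- The outer radial factor is stationary at `|y| = ε`. It is therefore continued by a constant into
the core with a continuous, even Lipschitz, derivative. -/
theorem airyOuterDeriv_core {R ε : ℝ} (hε : 0 < ε) : airyOuterDeriv R ε (ε ^ 2)⁻¹ = 0 := by
  have : R ^ 2 + ε ^ 2 ≠ 0 := by positivity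
  simp only [airyOuterDeriv]
  field_simp
  ring

theorem hasDerivAt_airyOuter_max {R ε : ℝ} (hε : 0 < ε) (t : ℝ) :
    HasDerivAt (fun t => airyOuter R ε (max t (ε ^ 2)))
      (airyOuterDeriv R ε (max t (ε ^ 2))⁻¹) t := by
  have hε2 : 0 < ε ^ 2 := by positivity
  rcases lt_trichotomy t (ε ^ 2) with h | h | h
  · rw [max_eq_right h.le, airyOuterDeriv_core hε]
    refine (hasDerivAt_const t (airyOuter R ε (ε ^ 2))).congr_of_eventuallyEq ?_
    filter_upwards [Iio_mem_nhds h] with s hs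
    rw [max_eq_right (le_of_lt hs)]
  · subst h
    rw [max_self]
    have h1 : HasDerivWithinAt (fun t => airyOuter R ε (max t (ε ^ 2)))
        (airyOuterDeriv R ε (ε ^ 2)⁻¹) (Set.Iic (ε ^ 2)) (ε ^ 2) := by
      rw [airyOuterDeriv_core hε]
      exact (hasDerivWithinAt_const _ _ (airyOuter R ε (ε ^ 2))).congr
        (fun s hs => by rw [max_eq_right hs]) (by rw [max_self])
    have h2 : HasDerivWithinAt (fun t => airyOuter R ε (max t (ε ^ 2)))
        (airyOuterDeriv R ε (ε ^ 2)⁻¹) (Set.Ici (ε ^ 2)) (ε ^ 2) :=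
      (hasDerivAt_airyOuter R ε hε2).hasDerivWithinAt.congr
        (fun s hs => by rw [max_eq_left hs]) (by rw [max_self])
    simpa [Set.Iic_union_Ici] using h1.union h2
  · rw [max_eq_left h.le]
    refine (hasDerivAt_airyOuter R ε (hε2.trans h)).congr_of_eventuallyEq ?_
    filter_upwards [Ioi_mem_nhds h] with s hs
    rw [max_eq_left (le_of_lt hs)]

theorem locallyLipschitz_airyOuterDeriv_max {R ε : ℝ} (hε : 0 < ε) :
    LocallyLipschitz fun t => airyOuterDeriv R ε (max t (ε ^ 2))⁻¹ := by
  have hε2 : 0 < ε ^ 2 := by positivity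
  have h1 : LocallyLipschitz fun t : ℝ => (max t (ε ^ 2))⁻¹ := by
    refine LipschitzWith.locallyLipschitz (K := ((ε ^ 2 * ε ^ 2)⁻¹).toNNReal)
      (LipschitzWith.of_dist_le_mul fun s t => ?_)
    have hs : ε ^ 2 ≤ max s (ε ^ 2) := le_max_right _ _
    have ht : ε ^ 2 ≤ max t (ε ^ 2) := le_max_right _ _
    have hs0 := hε2.trans_le hs
    have ht0 := hε2.trans_le ht
    rw [Real.coe_toNNReal _ (by positivity), Real.dist_eq, Real.dist_eq,
      inv_sub_inv hs0.ne' ht0.ne', abs_div, abs_of_pos (mul_pos hs0 ht0), inv_mul_eq_div,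
      abs_sub_comm]
    have := abs_max_sub_max_le_abs s t (ε ^ 2)
    gcongr
  have h2 : ContDiff ℝ 1 (airyOuterDeriv R ε) := by
    unfold airyOuterDeriv; fun_prop
  exact h2.locallyLipschitz.comp h1

/-- The unit vector `Π(b)/|b|` along which the Airy function of `b` is linear in its core. -/
noncomputable def airyDirection (b : Plane) : Plane := ‖b‖⁻¹ • clockwise b

theorem norm_frame {b : Plane} (hb : b ≠ 0) (y : Plane) :
    ‖(!₂[inner ℝ (‖b‖⁻¹ • clockwise b) y, inner ℝ (‖b‖⁻¹ • b) y] : Plane)‖ = ‖y‖ := by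
  have hb0 : ‖b‖ ≠ 0 := norm_ne_zero_iff.2 hb
  have h1 : ‖b‖ ^ 2 = b 0 ^ 2 + b 1 ^ 2 := by
    rw [EuclideanSpace.norm_sq_eq]; simp [Fin.sum_univ_two]
  have h2 : ‖y‖ ^ 2 = y 0 ^ 2 + y 1 ^ 2 := by
    rw [EuclideanSpace.norm_sq_eq]; simp [Fin.sum_univ_two]
  rw [← sq_eq_sq₀ (norm_nonneg _) (norm_nonneg _), EuclideanSpace.norm_sq_eq, h2]
  simp only [Fin.sum_univ_two, Real.norm_eq_abs, sq_abs, real_inner_smul_left]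
  simp [clockwise, PiLp.inner_apply, Fin.sum_univ_two]
  field_simp
  rw [h1]
  ring

/-- The constant `|b| E / (16 π (1 - ν²))`. -/
noncomputable def airyCoeff (E ν : ℝ) (b : Plane) : ℝ :=
  ‖b‖ / (16 * Real.pi) * (E / (1 - ν ^ 2))

/-- Both branches of the Airy function at once: the core amounts to truncating `|y|²` at `ε²`. -/
theorem airyVector_eq {E ν R ε : ℝ} {b : Plane} (hb : b ≠ 0) (hε : 0 < ε) (y : Plane) :
    airyVector E ν R ε b y
      = airyCoeff E ν b *
        (airyOuter R ε (max (‖y‖ ^ 2) (ε ^ 2)) * inner ℝ (airyDirection b) y) := by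
  simp only [airyVector, airyScalar, norm_frame hb, airyDirection, airyCoeff, airyOuter]
  split_ifs with h
  · have : ‖y‖ ^ 2 ≤ ε ^ 2 := by gcongr
    rw [max_eq_right this, Real.log_pow]
    simp
    ring
  · have : ε ^ 2 ≤ ‖y‖ ^ 2 := by
      have := not_lt.1 h
      gcongr
    rw [max_eq_left this]
    simp
    ring

/-- The regularised Airy function is `C^{1,1}`, hence in `H²₀` after localisation. -/
theorem memH20_mul_airyVector {Ω : Set Plane} (hΩ : IsOpen Ω) {E ν R ε : ℝ} {b : Plane}
    (hb : b ≠ 0) (hε : 0 < ε) (x : Plane) {η : Plane → ℝ} (hη : IsTestFunction Ω η) :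
    MemH20 Ω (fun y => η y * airyVector E ν R ε b (y - x)) := by
  obtain ⟨h1, h2⟩ := radial_mul_linear_regularity (hasDerivAt_airyOuter_max (R := R) hε)
    (locallyLipschitz_airyOuterDeriv_max hε) x (airyDirection b)
  set u : Plane → ℝ := fun y => airyOuter R ε (max (‖y - x‖ ^ 2) (ε ^ 2)) *
    inner ℝ (airyDirection b) (y - x)
  have hη' : IsTestFunction Ω (fun y => airyCoeff E ν b * η y) := hη.mul_left contDiff_const
  have hm := memH2_mul_of_locallyLipschitz_pderiv (hη'.mono (Set.subset_univ _)) h1 h2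
  have he : (fun y => η y * airyVector E ν R ε b (y - x))
      = fun y => airyCoeff E ν b * η y * u y := by
    ext y; rw [airyVector_eq hb hε]; ring
  rw [he]
  refine hm.memH20_of_compact_support hΩ hη.compact.isCompact hη.support fun y hy => ?_
  simp [image_eq_zero_of_notMem_tsupport hy]

/-- In its core the regularised Airy function is linear. -/
theorem airyVector_core {E ν R ε : ℝ} {b : Plane} (hb : b ≠ 0) (hε : 0 < ε) {y : Plane}
    (hy : ‖y‖ < ε) : airyVector E ν R ε b y
      = airyCoeff E ν b * airyOuter R ε (ε ^ 2) * inner ℝ (airyDirection b) y := by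
  have : ‖y‖ ^ 2 ≤ ε ^ 2 := by gcongr
  rw [airyVector_eq hb hε, max_eq_right this]
  ring

/-! ### The Airy functions away from the core -/

theorem contDiff_cutoff_mul {χ g : Plane → ℝ} {x : Plane} (hχ : ContDiff ℝ ∞ χ)
    (h0 : χ =ᶠ[𝓝 x] fun _ => 0) (hg : ∀ y, y ≠ x → ContDiffAt ℝ ∞ g y) :
    ContDiff ℝ ∞ fun y => χ y * g y := by
  rw [contDiff_iff_contDiffAt]
  intro y
  by_cases hy : y = x
  · subst hy
    refine (contDiffAt_const (c := (0 : ℝ))).congr_of_eventuallyEq ?_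
    filter_upwards [h0] with z hz
    simp [hz]
  · exact hχ.contDiffAt.mul (hg y hy)

theorem contDiffAt_norm_sub_sq (x y : Plane) : ContDiffAt ℝ ∞ (fun y => ‖y - x‖ ^ 2) y :=
  (contDiffAt_id.sub contDiffAt_const).norm_sq ℝ

theorem contDiffAt_inner_sub (n x y : Plane) :
    ContDiffAt ℝ ∞ (fun y => (inner ℝ n (y - x) : ℝ)) y :=
  contDiffAt_const.inner ℝ (contDiffAt_id.sub contDiffAt_const)

/-- The function `W_0^j` of a single dislocation, in the shape of the outer formula for `ε = 0`. In
`airyOuter` the term in `1 / t` then has coefficient zero. -/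
noncomputable def airyLimit (E ν R : ℝ) (b y : Plane) : ℝ :=
  airyCoeff E ν b * (airyOuter R 0 (‖y‖ ^ 2) * inner ℝ (airyDirection b) y)

theorem plasticW0_eq {Ω : Set Plane} (α : EdgeDislocations Ω) (E ν : ℝ) {R : ℝ} (hR : 0 < R)
    (y : Plane) : plasticW0 α E ν R y = ∑ j, airyLimit E ν R (α.b j) (y - α.x j) := by
  refine Finset.sum_congr rfl fun j _ => ?_
  simp only [airyLimit, airyCoeff, airyOuter, airyDirection]
  field_simp
  ring

theorem contDiff_cutoff_mul_airyLimit {χ : Plane → ℝ} {x : Plane} (hχ : ContDiff ℝ ∞ χ)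
    (h0 : χ =ᶠ[𝓝 x] fun _ => 0) (E ν R : ℝ) (b : Plane) :
    ContDiff ℝ ∞ fun y => χ y * airyLimit E ν R b (y - x) := by
  refine contDiff_cutoff_mul hχ h0 fun y hy => ?_
  have hn : ‖y - x‖ ^ 2 ≠ 0 := by simpa [sub_eq_zero] using hy
  have hsq := contDiffAt_norm_sub_sq x y
  have hin := contDiffAt_inner_sub (airyDirection b) x y
  unfold airyLimit airyOuter
  exact contDiffAt_const.mul ((((contDiffAt_const.add (contDiffAt_const.div hsq hn)).add
    (contDiffAt_const.mul hsq)).add (contDiffAt_const.mul (hsq.log hn))).mul hin)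

theorem contDiff_cutoff_mul_airyVector {χ : Plane → ℝ} {x : Plane} {ρ : ℝ} (hχ : ContDiff ℝ ∞ χ)
    (h0 : ∀ y ∈ Metric.closedBall x ρ, χ y = 0) {E ν R ε : ℝ} {b : Plane} (hb : b ≠ 0)
    (hε : 0 < ε) (hερ : ε ≤ ρ) :
    ContDiff ℝ ∞ fun y => χ y * airyVector E ν R ε b (y - x) := by
  have hev : χ =ᶠ[𝓝 x] fun _ => 0 := by
    filter_upwards [Metric.closedBall_mem_nhds x (hε.trans_le hερ)] with y hy using h0 y hy
  have he : (fun y => χ y * airyVector E ν R ε b (y - x)) = fun y => χ y *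
      (airyCoeff E ν b * (airyOuter R ε (‖y - x‖ ^ 2) * inner ℝ (airyDirection b) (y - x))) := by
    ext y
    by_cases hy : y ∈ Metric.closedBall x ρ
    · simp [h0 y hy]
    · have : ε ≤ ‖y - x‖ := by
        rw [Metric.mem_closedBall, dist_eq_norm, not_le] at hy; linarith
      rw [airyVector_eq hb hε, max_eq_left (by gcongr)]
  rw [he]
  refine contDiff_cutoff_mul hχ hev fun y hy => ?_
  have hn : ‖y - x‖ ^ 2 ≠ 0 := by simpa [sub_eq_zero] using hy
  have hsq := contDiffAt_norm_sub_sq x y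
  have hin := contDiffAt_inner_sub (airyDirection b) x y
  unfold airyOuter
  exact contDiffAt_const.mul ((((contDiffAt_const.add (contDiffAt_const.div hsq hn)).add
    (contDiffAt_const.mul hsq)).add (contDiffAt_const.mul (hsq.log hn))).mul hin)

/-- Away from the core, `W_ε → W_0` in `H²`: the difference is a combination of three fixed smooth
functions with coefficients tending to zero. -/
theorem eventually_cutoff_airyVector_sub_bound {Ω : Set Plane} (hbd : Bornology.IsBounded Ω)
    {χ : Plane → ℝ} {x : Plane} {ρ : ℝ} (hχ : ContDiff ℝ ∞ χ) (hρ : 0 < ρ)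
    (h0 : ∀ y ∈ Metric.closedBall x ρ, χ y = 0) (E ν : ℝ) {R : ℝ} (hR : 0 < R) {b : Plane}
    (hb : b ≠ 0) {δ : ℝ≥0∞} (hδ : 0 < δ) : ∀ᶠ ε in 𝓝[>] (0 : ℝ), HasH2Bound Ω
      (fun y => χ y * airyVector E ν R ε b (y - x) - χ y * airyLimit E ν R b (y - x)) δ := by
  have hev : χ =ᶠ[𝓝 x] fun _ => 0 := by
    filter_upwards [Metric.closedBall_mem_nhds x hρ] with y hy using h0 y hy
  let m : Plane → ℝ := fun y => airyCoeff E ν b * inner ℝ (airyDirection b) (y - x)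
  let A : Plane → ℝ := fun y => χ y * m y
  let B : Plane → ℝ := fun y => χ y * (m y / ‖y - x‖ ^ 2)
  let C : Plane → ℝ := fun y => χ y * (m y * ‖y - x‖ ^ 2)
  have hm : ∀ y, ContDiffAt ℝ ∞ m y := fun y =>
    contDiffAt_const.mul (contDiffAt_inner_sub _ _ _)
  have hA : ContDiff ℝ ∞ A := contDiff_cutoff_mul hχ hev fun y _ => hm y
  have hB : ContDiff ℝ ∞ B := contDiff_cutoff_mul hχ hev fun y hy =>
    (hm y).div (contDiffAt_norm_sub_sq x y) (by simpa [sub_eq_zero] using hy)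
  have hC : ContDiff ℝ ∞ C := contDiff_cutoff_mul hχ hev fun y _ =>
    (hm y).mul (contDiffAt_norm_sub_sq x y)
  obtain ⟨a, ha, hA⟩ := memH2_iff_exists_hasH2Bound.1 (memH2_of_contDiff hbd hA)
  obtain ⟨b', hb', hB⟩ := memH2_iff_exists_hasH2Bound.1 (memH2_of_contDiff hbd hB)
  obtain ⟨c, hc, hC⟩ := memH2_iff_exists_hasH2Bound.1 (memH2_of_contDiff hbd hC)
  let s : ℝ → ℝ := fun ε => 2 * ((R ^ 2 - ε ^ 2) / (R ^ 2 + ε ^ 2)) - 2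
  let t : ℝ → ℝ := fun ε => 2 * ε ^ 2 * (R ^ 2 / (R ^ 2 + ε ^ 2))
  let r : ℝ → ℝ := fun ε => -(2 / (R ^ 2 + ε ^ 2)) + 2 / R ^ 2
  have hne : ∀ ε : ℝ, R ^ 2 + ε ^ 2 ≠ 0 := fun ε => by positivity
  have hs : Continuous s := by fun_prop (disch := exact hne _)
  have ht : Continuous t := by fun_prop (disch := exact hne _)
  have hr : Continuous r := by fun_prop (disch := exact hne _)
  have hs0 : s 0 = 0 := by simp only [s]; field_simp; ring
  have ht0 : t 0 = 0 := by simp [t]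
  have hr0 : r 0 = 0 := by simp only [r]; simp
  have hlim : ∀ {f : ℝ → ℝ} {k : ℝ≥0∞}, Continuous f → f 0 = 0 → k ≠ ⊤ →
      Tendsto (fun ε => ‖f ε‖ₑ * k) (𝓝[>] 0) (𝓝 0) := by
    intro f k hf hf0 hk
    have h1 : Tendsto (fun ε => ‖f ε‖ₑ) (𝓝[>] 0) (𝓝 0) := by
      have := (hf.enorm.tendsto 0).mono_left (nhdsWithin_le_nhds (s := Set.Ioi 0))
      simpa [hf0] using this
    simpa using ENNReal.Tendsto.mul_const h1 (Or.inr hk)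
  have htot : Tendsto (fun ε => ‖s ε‖ₑ * a + ‖t ε‖ₑ * b' + ‖r ε‖ₑ * c) (𝓝[>] 0) (𝓝 0) := by
    simpa using ((hlim hs hs0 ha).add (hlim ht ht0 hb')).add (hlim hr hr0 hc)
  filter_upwards [htot.eventually (gt_mem_nhds hδ), Ioo_mem_nhdsGT hρ] with ε h1 h2
  have hbound := (((hA.const_mul (s ε)).add (hB.const_mul (t ε))).add
    (hC.const_mul (r ε))).mono h1.le
  convert hbound using 1
  ext y
  by_cases hy : y ∈ Metric.closedBall x ρ
  · simp [h0 y hy, A, B, C]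
  · rw [Metric.mem_closedBall, dist_eq_norm, not_le] at hy
    have hy2 : ε ≤ ‖y - x‖ := by linarith [h2.2]
    have hy3 : ‖y - x‖ ≠ 0 := (hρ.trans hy).ne'
    have hε := hne ε
    rw [airyVector_eq hb h2.1, max_eq_left (by have := h2.1; gcongr)]
    simp only [airyLimit, airyOuter, A, B, C, m, s, t, r]
    field_simp
    ring

/-! ### Making test functions affine in the cores -/

theorem abs_sub_le_of_pderiv_le {f : Plane → ℝ} (hf : Differentiable ℝ f) {x y : Plane} {C : ℝ}
    (hC : ∀ z ∈ Metric.closedBall x ‖y - x‖, ∀ i, |pderiv i f z| ≤ C) :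
    |f y - f x| ≤ 2 * C * ‖y - x‖ := by
  have := (convex_closedBall x ‖y - x‖).norm_image_sub_le_of_norm_fderiv_le (𝕜 := ℝ)
    (fun z _ => hf z) (fun z hz => norm_fderiv_le_of_pderiv (hC z hz))
    (Metric.mem_closedBall_self (norm_nonneg _)) (x := x) (y := y)
    (by rw [Metric.mem_closedBall, dist_eq_norm])
  simpa using this

/-- Taylor estimates for a function vanishing to first order at `x`. -/
theorem exists_taylor_bound {r : Plane → ℝ} (hr : ContDiff ℝ ∞ r) {x : Plane} (h0 : r x = 0)
    (h1 : ∀ i, pderiv i r x = 0) : ∃ M : ℝ, 0 ≤ M ∧ ∀ y ∈ Metric.closedBall x 1,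
      |r y| ≤ 4 * M * ‖y - x‖ ^ 2 ∧ (∀ i, |pderiv i r y| ≤ 2 * M * ‖y - x‖) ∧
      ∀ i j, |pderiv j (pderiv i r) y| ≤ M := by
  have hK : IsCompact (Metric.closedBall x 1) := isCompact_closedBall x 1
  choose B hB using fun i j => hK.exists_bound_of_continuousOn
    (contDiff_pderiv (contDiff_pderiv hr i) j).continuous.continuousOn
  have hx : x ∈ Metric.closedBall x 1 := Metric.mem_closedBall_self zero_le_one
  have hBn : ∀ i j, 0 ≤ B i j := fun i j => (norm_nonneg _).trans (hB i j x hx)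
  set M := ∑ i, ∑ j, B i j with hM
  have hBM : ∀ i j, B i j ≤ M := fun i j =>
    (Finset.single_le_sum (fun j _ => hBn i j) (Finset.mem_univ j)).trans
      (Finset.single_le_sum (f := fun i => ∑ j, B i j)
        (fun i _ => Finset.sum_nonneg fun j _ => hBn i j) (Finset.mem_univ i))
  have h2 : ∀ y ∈ Metric.closedBall x 1, ∀ i j, |pderiv j (pderiv i r) y| ≤ M :=
    fun y hy i j => (hB i j y hy).trans (hBM i j)
  have hsub : ∀ y ∈ Metric.closedBall x 1, Metric.closedBall x ‖y - x‖ ⊆ Metric.closedBall x 1 :=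
    fun y hy => Metric.closedBall_subset_closedBall (by simpa [dist_eq_norm] using hy)
  have h3 : ∀ y ∈ Metric.closedBall x 1, ∀ i, |pderiv i r y| ≤ 2 * M * ‖y - x‖ := by
    intro y hy i
    have := abs_sub_le_of_pderiv_le ((contDiff_pderiv hr i).differentiable (by simp))
      (fun z hz j => h2 z (hsub y hy hz) i j)
    rwa [h1, sub_zero] at this
  refine ⟨M, Finset.sum_nonneg fun i _ => Finset.sum_nonneg fun j _ => hBn i j, fun y hy =>
    ⟨?_, h3 y hy, h2 y hy⟩⟩
  have hM0 : 0 ≤ M := Finset.sum_nonneg fun i _ => Finset.sum_nonneg fun j _ => hBn i j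
  have := abs_sub_le_of_pderiv_le (hr.differentiable (by simp)) (x := x) (y := y)
    (C := 2 * M * ‖y - x‖) (fun z hz i => (h3 z (hsub y hy hz) i).trans (by
      have : ‖z - x‖ ≤ ‖y - x‖ := by simpa [dist_eq_norm] using hz
      gcongr))
  rw [h0, sub_zero] at this
  exact this.trans (le_of_eq (by ring))

/-- The bump function `η((y - x)/ε)`. -/
noncomputable def scaledBump (η : Plane → ℝ) (x : Plane) (ε : ℝ) (y : Plane) : ℝ :=
  η (ε⁻¹ • (y - x))

theorem pderiv_scaledBump {η : Plane → ℝ} (hη : Differentiable ℝ η) (x : Plane) (ε : ℝ)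
    (i : Fin 2) (y : Plane) :
    pderiv i (scaledBump η x ε) y = ε⁻¹ * scaledBump (pderiv i η) x ε y := by
  have h1 : HasFDerivAt (fun y : Plane => ε⁻¹ • (y - x))
      (ε⁻¹ • ContinuousLinearMap.id ℝ Plane) y := ((hasFDerivAt_id y).sub_const x).const_smul ε⁻¹
  have h2 := (hη (ε⁻¹ • (y - x))).hasFDerivAt.comp y h1
  have h3 : pderiv i (scaledBump η x ε) y
      = ((fderiv ℝ η (ε⁻¹ • (y - x))).comp (ε⁻¹ • ContinuousLinearMap.id ℝ Plane))
        (EuclideanSpace.single i 1) := by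
    rw [pderiv]; exact congrArg (fun L : Plane →L[ℝ] ℝ => L _) h2.fderiv
  rw [h3]
  simp [scaledBump, pderiv]

theorem contDiff_scaledBump {η : Plane → ℝ} (hη : ContDiff ℝ ∞ η) (x : Plane) (ε : ℝ) :
    ContDiff ℝ ∞ (scaledBump η x ε) :=
  hη.comp ((contDiff_id.sub contDiff_const).const_smul ε⁻¹)

theorem eLpNorm_le_of_bounded_of_support {f : Plane → ℝ} {x : Plane} {s C : ℝ}
    (h0 : ∀ y, y ∉ Metric.closedBall x s → f y = 0)
    (hC : ∀ y ∈ Metric.closedBall x s, |f y| ≤ C) :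
    eLpNorm f 2 ≤ volume (Metric.closedBall x s) ^ (2⁻¹ : ℝ) * ENNReal.ofReal C := by
  rw [← eLpNorm_restrict_eq_of_support_subset (s := Metric.closedBall x s)
    (fun y hy => by_contra fun h => hy (h0 y h))]
  refine (eLpNorm_le_of_ae_bound (C := C)
    ((ae_restrict_mem Metric.isClosed_closedBall.measurableSet).mono hC)).trans ?_
  simp

theorem tendsto_volume_closedBall (x : Plane) (C : ℝ) : Tendsto (fun ε : ℝ =>
    volume (Metric.closedBall x (2 * ε)) ^ (2⁻¹ : ℝ) * ENNReal.ofReal C) (𝓝[>] 0) (𝓝 0) := by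
  have h1 : Tendsto (fun ε : ℝ => volume (Metric.closedBall x (2 * ε))) (𝓝[>] 0) (𝓝 0) := by
    have hc : Tendsto (fun ε : ℝ =>
        ENNReal.ofReal ((2 * ε) ^ 2) * volume (Metric.ball (0 : Plane) 1)) (𝓝[>] 0) (𝓝 0) := by
      have h2 : Tendsto (fun ε : ℝ => ENNReal.ofReal ((2 * ε) ^ 2)) (𝓝[>] 0) (𝓝 0) := by
        have : Continuous fun ε : ℝ => ENNReal.ofReal ((2 * ε) ^ 2) :=
          ENNReal.continuous_ofReal.comp (by fun_prop)
        simpa using (this.tendsto 0).mono_left (nhdsWithin_le_nhds (s := Set.Ioi 0))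
      have := ENNReal.Tendsto.mul_const (b := volume (Metric.ball (0 : Plane) 1)) h2
        (Or.inr Metric.isBounded_ball.measure_lt_top.ne)
      rwa [zero_mul] at this
    refine hc.congr' ?_
    filter_upwards [self_mem_nhdsWithin] with ε hε
    have : (0 : ℝ) ≤ 2 * ε := by have : (0 : ℝ) < ε := hε; positivity
    rw [Measure.addHaar_closedBall _ _ this]
    simp
  have h2 : Tendsto (fun ε : ℝ => volume (Metric.closedBall x (2 * ε)) ^ (2⁻¹ : ℝ)) (𝓝[>] 0)
      (𝓝 0) := by
    have := h1.ennrpow_const (2⁻¹ : ℝ)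
    rwa [ENNReal.zero_rpow_of_pos (by norm_num)] at this
  simpa using ENNReal.Tendsto.mul_const (b := ENNReal.ofReal C) h2 (Or.inr ENNReal.ofReal_ne_top)

/-- Cutting off, at scale `ε`, a function vanishing to first order produces a function that is small
in `H²`: its second derivatives are bounded uniformly in `ε`, on a set of area `O(ε²)`. -/
theorem eventually_scaledBump_mul_bound {η r : Plane → ℝ} (hη : ContDiff ℝ ∞ η)
    (hηs : tsupport η ⊆ Metric.closedBall 0 2) (hr : ContDiff ℝ ∞ r) {x : Plane} (h0 : r x = 0)
    (h1 : ∀ i, pderiv i r x = 0) {δ : ℝ≥0∞} (hδ : 0 < δ) : ∀ᶠ ε in 𝓝[>] (0 : ℝ),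
      HasH2Bound Set.univ (fun y => scaledBump η x ε y * r y) δ := by
  obtain ⟨M, hM, hT⟩ := exists_taylor_bound hr h0 h1
  have hηc : HasCompactSupport η :=
    HasCompactSupport.of_support_subset_isCompact (isCompact_closedBall 0 2)
      ((subset_tsupport _).trans hηs)
  have hηt : IsTestFunction Set.univ η := ⟨hη, hηc, Set.subset_univ _⟩
  obtain ⟨N0, hN0⟩ := hηc.exists_bound_of_continuous hη.continuous
  choose N1 hN1 using fun i =>
    (hηt.pderiv i).compact.exists_bound_of_continuous (hηt.pderiv i).smooth.continuous
  choose N2 hN2 using fun i j => ((hηt.pderiv i).pderiv j).compact.exists_bound_of_continuous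
    ((hηt.pderiv i).pderiv j).smooth.continuous
  have p0 : 0 ≤ N0 := (norm_nonneg _).trans (hN0 0)
  have p1 : ∀ i, 0 ≤ N1 i := fun i => (norm_nonneg _).trans (hN1 i 0)
  have p2 : ∀ i j, 0 ≤ N2 i j := fun i j => (norm_nonneg _).trans (hN2 i j 0)
  set N := N0 + ∑ i, N1 i + ∑ i, ∑ j, N2 i j with hN
  have s1 : 0 ≤ ∑ i, N1 i := Finset.sum_nonneg fun i _ => p1 i
  have s2 : 0 ≤ ∑ i, ∑ j, N2 i j := Finset.sum_nonneg fun i _ => Finset.sum_nonneg fun j _ => p2 i j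
  have hNn : 0 ≤ N := by positivity
  have b0 : ∀ z, |η z| ≤ N := fun z => (hN0 z).trans (by linarith)
  have b1 : ∀ i z, |pderiv i η z| ≤ N := fun i z => (hN1 i z).trans (by
    have := Finset.single_le_sum (fun i _ => p1 i) (Finset.mem_univ i)
    linarith)
  have b2 : ∀ i j z, |pderiv j (pderiv i η) z| ≤ N := fun i j z => (hN2 i j z).trans (by
    have h1 := Finset.single_le_sum (fun j _ => p2 i j) (Finset.mem_univ j)
    have h2 := Finset.single_le_sum (f := fun i => ∑ j, N2 i j)
      (fun i _ => Finset.sum_nonneg fun j _ => p2 i j) (Finset.mem_univ i)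
    linarith)
  -- `25 = 16 + 4 + 4 + 1` collects the four terms of the second derivative of the product
  have hvol := (tendsto_volume_closedBall x (25 * (N * M))).eventually (gt_mem_nhds hδ)
  filter_upwards [hvol, Ioo_mem_nhdsGT (show (0 : ℝ) < 1 / 2 by norm_num)] with ε hε hε'
  have e0 : 0 < ε := hε'.1
  have e1 : 2 * ε ≤ 1 := by linarith [hε'.2]
  set β := scaledBump η x ε with hβ
  have hβs : ContDiff ℝ ∞ β := contDiff_scaledBump hη x ε
  have dβ : ∀ i y, pderiv i β y = ε⁻¹ * scaledBump (pderiv i η) x ε y :=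
    pderiv_scaledBump (hη.differentiable (by simp)) x ε
  have ddβ : ∀ i j y, pderiv j (pderiv i β) y
      = ε⁻¹ * (ε⁻¹ * scaledBump (pderiv j (pderiv i η)) x ε y) := by
    intro i j y
    rw [funext (dβ i), pderiv_const_mul
      ((contDiff_scaledBump (contDiff_pderiv hη i) x ε).differentiable (by simp) y),
      pderiv_scaledBump ((contDiff_pderiv hη i).differentiable (by simp))]
  have hprod : ContDiff ℝ ∞ fun y => β y * r y := hβs.mul hr
  have hd : ∀ i, pderiv i (fun y => β y * r y) = fun y => pderiv i β y * r y + β y * pderiv i r y :=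
    fun i => funext fun y => pderiv_mul (hβs.differentiable (by simp) y)
      (hr.differentiable (by simp) y) i
  have hdd : ∀ i j, pderiv j (pderiv i (fun y => β y * r y)) = fun y =>
      (pderiv j (pderiv i β) y * r y + pderiv i β y * pderiv j r y)
        + (pderiv j β y * pderiv i r y + β y * pderiv j (pderiv i r) y) := by
    intro i j
    ext y
    have a1 := (contDiff_pderiv hβs i).differentiable (by simp) y
    have a2 := (contDiff_pderiv hr i).differentiable (by simp) y
    have a3 := hβs.differentiable (by simp) y
    have a4 := hr.differentiable (by simp) y
    rw [hd, pderiv_add (a1.fun_mul a4) (a3.fun_mul a2), pderiv_mul a1 a4, pderiv_mul a3 a2]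
  have hsupp : tsupport (fun y => β y * r y) ⊆ Metric.closedBall x (2 * ε) := by
    refine closure_minimal (fun y hy => ?_) Metric.isClosed_closedBall
    by_contra h
    refine hy ?_
    have : ε⁻¹ • (y - x) ∉ tsupport η := fun h' => h (by
      have := hηs h'
      rw [mem_closedBall_zero_iff, norm_smul, norm_inv, Real.norm_of_nonneg e0.le,
        inv_mul_le_iff₀ e0] at this
      rw [Metric.mem_closedBall, dist_eq_norm]
      linarith)
    simp [hβ, scaledBump, image_eq_zero_of_notMem_tsupport this]
  have hz : ∀ {f : Plane → ℝ}, tsupport f ⊆ tsupport (fun y => β y * r y) →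
      ∀ y, y ∉ Metric.closedBall x (2 * ε) → f y = 0 := fun hf y hy =>
    image_eq_zero_of_notMem_tsupport fun h => hy (hsupp (hf h))
  have hq : 0 ≤ N * M := by positivity
  have key : ∀ y ∈ Metric.closedBall x (2 * ε), |β y * r y| ≤ 25 * (N * M) ∧
      (∀ i, |pderiv i β y * r y + β y * pderiv i r y| ≤ 25 * (N * M)) ∧
      ∀ i j, |(pderiv j (pderiv i β) y * r y + pderiv i β y * pderiv j r y)
        + (pderiv j β y * pderiv i r y + β y * pderiv j (pderiv i r) y)| ≤ 25 * (N * M) := by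
    intro y hy
    obtain ⟨t0, t1, t2⟩ := hT y (Metric.closedBall_subset_closedBall e1 hy)
    have hn : ‖y - x‖ ≤ 2 * ε := by simpa [dist_eq_norm] using hy
    have t0' : |r y| ≤ 16 * M * ε ^ 2 := t0.trans (by
      calc 4 * M * ‖y - x‖ ^ 2 ≤ 4 * M * (2 * ε) ^ 2 := by gcongr
        _ = _ := by ring)
    have t1' : ∀ i, |pderiv i r y| ≤ 4 * M * ε := fun i => (t1 i).trans (by
      calc 2 * M * ‖y - x‖ ≤ 2 * M * (2 * ε) := by gcongr
        _ = _ := by ring)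
    have c0 : |β y| ≤ N := b0 _
    have c1 : ∀ i, |pderiv i β y| ≤ ε⁻¹ * N := fun i => by
      rw [dβ, abs_mul, abs_of_pos (inv_pos.2 e0)]
      gcongr
      exact b1 i _
    have c2 : ∀ i j, |pderiv j (pderiv i β) y| ≤ ε⁻¹ * (ε⁻¹ * N) := fun i j => by
      rw [ddβ, abs_mul, abs_mul, abs_of_pos (inv_pos.2 e0)]
      gcongr
      exact b2 i j _
    have hεs : ε ^ 2 ≤ 1 := by nlinarith
    have hε1 : ε ≤ 1 := by linarith
    have m00 : |β y * r y| ≤ 16 * (N * M) * ε ^ 2 := by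
      rw [abs_mul]
      calc _ ≤ N * (16 * M * ε ^ 2) := by gcongr
        _ = _ := by ring
    have m10 : ∀ i, |pderiv i β y * r y| ≤ 16 * (N * M) * ε := fun i => by
      rw [abs_mul]
      calc _ ≤ (ε⁻¹ * N) * (16 * M * ε ^ 2) := by gcongr; exact c1 i
        _ = _ := by field_simp
    have m01 : ∀ i, |β y * pderiv i r y| ≤ 4 * (N * M) * ε := fun i => by
      rw [abs_mul]
      calc _ ≤ N * (4 * M * ε) := by gcongr; exact t1' i
        _ = _ := by ring
    have m20 : ∀ i j, |pderiv j (pderiv i β) y * r y| ≤ 16 * (N * M) := fun i j => by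
      rw [abs_mul]
      calc _ ≤ (ε⁻¹ * (ε⁻¹ * N)) * (16 * M * ε ^ 2) := by gcongr; exact c2 i j
        _ = _ := by field_simp
    have m11 : ∀ i j, |pderiv i β y * pderiv j r y| ≤ 4 * (N * M) := fun i j => by
      rw [abs_mul]
      calc _ ≤ (ε⁻¹ * N) * (4 * M * ε) := by
            gcongr
            · exact c1 i
            · exact t1' j
        _ = _ := by field_simp
    have m02 : ∀ i j, |β y * pderiv j (pderiv i r) y| ≤ N * M := fun i j => by
      rw [abs_mul]
      gcongr
      exact t2 i j
    refine ⟨m00.trans (by nlinarith), fun i => (abs_add_le _ _).trans ?_, fun i j =>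
      (abs_add_le _ _).trans ?_⟩
    · nlinarith [m10 i, m01 i]
    · linarith [m20 i j, m11 i j, m11 j i, m02 i j,
        abs_add_le (pderiv j (pderiv i β) y * r y) (pderiv i β y * pderiv j r y),
        abs_add_le (pderiv j β y * pderiv i r y) (β y * pderiv j (pderiv i r) y)]
  refine HasH2Bound.mono ⟨fun i => pderiv i (fun y => β y * r y),
    fun i j => pderiv j (pderiv i (fun y => β y * r y)),
    fun i => IsWeakPartial.of_contDiff (hprod.of_le (by norm_cast)),
    fun i j => IsWeakPartial.of_contDiff ((contDiff_pderiv hprod i).of_le (by norm_cast)),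
    ?_, fun i => ?_, fun i j => ?_⟩ hε.le
  · rw [Measure.restrict_univ]
    exact eLpNorm_le_of_bounded_of_support (hz le_rfl) fun y hy => (key y hy).1
  · rw [Measure.restrict_univ]
    refine eLpNorm_le_of_bounded_of_support (hz (tsupport_pderiv_subset _ _)) fun y hy => ?_
    simp only [hd]
    exact (key y hy).2.1 i
  · rw [Measure.restrict_univ]
    refine eLpNorm_le_of_bounded_of_support
      (hz ((tsupport_pderiv_subset _ _).trans (tsupport_pderiv_subset _ _))) fun y hy => ?_
    simp only [hdd]
    exact (key y hy).2.2 i j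

/-- The remainder of `φ` at `x` after its first-order Taylor polynomial. -/
noncomputable def taylorRemainder (φ : Plane → ℝ) (x y : Plane) : ℝ :=
  φ y - φ x - fderiv ℝ φ x (y - x)

theorem contDiff_taylorRemainder {φ : Plane → ℝ} (hφ : ContDiff ℝ ∞ φ) (x : Plane) :
    ContDiff ℝ ∞ (taylorRemainder φ x) :=
  (hφ.sub contDiff_const).sub ((fderiv ℝ φ x).contDiff.comp (contDiff_id.sub contDiff_const))

theorem pderiv_taylorRemainder {φ : Plane → ℝ} (hφ : ContDiff ℝ ∞ φ) (x : Plane) (i : Fin 2) :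
    pderiv i (taylorRemainder φ x) x = 0 := by
  have h1 : HasFDerivAt φ (fderiv ℝ φ x) x := (hφ.differentiable (by simp) x).hasFDerivAt
  have h2 : HasFDerivAt (fun y => fderiv ℝ φ x (y - x)) (fderiv ℝ φ x) x :=
    ((fderiv ℝ φ x).hasFDerivAt.comp x ((hasFDerivAt_id x).sub_const x)).congr_fderiv
      (ContinuousLinearMap.comp_id _)
  have h3 : HasFDerivAt (taylorRemainder φ x) (fderiv ℝ φ x - fderiv ℝ φ x) x :=
    (h1.sub_const (φ x)).sub h2
  rw [pderiv, h3.fderiv]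
  simp

/-- Small balls around the points are contained in `Ω` and well separated. -/
theorem eventually_closedBall_subset_and_separated {Ω : Set Plane} (hΩ : IsOpen Ω) {n : ℕ}
    {x : Fin n → Plane} (hx : Function.Injective x) (hxΩ : ∀ j, x j ∈ Ω) :
    ∀ᶠ ε in 𝓝[>] (0 : ℝ), (∀ j, Metric.closedBall (x j) (2 * ε) ⊆ Ω) ∧
      ∀ j k, j ≠ k → 4 * ε ≤ dist (x j) (x k) := by
  refine (eventually_all.2 fun j => ?_).and (eventually_all.2 fun j => eventually_all.2 fun k => ?_)
  · obtain ⟨s, hs, hsΩ⟩ := Metric.isOpen_iff.1 hΩ _ (hxΩ j)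
    filter_upwards [Ioo_mem_nhdsGT (show 0 < s / 2 by positivity)] with ε hε
    exact (Metric.closedBall_subset_ball (by linarith [hε.2])).trans hsΩ
  · by_cases hjk : j = k
    · simp [hjk]
    · have : 0 < dist (x j) (x k) := dist_pos.2 (hx.ne hjk)
      filter_upwards [Ioo_mem_nhdsGT (show 0 < dist (x j) (x k) / 4 by positivity)] with ε hε _
      linarith [hε.2]

/-- Test functions that are affine near each of finitely many given points are dense, in the `H²`
norm, among all test functions. -/
theorem exists_testFunction_affine_near {Ω : Set Plane} (hΩ : IsOpen Ω) {n : ℕ} {x : Fin n → Plane}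
    (hx : Function.Injective x) (hxΩ : ∀ j, x j ∈ Ω) {φ : Plane → ℝ} (hφ : IsTestFunction Ω φ)
    {δ : ℝ≥0∞} (hδ : 0 < δ) : ∃ ψ, IsTestFunction Ω ψ ∧ HasH2Bound Ω (fun y => ψ y - φ y) δ ∧
      ∃ ε > 0, ∀ j, ∃ a : Plane →ᵃ[ℝ] ℝ, ∀ y ∈ Metric.ball (x j) ε, ψ y = a y := by
  let η : ContDiffBump (0 : Plane) := ⟨1, 2, one_pos, one_lt_two⟩
  have hηs : tsupport η = Metric.closedBall 0 2 := η.tsupport_eq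
  have hn : (0 : ℝ≥0∞) < δ / (n + 1) := ENNReal.div_pos hδ.ne' (by simp)
  have hbd : ∀ᶠ ε in 𝓝[>] (0 : ℝ), ∀ j, HasH2Bound Set.univ
      (fun y => scaledBump η (x j) ε y * taylorRemainder φ (x j) y) (δ / (n + 1)) :=
    eventually_all.2 fun j => eventually_scaledBump_mul_bound η.contDiff hηs.le
      (contDiff_taylorRemainder hφ.smooth _) (by simp [taylorRemainder])
      (pderiv_taylorRemainder hφ.smooth _) hn
  obtain ⟨ε, ⟨⟨h1, h2⟩, h3⟩, hε⟩ :=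
    ((eventually_closedBall_subset_and_separated hΩ hx hxΩ).and hbd).and
      self_mem_nhdsWithin |>.exists
  have hε : 0 < ε := hε
  set c : Fin n → Plane → ℝ := fun j y => scaledBump η (x j) ε y * taylorRemainder φ (x j) y with hc
  have hzero : ∀ j y, y ∉ Metric.closedBall (x j) (2 * ε) → scaledBump η (x j) ε y = 0 := by
    intro j y hy
    refine image_eq_zero_of_notMem_tsupport (f := η) (x := ε⁻¹ • (y - x j)) fun h => hy ?_
    rw [hηs, mem_closedBall_zero_iff, norm_smul, norm_inv, Real.norm_of_nonneg hε.le,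
      inv_mul_le_iff₀ hε] at h
    rw [Metric.mem_closedBall, dist_eq_norm]
    linarith
  have hct : ∀ j, IsTestFunction Ω (c j) := fun j =>
    IsTestFunction.of_eq_zero_off_compact (isCompact_closedBall _ _) (h1 j)
      ((contDiff_scaledBump η.contDiff _ _).mul (contDiff_taylorRemainder hφ.smooth _))
      fun y hy => by simp [hc, hzero j y hy]
  have hsum := IsTestFunction.sum Finset.univ fun j _ => hct j
  refine ⟨fun y => φ y + (-1) * ∑ j, c j y, hφ.add (hsum.mul_left contDiff_const), ?_, ε, hε,
    fun k => ?_⟩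
  · have hb := ((HasH2Bound.sum Finset.univ fun j (_ : j ∈ Finset.univ) => h3 j).const_mul (-1)
      ).mono_set (Set.subset_univ Ω)
    refine HasH2Bound.mono (δ := ‖(-1 : ℝ)‖ₑ * ∑ _j : Fin n, δ / (n + 1)) ?_ ?_
    · convert hb using 1
      ext y; simp [hc]
    · simp only [enorm_neg, enorm_one, one_mul, Finset.sum_const, Finset.card_univ,
        Fintype.card_fin, nsmul_eq_mul]
      calc (n : ℝ≥0∞) * (δ / (n + 1)) ≤ (n + 1) * (δ / (n + 1)) := by gcongr; exact le_self_add
        _ ≤ δ := ENNReal.mul_div_le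
  · let a : Plane →ᵃ[ℝ] ℝ := AffineMap.const ℝ Plane (φ (x k) - fderiv ℝ φ (x k) (x k))
      + ((fderiv ℝ φ (x k) : Plane →ₗ[ℝ] ℝ)).toAffineMap
    refine ⟨a, fun y hy => ?_⟩
    have hyk : ‖y - x k‖ < ε := by simpa [dist_eq_norm] using hy
    have hone : scaledBump η (x k) ε y = 1 := by
      refine η.one_of_mem_closedBall ?_
      rw [mem_closedBall_zero_iff, norm_smul, norm_inv, Real.norm_of_nonneg hε.le,
        inv_mul_le_iff₀ hε]
      change ‖y - x k‖ ≤ ε * 1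
      linarith
    have hother : ∀ j, j ≠ k → c j y = 0 := by
      intro j hj
      have : y ∉ Metric.closedBall (x j) (2 * ε) := by
        intro h
        have h4 := h2 j k hj
        have h5 := dist_triangle_left (x j) (x k) y
        rw [Metric.mem_closedBall] at h
        rw [Metric.mem_ball] at hy
        linarith
      simp [hc, hzero j y this]
    change φ y + -1 * ∑ j, c j y = a y
    rw [Finset.sum_eq_single k (fun j _ hj => hother j hj) (by simp)]
    simp only [hc, hone, taylorRemainder, a, one_mul, map_sub]
    simp
    ring

/-! ### The recovery sequence -/

/-- A function in `H²₀(Ω)` is the limit, as `ε → 0`, of test functions `ψ ε` that are affine in the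
balls of radius `ε` around finitely many given points. -/
theorem MemH20.exists_tendsto_affine_in_balls {Ω : Set Plane} (hΩ : IsOpen Ω) {n : ℕ}
    {x : Fin n → Plane} (hx : Function.Injective x) (hxΩ : ∀ j, x j ∈ Ω) {v : Plane → ℝ}
    (hv : MemH20 Ω v) : ∃ ψ : ℝ → Plane → ℝ, (∀ ε, 0 < ε → IsTestFunction Ω (ψ ε) ∧
      ∀ j, ∃ a : Plane →ᵃ[ℝ] ℝ, ∀ y ∈ Metric.ball (x j) ε, ψ ε y = a y) ∧
      Tendsto (fun ε => eH2Norm Ω (fun y => ψ ε y - v y)) (𝓝[>] 0) (𝓝 0) := by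
  let S : ℝ → Set (Plane → ℝ) := fun ε => {ψ | IsTestFunction Ω ψ ∧
    ∀ j, ∃ a : Plane →ᵃ[ℝ] ℝ, ∀ y ∈ Metric.ball (x j) ε, ψ y = a y}
  let d : (Plane → ℝ) → ℝ≥0∞ := fun ψ => eH2Norm Ω (fun y => ψ y - v y)
  -- for each `ε`, an admissible test function whose distance from `v` is minimal up to `ε`
  have hex : ∀ ε : ℝ, ∃ ψ, 0 < ε → ψ ∈ S ε ∧ ∀ φ ∈ S ε, d ψ ≤ d φ + ENNReal.ofReal ε := by
    intro ε
    by_contra! h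
    obtain ⟨hε, -⟩ := h (fun _ => 0)
    have hlt : ∀ ψ ∈ S ε, (⨅ φ ∈ S ε, d φ) + ENNReal.ofReal ε < d ψ := fun ψ hψ => by
      obtain ⟨φ, hφ, hlt⟩ := (h ψ).2 hψ
      exact lt_of_le_of_lt (add_le_add_left (iInf₂_le φ hφ) _) hlt
    have h0 := hlt (fun _ => 0) ⟨IsTestFunction.zero, fun j => ⟨0, fun y _ => rfl⟩⟩
    have hfin : (⨅ φ ∈ S ε, d φ) ≠ ⊤ := ne_top_of_le_ne_top h0.ne_top le_self_add
    exact (ENNReal.lt_add_right hfin (ENNReal.ofReal_pos.2 hε).ne').not_ge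
      (le_iInf₂ fun ψ hψ => (hlt ψ hψ).le)
  choose ψ hψ using hex
  refine ⟨ψ, fun ε hε => (hψ ε hε).1, ENNReal.tendsto_nhds_zero.2 fun δ hδ => ?_⟩
  -- one half of `δ` is left for the defect of minimality; the other is shared by two approximations
  -- and has to absorb the factor of `HasH2Bound.eH2Norm_le`
  have hδ' : 0 < δ / 2 / 3 / 2 :=
    ENNReal.half_pos (ENNReal.div_pos (ENNReal.half_pos hδ.ne').ne' (by norm_num)).ne'
  obtain ⟨φ, hφ, hφv⟩ := (memH20_iff.1 hv).2 _ hδ'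
  obtain ⟨χ, hχ, hχφ, ε₀, hε₀, ha⟩ := exists_testFunction_affine_near hΩ hx hxΩ hφ hδ'
  have hdχ : d χ ≤ δ / 2 := by
    have hb : HasH2Bound Ω (fun y => χ y - v y) (δ / 2 / 3) := by
      have := hχφ.add hφv
      rw [ENNReal.add_halves] at this
      simpa using this
    exact hb.eH2Norm_le.trans ENNReal.mul_div_le
  have hsmall : ∀ᶠ ε in 𝓝[>] (0 : ℝ), ENNReal.ofReal ε < δ / 2 := by
    have h := ((ENNReal.continuous_ofReal.tendsto 0).mono_left
      (nhdsWithin_le_nhds (s := Set.Ioi 0)))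
    rw [ENNReal.ofReal_zero] at h
    exact h.eventually (gt_mem_nhds (ENNReal.half_pos hδ.ne'))
  filter_upwards [hsmall, Ioo_mem_nhdsGT hε₀] with ε h1 h2
  have hmem : χ ∈ S ε := ⟨hχ, fun j => (ha j).imp fun a h y hy =>
    h y (Metric.ball_subset_ball h2.2.le hy)⟩
  calc d (ψ ε) ≤ d χ + ENNReal.ofReal ε := (hψ ε h2.1).2 χ hmem
    _ ≤ δ / 2 + δ / 2 := by gcongr
    _ = δ := ENNReal.add_halves δ

theorem propositionE1 (Ω : Set Plane) (hopen : IsOpen Ω) (hbdd : Bornology.IsBounded Ω)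
    (hsc : SimplyConnectedSpace Ω) (hC2 : HasBoundaryOfClass 2 Ω)
    (E ν : ℝ) (hE : 0 < E) (hν : -1 < ν) (hν' : ν < 1 / 2)
    (α : EdgeDislocations Ω) (R : ℝ) (hR : 0 < R)
    (hΩR : ∀ j, closure Ω ⊆ Metric.ball (α.x j) R)
    (w : Plane → ℝ) (hw : w ∈ classB0 α E ν R) :
    ∃ wε : ℝ → Plane → ℝ,
      (∀ ε, 0 < ε → MemH2 Ω (wε ε)) ∧
      (∀ᶠ ε in 𝓝[>] (0 : ℝ), wε ε ∈ classBε α E ν R ε) ∧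
      (∀ᶠ ε in 𝓝[>] (0 : ℝ),
        HasCauchyData Ω (fun y => wε ε y + plasticW α E ν R ε y) (fun _ => 0)) ∧
      Tendsto (fun ε => eH2Norm Ω (fun y => wε ε y - w y)) (𝓝[>] (0 : ℝ)) (𝓝 0) := by
  obtain ⟨ρ, ⟨hρΩ, hsep⟩, hρ⟩ := ((eventually_closedBall_subset_and_separated hopen α.x_injective
    α.x_mem).and self_mem_nhdsWithin).exists
  have hρ : 0 < ρ := hρ
  let η : ∀ j, ContDiffBump (α.x j) := fun j => ⟨ρ, 2 * ρ, hρ, by linarith⟩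
  have hηt : ∀ j, IsTestFunction Ω (η j) := fun j =>
    ⟨(η j).contDiff, (η j).hasCompactSupport, by rw [(η j).tsupport_eq]; exact hρΩ j⟩
  have hη0 : ∀ j y, y ∉ Metric.closedBall (α.x j) (2 * ρ) → η j y = 0 := fun j y hy =>
    image_eq_zero_of_notMem_tsupport (by rwa [(η j).tsupport_eq])
  have hη1 : ∀ j, ∀ y ∈ Metric.closedBall (α.x j) ρ, η j y = 1 := fun j y hy =>
    (η j).one_of_mem_closedBall hy
  let χ : Fin α.J → Plane → ℝ := fun j y => 1 - η j y
  have hχ : ∀ j, ContDiff ℝ ∞ (χ j) := fun j => contDiff_const.sub (η j).contDiff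
  have hχ0 : ∀ j, ∀ y ∈ Metric.closedBall (α.x j) ρ, χ j y = 0 := fun j y hy => by
    simp [χ, hη1 j y hy]
  have hχe : ∀ j, χ j =ᶠ[𝓝 (α.x j)] fun _ => 0 := fun j => by
    filter_upwards [Metric.closedBall_mem_nhds _ hρ] with y hy using hχ0 j y hy
  let F : Plane → ℝ := fun y => ∑ j, χ j y * airyLimit E ν R (α.b j) (y - α.x j)
  have hF : ContDiff ℝ ∞ F := ContDiff.sum fun j _ =>
    contDiff_cutoff_mul_airyLimit (hχ j) (hχe j) E ν R (α.b j)
  -- `F` is smooth everywhere and coincides with `W_0^α` near the boundary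
  have hWF : ∀ x ∈ frontier Ω, (fun y => - plasticW0 α E ν R y) =ᶠ[𝓝 x] fun y => - F y := by
    intro x hx
    have hxΩ : x ∉ Ω := fun h => hx.2 (hopen.interior_eq.symm ▸ h)
    have : ∀ᶠ y in 𝓝 x, ∀ j, y ∉ Metric.closedBall (α.x j) (2 * ρ) := eventually_all.2 fun j =>
      Metric.isClosed_closedBall.isOpen_compl.mem_nhds fun h => hxΩ (hρΩ j h)
    filter_upwards [this] with y hy
    rw [plasticW0_eq α E ν hR]
    simp [F, χ, hη0 _ y (hy _)]
  have hv2 : MemH2 Ω (fun y => w y + F y) := hw.1.add (memH2_of_contDiff hbdd hF)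
  have hv : MemH20 Ω (fun y => w y + F y) := hv2.memH20_of_hasCauchyData_zero hopen hbdd hC2
    (hw.2.add_contDiff_eq_zero hopen hbdd hC2 hF hWF)
  obtain ⟨ψ, hψ, hlim⟩ := hv.exists_tendsto_affine_in_balls hopen α.x_injective α.x_mem
  let W : ℝ → Fin α.J → Plane → ℝ := fun ε j y => airyVector E ν R ε (α.b j) (y - α.x j)
  have hWsum : ∀ ε y, plasticW α E ν R ε y = ∑ j, W ε j y := fun _ _ => rfl
  -- beyond `ε = ρ`, where nothing is claimed, any function in `H²` will do
  let wε : ℝ → Plane → ℝ := fun ε => if ε ≤ ρ then fun y => ψ ε y - ∑ j, χ j y * W ε j y else w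
  have hwε : ∀ ε, ε ≤ ρ → wε ε = fun y => ψ ε y - ∑ j, χ j y * W ε j y := fun ε h => if_pos h
  have hadd : ∀ ε, ε ≤ ρ → ∀ y,
      wε ε y + plasticW α E ν R ε y = ψ ε y + ∑ j, η j y * W ε j y := by
    intro ε h y
    have : ∑ j, χ j y * W ε j y = ∑ j, W ε j y - ∑ j, η j y * W ε j y := by
      rw [← Finset.sum_sub_distrib]
      exact Finset.sum_congr rfl fun j _ => by simp only [χ]; ring
    rw [hwε ε h, hWsum]
    change ψ ε y - ∑ j, χ j y * W ε j y + _ = _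
    rw [this]
    ring
  have hrange : ∀ᶠ ε in 𝓝[>] (0 : ℝ), 0 < ε ∧ ε ≤ ρ := by
    filter_upwards [Ioo_mem_nhdsGT hρ] with ε hε using ⟨hε.1, hε.2.le⟩
  have h20 : ∀ ε, 0 < ε → ε ≤ ρ → MemH20 Ω (fun y => wε ε y + plasticW α E ν R ε y) := by
    intro ε h0 h
    rw [funext (hadd ε h)]
    exact ((hψ ε h0).1.memH20 hbdd).add (MemH20.sum hbdd _ fun j _ =>
      memH20_mul_airyVector hopen (α.b_ne_zero j) h0 _ (hηt j))
  refine ⟨wε, fun ε h0 => ?_, ?_, ?_, ENNReal.tendsto_nhds_zero.2 fun δ hδ => ?_⟩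
  · by_cases h : ε ≤ ρ
    · rw [hwε ε h]
      exact memH2_of_contDiff hbdd ((hψ ε h0).1.smooth.sub (ContDiff.sum fun j _ =>
        contDiff_cutoff_mul_airyVector (hχ j) (hχ0 j) (α.b_ne_zero j) h0 h))
    · simpa only [wε, if_neg h] using hw.1
  · filter_upwards [hrange] with ε ⟨h0, h⟩
    refine ⟨h20 ε h0 h, fun k => ?_⟩
    obtain ⟨a, ha⟩ := (hψ ε h0).2 k
    let L : Plane →ᵃ[ℝ] ℝ := ((airyCoeff E ν (α.b k) * airyOuter R ε (ε ^ 2)) •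
      (innerSL ℝ (airyDirection (α.b k)) : Plane →ₗ[ℝ] ℝ)).toAffineMap.comp
        (AffineMap.id ℝ Plane - AffineMap.const ℝ Plane (α.x k))
    refine ⟨a + L, (ae_restrict_mem Metric.isOpen_ball.measurableSet).mono fun y hy => ?_⟩
    have hyk : dist y (α.x k) < ε := hy
    have hother : ∀ j, j ≠ k → η j y * W ε j y = 0 := by
      intro j hj
      rw [hη0 j y, zero_mul]
      intro hyj
      have h4 := hsep j k hj
      have h5 := dist_triangle_left (α.x j) (α.x k) y
      rw [Metric.mem_closedBall] at hyj
      linarith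
    rw [hadd ε h, ha y hy, Finset.sum_eq_single k (fun j _ hj => hother j hj) (by simp),
      hη1 k y (hyk.le.trans h), one_mul]
    simp only [W]
    rw [airyVector_core (α.b_ne_zero k) h0 (by rwa [← dist_eq_norm])]
    simp [L]
  · filter_upwards [hrange] with ε ⟨h0, h⟩ using (h20 ε h0 h).hasCauchyData_zero hopen
  · have hδ' : 0 < δ / (3 * (α.J + 1)) := ENNReal.div_pos hδ.ne'
      (ENNReal.mul_ne_top (by norm_num) (by simp))
    have hcut := eventually_all.2 fun j => eventually_cutoff_airyVector_sub_bound hbdd (hχ j) hρ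
      (hχ0 j) E ν hR (α.b_ne_zero j) hδ'
    filter_upwards [hrange, hcut, hlim.eventually (gt_mem_nhds hδ')] with ε ⟨_, h⟩ h1 h2
    have hb := (hasH2Bound_of_eH2Norm_lt h2).sub (HasH2Bound.sum Finset.univ fun j _ => h1 j)
    have he : (fun y => wε ε y - w y) = fun y => ψ ε y - (w y + F y) - ∑ j,
        (χ j y * airyVector E ν R ε (α.b j) (y - α.x j)
          - χ j y * airyLimit E ν R (α.b j) (y - α.x j)) := by
      ext y
      rw [hwε ε h, Finset.sum_sub_distrib]
      simp only [F, W]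
      ring
    rw [he]
    refine hb.eH2Norm_le.trans (le_trans (le_of_eq ?_) (ENNReal.mul_div_le (a := 3 * (α.J + 1))))
    rw [Finset.sum_const, Finset.card_univ, Fintype.card_fin, nsmul_eq_mul]
    ring
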